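/- Let $X$ be a smooth manifold (all manifolds are Hausdorff and second countable) with a regular smooth foliation $\mathcal F$ of dimension $d$ and codimension $q$, and let $g$ be a transversely Riemannian metric on $(X,\mathcal F)$, that is, a smooth symmetric $(0,2)$-tensor on $X$ such that $\iota_Y g=0$ and $\mathcal L_Y g=0$ for all vector fields $Y$ tangent to $\mathcal F$, and such that $g$ is positive definite on the normal bundle $TX/T\mathcal F$. Let $p:\hat X\to X$ be a cover by a connected manifold $\hat X$ which is Galois, i.e. its group $\Gamma$ of deck transformations acts transitively on the fibres of $p$. Suppose that $p$ develops $\mathcal F$: there is a surjective submersion $f:\hat X\to M$ onto a manifold $M$ whose fibres are exactly the leaves of the pullback foliation $p^{-1}(\mathcal F)$, so that $M$ is the leaf space of $p^{-1}(\mathcal F)$. The group $\Gamma$ acts on $M$ by $\gamma\cdot f(\hat x)=f(\gamma\cdot\hat x)$. Let $\Gamma_M$ be the normal subgroup of the elements of $\Gamma$ that act trivially on $M$, let $\Gamma_{\mathrm{eff}}:=\Gamma/\Gamma_M$ (a discrete group), and let $\Gamma_{\mathrm{eff}}\ltimes M\rightrightarrows M$ be the action groupoid. Then the holonomy groupoid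 $\mathrm{Hol}(\mathcal F)\rightrightarrows X$, whose arrows are the holonomy classes of leafwise paths, with its standard smooth structure of dimension $2d+q$, is Morita equivalent to $\Gamma_{\mathrm{eff}}\ltimes M$. Here two Lie groupoids $G,H$ (whose arrow spaces need be neither Hausdorff nor second countable) are Morita equivalent if there are a Lie groupoid $K$ and Morita maps $K\to G$ and $K\to H$; a Morita map is a smooth functor that induces a homeomorphism of orbit spaces, isomorphisms of the isotropy Lie groups, and isomorphisms of the normal spaces to the orbits. -/

import Mathlib

open Set Filter Topology Manifold
open scoped ContDiff

universe u

noncomputable section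

namespace FolGpd

/-- The model space `ℝⁿ`. -/
abbrev RR (n : ℕ) : Type := EuclideanSpace ℝ (Fin n)

/-! ### Lie groupoids -/

/-- A groupoid with set of objects `B` and set of arrows `A`, presented by its structure maps.
`mul g h` is the composite `g ∘ h` ("first `h`, then `g`"), defined when `src g = tgt h`. -/
structure Gpd (B A : Type u) where
  src : A → B
  tgt : A → B
  one : B → A
  inv : A → A
  mul : ∀ g h : A, src g = tgt h → A
  src_one : ∀ x, src (one x) = x
  tgt_one : ∀ x, tgt (one x) = x
  src_inv : ∀ g, src (inv g) = tgt g
  tgt_inv : ∀ g, tgt (inv g) = src g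
  src_mul : ∀ g h w, src (mul g h w) = src h
  tgt_mul : ∀ g h w, tgt (mul g h w) = tgt g
  one_mul : ∀ g, mul (one (tgt g)) g (src_one _) = g
  mul_one : ∀ g, mul g (one (src g)) (tgt_one _).symm = g
  mul_assoc : ∀ g h k (w : src g = tgt h) (w' : src h = tgt k),
    mul (mul g h w) k ((src_mul _ _ _).trans w') = mul g (mul h k w') (w.trans (tgt_mul _ _ _).symm)
  inv_mul : ∀ g, mul (inv g) g (src_inv _) = one (src g)
  mul_inv : ∀ g, mul g (inv g) (tgt_inv _).symm = one (tgt g)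

namespace Gpd

section Algebra

variable {B A : Type u} (G : Gpd B A)

/-- Two objects are in the same orbit if some arrow joins them. -/
def orbitSetoid : Setoid B where
  r x y := ∃ g, G.src g = x ∧ G.tgt g = y
  iseqv :=
    { refl := fun x => ⟨G.one x, G.src_one x, G.tgt_one x⟩
      symm := by
        rintro x y ⟨g, h₁, h₂⟩
        exact ⟨G.inv g, (G.src_inv g).trans h₂, (G.tgt_inv g).trans h₁⟩
      trans := by
        rintro x y z ⟨g, h₁, h₂⟩ ⟨k, h₃, h₄⟩
        exact ⟨G.mul k g (h₃.trans h₂.symm), (G.src_mul _ _ _).trans h₁,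
          (G.tgt_mul _ _ _).trans h₄⟩ }

/-- The orbit space, with the quotient topology. -/
abbrev OrbitSpace : Type u := Quotient G.orbitSetoid

/-- The isotropy group at `x`, as a set of arrows. -/
def isotropy (x : B) : Set A := {g | G.src g = x ∧ G.tgt g = x}

variable {B' A' : Type u} (G' : Gpd B' A')

/-- `(f, φ)` is a functor from `G` to `G'`. -/
structure IsFunctor (f : B → B') (φ : A → A') : Prop where
  src_map : ∀ g, G'.src (φ g) = f (G.src g)
  tgt_map : ∀ g, G'.tgt (φ g) = f (G.tgt g)
  map_one : ∀ x, φ (G.one x) = G'.one (f x)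
  map_mul : ∀ g h (w : G.src g = G.tgt h),
    φ (G.mul g h w) = G'.mul (φ g) (φ h) ((src_map g).trans ((congrArg f w).trans (tgt_map h).symm))

variable {G G'}

/-- The map of orbit spaces induced by a functor. -/
def IsFunctor.orbitMap {f : B → B'} {φ : A → A'} (h : IsFunctor G G' f φ) :
    G.OrbitSpace → G'.OrbitSpace :=
  Quotient.map f (by
    rintro x y ⟨g, h₁, h₂⟩
    exact ⟨φ g, (h.src_map g).trans (congrArg f h₁), (h.tgt_map g).trans (congrArg f h₂)⟩)

end Algebra

section Smooth

variable (b a : ℕ) {B A : Type u}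
  [TopologicalSpace B] [ChartedSpace (RR b) B] [TopologicalSpace A] [ChartedSpace (RR a) A]

open Classical in
/-- `G` is a Lie groupoid: objects form a (Hausdorff, second countable) manifold, arrows form a
manifold that need be neither Hausdorff nor second countable, the structure maps are smooth, source
and target are (automatically surjective) submersions with Hausdorff fibres.
Smoothness of the multiplication is smoothness on the embedded submanifold of composable pairs. -/
structure IsLie (G : Gpd B A) : Prop where
  obj_t2 : T2Space B
  obj_second_countable : SecondCountableTopology B
  obj_manifold : IsManifold 𝓘(ℝ, RR b) ∞ B
  arr_manifold : IsManifold 𝓘(ℝ, RR a) ∞ A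
  smooth_src : ContMDiff 𝓘(ℝ, RR a) 𝓘(ℝ, RR b) ∞ G.src
  smooth_tgt : ContMDiff 𝓘(ℝ, RR a) 𝓘(ℝ, RR b) ∞ G.tgt
  submersion_src : ∀ g, Function.Surjective (mfderiv 𝓘(ℝ, RR a) 𝓘(ℝ, RR b) G.src g)
  submersion_tgt : ∀ g, Function.Surjective (mfderiv 𝓘(ℝ, RR a) 𝓘(ℝ, RR b) G.tgt g)
  t2_src_fiber : ∀ x, T2Space (G.src ⁻¹' {x})
  t2_tgt_fiber : ∀ x, T2Space (G.tgt ⁻¹' {x})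
  smooth_one : ContMDiff 𝓘(ℝ, RR b) 𝓘(ℝ, RR a) ∞ G.one
  smooth_inv : ContMDiff 𝓘(ℝ, RR a) 𝓘(ℝ, RR a) ∞ G.inv
  smooth_mul : ContMDiffOn (𝓘(ℝ, RR a).prod 𝓘(ℝ, RR a)) 𝓘(ℝ, RR a) ∞
    (fun r : A × A => if w : G.src r.1 = G.tgt r.2 then G.mul r.1 r.2 w else r.1)
    {r | G.src r.1 = G.tgt r.2}

/-- The tangent space at `x` of the orbit through `x`: the image under `d tgt` of the tangent space
at the unit `1ₓ` of the source fibre. -/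
def orbitTangent (G : Gpd B A) (x : B) : Submodule ℝ (RR b) :=
  Submodule.map
    (show RR a →ₗ[ℝ] RR b from
      (mfderiv 𝓘(ℝ, RR a) 𝓘(ℝ, RR b) G.tgt (G.one x)).toLinearMap)
    (LinearMap.ker (show RR a →ₗ[ℝ] RR b from
      (mfderiv 𝓘(ℝ, RR a) 𝓘(ℝ, RR b) G.src (G.one x)).toLinearMap))

variable (b' a' : ℕ) {B' A' : Type u}
  [TopologicalSpace B'] [ChartedSpace (RR b') B'] [TopologicalSpace A'] [ChartedSpace (RR a') A']

/-- `(f, φ)` is a Morita map: a smooth functor which induces a homeomorphism of orbit spaces,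
isomorphisms of the isotropy (Lie) groups, and isomorphisms of the normal spaces to the orbits. -/
structure IsMoritaMap (G : Gpd B A) (G' : Gpd B' A') (f : B → B') (φ : A → A') : Prop where
  functor : IsFunctor G G' f φ
  smooth_obj : ContMDiff 𝓘(ℝ, RR b) 𝓘(ℝ, RR b') ∞ f
  smooth_arr : ContMDiff 𝓘(ℝ, RR a) 𝓘(ℝ, RR a') ∞ φ
  orbit_homeo : IsHomeomorph functor.orbitMap
  isotropy_bij : ∀ x, BijOn φ (G.isotropy x) (G'.isotropy (f x))
  isotropy_smooth_inv : ∀ x, ∃ ψ : A' → A,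
    ContMDiffOn 𝓘(ℝ, RR a') 𝓘(ℝ, RR a) ∞ ψ (G'.isotropy (f x)) ∧ ∀ g ∈ G.isotropy x, ψ (φ g) = g
  normal_iso : ∀ x, ∃ w : G.orbitTangent b a x ≤ (G'.orbitTangent b' a' (f x)).comap
      (show RR b →ₗ[ℝ] RR b' from (mfderiv 𝓘(ℝ, RR b) 𝓘(ℝ, RR b') f x).toLinearMap),
    Function.Bijective (Submodule.mapQ (G.orbitTangent b a x) (G'.orbitTangent b' a' (f x)) _ w)

/-- Two Lie groupoids are Morita equivalent if a third Lie groupoid has Morita maps to both. -/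
def MoritaEquivalent (G : Gpd B A) (G' : Gpd B' A') : Prop :=
  G.IsLie b a ∧ G'.IsLie b' a' ∧
  ∃ (m n : ℕ) (C D : Type u)
    (_ : TopologicalSpace C) (_ : ChartedSpace (RR m) C)
    (_ : TopologicalSpace D) (_ : ChartedSpace (RR n) D) (K : Gpd C D),
    K.IsLie m n ∧ (∃ f φ, IsMoritaMap m n b a K G f φ) ∧ (∃ f φ, IsMoritaMap m n b' a' K G' f φ)

end Smooth

end Gpd

/-! ### The action groupoid of a discrete group -/

section Action

variable (Γ M : Type u)

/-- The arrows of `Γ ⋉ M`: the set `Γ × M`, where `Γ` is discrete. -/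
def ActionArr : Type u := Γ × M

/-- The product topology on `Γ × M`, with `Γ` discrete. -/
instance [TopologicalSpace M] : TopologicalSpace (ActionArr Γ M) :=
  @instTopologicalSpaceProd Γ M ⊥ _

variable {Γ M}

/-- A chart of `M`, placed on the sheet `{γ} × M` of `Γ × M`. -/
def sheetChart {H : Type*} [TopologicalSpace H] [TopologicalSpace M]
    (γ : Γ) (e : OpenPartialHomeomorph M H) : OpenPartialHomeomorph (ActionArr Γ M) H :=
  letI : TopologicalSpace Γ := ⊥
  haveI : DiscreteTopology Γ := ⟨rfl⟩
  { toFun := fun z => e z.2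
    invFun := fun y => (γ, e.symm y)
    source := {γ} ×ˢ e.source
    target := e.target
    map_source' := fun _ hz => e.map_source hz.2
    map_target' := fun _ hy => ⟨rfl, e.map_target hy⟩
    left_inv' := fun _ hz => Prod.ext hz.1.symm (e.left_inv hz.2)
    right_inv' := fun _ hy => e.right_inv hy
    open_source := (isOpen_discrete ({γ} : Set Γ)).prod e.open_source
    open_target := e.open_target
    continuousOn_toFun := e.continuousOn.comp continuous_snd.continuousOn (fun _ hz => hz.2)
    continuousOn_invFun := (continuousOn_const (c := γ)).prodMk e.continuousOn_symm }

instance {H : Type*} [TopologicalSpace H] [TopologicalSpace M] [ChartedSpace H M] :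
    ChartedSpace H (ActionArr Γ M) where
  atlas := {c | ∃ γ : Γ, ∃ e ∈ atlas H M, c = sheetChart γ e}
  chartAt z := sheetChart z.1 (chartAt H z.2)
  mem_chart_source z := ⟨rfl, mem_chart_source H z.2⟩
  chart_mem_atlas z := ⟨z.1, _, chart_mem_atlas H z.2, rfl⟩

variable (Γ M)

/-- The action groupoid `Γ ⋉ M`: the pair `(γ, m)` is an arrow from `m` to `γ • m`, and
`(γ', m') (γ, m) = (γ' γ, m)`. -/
def actionGroupoid [Group Γ] [MulAction Γ M] : Gpd M (ActionArr Γ M) where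
  src z := z.2
  tgt z := z.1 • z.2
  one m := (1, m)
  inv z := (z.1⁻¹, z.1 • z.2)
  mul z z' _ := (z.1 * z'.1, z'.2)
  src_one _ := rfl
  tgt_one m := one_smul Γ m
  src_inv _ := rfl
  tgt_inv z := inv_smul_smul z.1 z.2
  src_mul _ _ _ := rfl
  tgt_mul z z' w := by
    change (z.1 * z'.1) • z'.2 = z.1 • z.2
    rw [mul_smul, ← show z.2 = z'.1 • z'.2 from w]
  one_mul z := Prod.ext (one_mul z.1) rfl
  mul_one z := Prod.ext (mul_one z.1) rfl
  mul_assoc z z' z'' _ _ := Prod.ext (mul_assoc z.1 z'.1 z''.1) rfl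
  inv_mul z := Prod.ext (inv_mul_cancel z.1) rfl
  mul_inv z := Prod.ext (mul_inv_cancel z.1) rfl

end Action

/-! ### Foliations -/

/-- A (smooth, regular) foliation of dimension `d` and codimension `q` of a manifold `X` of
dimension `d + q`, given by a foliated atlas: smooth charts to `ℝᵈ × ℝ^q`, covering `X`, whose
changes of charts are locally of the form `(x, y) ↦ (g (x, y), h y)`. -/
structure Foliation (d q : ℕ) (X : Type u) [TopologicalSpace X] [ChartedSpace (RR (d + q)) X] where
  charts : Set (OpenPartialHomeomorph X (RR d × RR q))
  cover : ∀ x, ∃ c ∈ charts, x ∈ c.source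
  smooth : ∀ c ∈ charts, ContMDiffOn 𝓘(ℝ, RR (d + q)) 𝓘(ℝ, RR d × RR q) ∞ c c.source
  smooth_symm : ∀ c ∈ charts, ContMDiffOn 𝓘(ℝ, RR d × RR q) 𝓘(ℝ, RR (d + q)) ∞ c.symm c.target
  compat : ∀ c ∈ charts, ∀ c' ∈ charts, ∀ x, x ∈ c.source → x ∈ c'.source →
    ∃ h : RR q → RR q, IsLocalDiffeomorphAt 𝓘(ℝ, RR q) 𝓘(ℝ, RR q) ∞ h (c x).2 ∧
      ∀ᶠ z in 𝓝 x, (c' z).2 = h (c z).2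

namespace Foliation

variable {d q : ℕ} {X : Type u} [TopologicalSpace X] [ChartedSpace (RR (d + q)) X]
  (F : Foliation d q X)

/-- `v` is tangent to the leaf through `x`. -/
def IsTangent (x : X) (v : TangentSpace 𝓘(ℝ, RR (d + q)) x) : Prop :=
  ∀ c ∈ F.charts, x ∈ c.source →
    mfderiv 𝓘(ℝ, RR (d + q)) 𝓘(ℝ, RR q) (fun z => (c z).2) x v = 0

/-- A leafwise path: a path which is continuous for the leaf topology, i.e. which locally stays in
a plaque of each foliated chart. -/
def IsLeafwise {x y : X} (γ : Path x y) : Prop :=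
  ∀ t : unitInterval, ∀ c ∈ F.charts, γ t ∈ c.source → ∀ᶠ τ in 𝓝 t, (c (γ τ)).2 = (c (γ t)).2

/-- Leafwise paths from `x` to `y`. -/
def LeafPath (x y : X) : Type u := {γ : Path x y // F.IsLeafwise γ}

/-- The leaf through `x`. -/
def leaf (x : X) : Set X := {y | Nonempty (F.LeafPath x y)}

/-- The germ of `s` at `x` is a transverse coordinate: a submersion to `ℝ^q` whose fibres are the
plaques near `x`. -/
def IsTransverseAt (s : X → RR q) (x : X) : Prop :=
  ∃ c ∈ F.charts, x ∈ c.source ∧ ∃ h : RR q → RR q,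
    IsLocalDiffeomorphAt 𝓘(ℝ, RR q) 𝓘(ℝ, RR q) ∞ h (c x).2 ∧ ∀ᶠ z in 𝓝 x, s z = h (c z).2

/-- `σ` is a locally constant family of germs of transverse coordinates along the map `γ`. -/
structure IsContinuation {T : Type*} [TopologicalSpace T] (γ : T → X) (σ : T → X → RR q) :
    Prop where
  transverse : ∀ t, F.IsTransverseAt (σ t) (γ t)
  locally_const : ∀ t, ∀ᶠ τ in 𝓝 t, σ τ =ᶠ[𝓝 (γ τ)] σ t

/-- The holonomy of the path `γ` from `x` to `y` carries the germ at `x` of the transverse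
coordinate `a` to the germ at `y` of the transverse coordinate `b`.

If `S`, `S'` are transversals at `x`, `y`, then `a|S` and `b|S'` are local coordinates, and the
holonomy diffeomorphism `S ⇢ S'` obtained by following chains of plaques along `γ` is the germ of
`(b|S')⁻¹ ∘ a|S`. -/
def Transports {x y : X} (γ : Path x y) (a b : X → RR q) : Prop :=
  ∃ σ : unitInterval → X → RR q, F.IsContinuation γ σ ∧ σ 0 =ᶠ[𝓝 x] a ∧ σ 1 =ᶠ[𝓝 y] b

/-- Leafwise paths with the same endpoints are in the same holonomy class if they have the same
holonomy. -/
def holonomySetoid (x y : X) : Setoid (F.LeafPath x y) where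
  r γ γ' := ∀ a b, F.Transports γ.1 a b ↔ F.Transports γ'.1 a b
  iseqv := ⟨fun _ _ _ => Iff.rfl, fun h a b => (h a b).symm,
    fun h h' a b => (h a b).trans (h' a b)⟩

/-- Holonomy classes of leafwise paths from `x` to `y`. -/
def HolClass (x y : X) : Type u := Quotient (F.holonomySetoid x y)

/-- The arrows of the holonomy groupoid. -/
def HolArr : Type u := Σ x y : X, F.HolClass x y

/-! #### Basic properties of holonomy transport, needed for the groupoid laws -/

section Transport

variable {F}

lemma IsContinuation.comp {T T' : Type*} [TopologicalSpace T] [TopologicalSpace T']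
    {γ : T → X} {σ : T → X → RR q} (h : F.IsContinuation γ σ) {f : T' → T} (hf : Continuous f) :
    F.IsContinuation (γ ∘ f) (σ ∘ f) :=
  ⟨fun t => h.transverse (f t), fun t => hf.continuousAt.eventually (h.locally_const (f t))⟩

lemma IsTransverseAt.congr {s s' : X → RR q} {x : X} (h : F.IsTransverseAt s x)
    (e : s' =ᶠ[𝓝 x] s) : F.IsTransverseAt s' x := by
  obtain ⟨c, hc, hx, k, hk, hs⟩ := h
  exact ⟨c, hc, hx, k, hk, by filter_upwards [e, hs] with z h₁ h₂ using h₁.trans h₂⟩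

lemma IsTransverseAt.exists_eq {s : X → RR q} {x : X} (h : F.IsTransverseAt s x)
    {c : OpenPartialHomeomorph X (RR d × RR q)} (hc : c ∈ F.charts) (hx : x ∈ c.source) :
    ∃ k : RR q → RR q, IsLocalDiffeomorphAt 𝓘(ℝ, RR q) 𝓘(ℝ, RR q) ∞ k (c x).2 ∧
      ∀ᶠ z in 𝓝 x, s z = k (c z).2 := by
  obtain ⟨c', hc', hx', k, hk, hs⟩ := h
  obtain ⟨l, hl, hl'⟩ := F.compat c hc c' hc' x hx hx'
  refine ⟨k ∘ l, ?_, ?_⟩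
  · refine hl.comp 𝓘(ℝ, RR q) (RR q) ?_
    rw [← hl'.self_of_nhds]
    exact hk
  · filter_upwards [hs, hl'] with z h₁ h₂
    rw [h₁, h₂]; rfl

lemma map_snd_chart {Y : Type u} [TopologicalSpace Y]
    (c : OpenPartialHomeomorph Y (RR d × RR q)) {x : Y} (hx : x ∈ c.source) :
    Filter.map (fun z => (c z).2) (𝓝 x) = 𝓝 (c x).2 := by
  have : (fun z => (c z).2) = Prod.snd ∘ c := rfl
  rw [this, ← Filter.map_map, c.map_nhds_eq hx, map_snd_nhds]

lemma comp_eventuallyEq_iff {Y : Type u} [TopologicalSpace Y]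
    (c : OpenPartialHomeomorph Y (RR d × RR q)) {x : Y}
    (hx : x ∈ c.source) (k l : RR q → RR q) :
    ((fun z => k (c z).2) =ᶠ[𝓝 x] fun z => l (c z).2) ↔ k =ᶠ[𝓝 (c x).2] l := by
  rw [← map_snd_chart c hx]
  exact Iff.rfl

lemma germ_congr {x : X} {s s' t t' : X → RR q} (h : s =ᶠ[𝓝 x] s') (h' : t =ᶠ[𝓝 x] t') :
    (s =ᶠ[𝓝 x] t) ↔ (s' =ᶠ[𝓝 x] t') :=
  ⟨fun e => h.symm.trans (e.trans h'), fun e => h.trans (e.trans h'.symm)⟩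

/-- Continuations along a leafwise path are determined by one value. -/
lemma IsContinuation.unique {x y : X} {γ : Path x y} (hγ : F.IsLeafwise γ)
    {σ σ' : unitInterval → X → RR q} (h : F.IsContinuation γ σ) (h' : F.IsContinuation γ σ')
    {t₀ : unitInterval} (e : σ t₀ =ᶠ[𝓝 (γ t₀)] σ' t₀) (t : unitInterval) :
    σ t =ᶠ[𝓝 (γ t)] σ' t := by
  have key : IsLocallyConstant fun t => (σ t =ᶠ[𝓝 (γ t)] σ' t) := by
    rw [IsLocallyConstant.iff_eventually_eq]
    intro t
    obtain ⟨c, hc, hx⟩ := F.cover (γ t)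
    obtain ⟨k, -, hk⟩ := (h.transverse t).exists_eq hc hx
    obtain ⟨l, -, hl⟩ := (h'.transverse t).exists_eq hc hx
    have cont : Tendsto γ (𝓝 t) (𝓝 (γ t)) := γ.continuous.continuousAt
    filter_upwards [h.locally_const t, h'.locally_const t, hγ t c hc hx,
      cont.eventually hk.eventually_nhds, cont.eventually hl.eventually_nhds,
      cont.eventually (c.open_source.mem_nhds hx)] with τ h₁ h₂ h₃ h₄ h₅ h₆
    refine propext ?_
    rw [germ_congr (EventuallyEq.trans h₁ h₄) (EventuallyEq.trans h₂ h₅),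
      comp_eventuallyEq_iff c h₆, germ_congr hk hl, comp_eventuallyEq_iff c hx, h₃]
  have := key.apply_eq_of_preconnectedSpace t t₀
  exact this.mpr e

/-- Every transverse coordinate can be continued along a leafwise path. -/
lemma exists_continuation {x y : X} {γ : Path x y} (hγ : F.IsLeafwise γ) {a : X → RR q}
    (ha : F.IsTransverseAt a x) : ∃ b, F.Transports γ a b := by
  classical
  choose c hc hx using fun t : unitInterval => F.cover (γ t)
  have hnh : ∀ t : unitInterval, ∃ U : Set unitInterval, IsOpen U ∧ t ∈ U ∧ ∀ τ ∈ U,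
      γ τ ∈ (c t).source ∧ (c t (γ τ)).2 = (c t (γ t)).2 := by
    intro t
    have cont : Tendsto γ (𝓝 t) (𝓝 (γ t)) := γ.continuous.continuousAt
    obtain ⟨U, hU, hUo, htU⟩ := eventually_nhds_iff.mp
      ((cont.eventually ((c t).open_source.mem_nhds (hx t))).and (hγ t _ (hc t) (hx t)))
    exact ⟨U, hUo, htU, hU⟩
  choose U hUo htU hU using hnh
  obtain ⟨t, ht0, htm, ⟨N, hN⟩, htU'⟩ :=
    exists_monotone_Icc_subset_open_cover_unitInterval hUo
      (fun t _ => mem_iUnion.mpr ⟨t, htU t⟩)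
  have step : ∀ n, ∃ σ : unitInterval → X → RR q, σ 0 = a ∧
      (∀ s ≤ t n, F.IsTransverseAt (σ s) (γ s)) ∧
      ∀ s ≤ t n, ∀ᶠ τ in 𝓝 s, τ ≤ t n → σ τ =ᶠ[𝓝 (γ τ)] σ s := by
    intro n
    induction n with
    | zero =>
      refine ⟨fun _ => a, rfl, ?_, fun _ _ => Eventually.of_forall fun _ _ => EventuallyEq.rfl⟩
      intro s hs
      have : s = 0 := le_antisymm (hs.trans ht0.le) s.2.1
      rw [this, γ.source]
      exact ha
    | succ n ih =>
      obtain ⟨σ, h0, h1, h2⟩ := ih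
      obtain ⟨i, hi⟩ := htU' n
      have hle : t n ≤ t (n + 1) := htm n.le_succ
      have hin : ∀ s, t n ≤ s → s ≤ t (n + 1) → γ s ∈ (c i).source ∧
          (c i (γ s)).2 = (c i (γ i)).2 := fun s hs hs' => hU i s (hi ⟨hs, hs'⟩)
      obtain ⟨k, hk, hk'⟩ := (h1 (t n) le_rfl).exists_eq (hc i) (hin _ le_rfl hle).1
      have hktr : ∀ s, t n ≤ s → s ≤ t (n + 1) →
          F.IsTransverseAt (fun z => k (c i z).2) (γ s) := fun s hs hs' =>
        ⟨c i, hc i, (hin s hs hs').1, k, by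
          rw [(hin s hs hs').2, ← (hin _ le_rfl hle).2]; exact hk, Eventually.of_forall fun _ => rfl⟩
      refine ⟨fun s => if s ≤ t n then σ s else fun z => k (c i z).2, ?_, ?_, ?_⟩
      · exact (if_pos (show (0 : unitInterval) ≤ t n from (t n).2.1)).trans h0
      · intro s hs
        by_cases hsn : s ≤ t n
        · simp only [if_pos hsn]; exact h1 s hsn
        · simp only [if_neg hsn]; exact hktr s (le_of_not_ge hsn) hs
      · intro s hs
        rcases lt_trichotomy s (t n) with hsn | hsn | hsn
        · filter_upwards [h2 s hsn.le, eventually_lt_nhds hsn] with τ h₁ h₂ _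
          simp only [if_pos hsn.le, if_pos h₂.le]
          exact h₁ h₂.le
        · have cont : Tendsto γ (𝓝 s) (𝓝 (γ s)) := γ.continuous.continuousAt
          rw [← hsn] at hk'
          filter_upwards [h2 s hsn.le, cont.eventually hk'.eventually_nhds] with τ h₁ h₂ _
          simp only [if_pos hsn.le]
          by_cases hτ : τ ≤ t n
          · simp only [if_pos hτ]; exact h₁ hτ
          · simp only [if_neg hτ]; exact EventuallyEq.symm h₂
        · filter_upwards [eventually_gt_nhds hsn] with τ h₁ _
          simp only [if_neg (not_le.mpr hsn), if_neg (not_le.mpr h₁)]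
          exact EventuallyEq.rfl
  obtain ⟨σ, h0, h1, h2⟩ := step N
  have hle : ∀ s, s ≤ t N := fun s => by rw [hN N le_rfl]; exact s.2.2
  refine ⟨σ 1, σ, ⟨fun s => h1 s (hle s), fun s => ?_⟩, by rw [h0], EventuallyEq.rfl⟩
  filter_upwards [h2 s (hle s)] with τ h₁ using h₁ (hle τ)

lemma Transports.transverse_left {x y : X} {γ : Path x y} {a b : X → RR q}
    (h : F.Transports γ a b) : F.IsTransverseAt a x := by
  obtain ⟨σ, hσ, h0, -⟩ := h
  have := hσ.transverse 0
  rw [γ.source] at this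
  exact this.congr h0.symm

lemma Transports.congr {x y : X} {γ : Path x y} {a b a' b' : X → RR q}
    (h : F.Transports γ a b) (e : a =ᶠ[𝓝 x] a') (e' : b =ᶠ[𝓝 y] b') :
    F.Transports γ a' b' := by
  obtain ⟨σ, hσ, h0, h1⟩ := h
  exact ⟨σ, hσ, h0.trans e, h1.trans e'⟩

lemma Transports.left_unique {x y : X} {γ : Path x y} (hγ : F.IsLeafwise γ) {a a' b : X → RR q}
    (h : F.Transports γ a b) (h' : F.Transports γ a' b) : a =ᶠ[𝓝 x] a' := by
  obtain ⟨σ, hσ, h0, h1⟩ := h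
  obtain ⟨σ', hσ', h0', h1'⟩ := h'
  have e : σ 1 =ᶠ[𝓝 (γ 1)] σ' 1 := by rw [γ.target]; exact h1.trans h1'.symm
  have := hσ.unique hγ hσ' e 0
  rw [γ.source] at this
  exact h0.symm.trans (this.trans h0')

lemma transports_symm {x y : X} {γ : Path x y} {a b : X → RR q} :
    F.Transports γ.symm a b ↔ F.Transports γ b a := by
  have aux : ∀ {x y : X} {γ : Path x y} {a b : X → RR q},
      F.Transports γ a b → F.Transports γ.symm b a := by
    rintro x y γ a b ⟨σ, hσ, h0, h1⟩
    refine ⟨σ ∘ unitInterval.symm, hσ.comp unitInterval.continuous_symm, ?_, ?_⟩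
    · simpa using h1
    · simpa using h0
  exact ⟨fun h => by simpa using aux h, aux⟩

lemma isLeafwise_refl (x : X) : F.IsLeafwise (Path.refl x) :=
  fun _ _ _ _ => Eventually.of_forall fun _ => rfl

lemma isLeafwise_symm {x y : X} {γ : Path x y} (h : F.IsLeafwise γ) : F.IsLeafwise γ.symm :=
  fun t c hc hx => unitInterval.continuous_symm.continuousAt.eventually
    (h (unitInterval.symm t) c hc hx)

lemma transports_refl {x : X} {a b : X → RR q} :
    F.Transports (Path.refl x) a b ↔ F.IsTransverseAt a x ∧ a =ᶠ[𝓝 x] b := by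
  constructor
  · intro h
    refine ⟨h.transverse_left, ?_⟩
    have h' : F.Transports (Path.refl x) b b :=
      ⟨fun _ => b, ⟨fun _ => ?_, fun _ => Eventually.of_forall fun _ => EventuallyEq.rfl⟩,
        EventuallyEq.rfl, EventuallyEq.rfl⟩
    · exact h.left_unique (isLeafwise_refl x) h'
    · exact (transports_symm.mpr h).transverse_left
  · rintro ⟨h, e⟩
    exact ⟨fun _ => a, ⟨fun _ => h, fun _ => Eventually.of_forall fun _ => EventuallyEq.rfl⟩,
        EventuallyEq.rfl, e⟩

/-- `t ↦ 2 t` on the first half of the interval. -/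
def firstHalf (t : unitInterval) : unitInterval := projIcc 0 1 zero_le_one (2 * (t : ℝ))

/-- `t ↦ 2 t - 1` on the second half of the interval. -/
def secondHalf (t : unitInterval) : unitInterval := projIcc 0 1 zero_le_one (2 * (t : ℝ) - 1)

lemma continuous_firstHalf : Continuous firstHalf := by unfold firstHalf; fun_prop

lemma continuous_secondHalf : Continuous secondHalf := by unfold secondHalf; fun_prop

lemma trans_left {x y z : X} (γ : Path x y) (γ' : Path y z) {t : unitInterval}
    (ht : (t : ℝ) ≤ 1 / 2) : γ.trans γ' t = γ (firstHalf t) := by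
  change (if (t : ℝ) ≤ 1 / 2 then γ.extend (2 * (t : ℝ)) else γ'.extend (2 * (t : ℝ) - 1)) = _
  rw [if_pos ht]; rfl

lemma trans_right {x y z : X} (γ : Path x y) (γ' : Path y z) {t : unitInterval}
    (ht : 1 / 2 ≤ (t : ℝ)) : γ.trans γ' t = γ' (secondHalf t) := by
  rcases eq_or_lt_of_le ht with h | h
  · rw [trans_left γ γ' h.symm.le]
    have h₁ : firstHalf t = 1 := by
      unfold firstHalf; rw [← h]; norm_num
    have h₂ : secondHalf t = 0 := by
      unfold secondHalf; rw [← h]; norm_num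
    rw [h₁, h₂, γ.target, γ'.source]
  · change (if (t : ℝ) ≤ 1 / 2 then γ.extend (2 * (t : ℝ)) else γ'.extend (2 * (t : ℝ) - 1)) = _
    rw [if_neg (not_le.mpr h)]; rfl

lemma isLeafwise_trans {x y z : X} {γ : Path x y} {γ' : Path y z} (h : F.IsLeafwise γ)
    (h' : F.IsLeafwise γ') : F.IsLeafwise (γ.trans γ') := by
  intro t c hc hx
  have hco : Continuous fun τ : unitInterval => (τ : ℝ) := continuous_subtype_val
  have H₁ : (t : ℝ) ≤ 1 / 2 → ∀ᶠ τ : unitInterval in 𝓝 t, (τ : ℝ) ≤ 1 / 2 →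
      (c (γ.trans γ' τ)).2 = (c (γ.trans γ' t)).2 := by
    intro ht
    rw [trans_left γ γ' ht] at hx ⊢
    filter_upwards [continuous_firstHalf.continuousAt.eventually (h _ c hc hx)] with τ h₁ h₂
    rw [trans_left γ γ' h₂, h₁]
  have H₂ : 1 / 2 ≤ (t : ℝ) → ∀ᶠ τ : unitInterval in 𝓝 t, 1 / 2 ≤ (τ : ℝ) →
      (c (γ.trans γ' τ)).2 = (c (γ.trans γ' t)).2 := by
    intro ht
    rw [trans_right γ γ' ht] at hx ⊢
    filter_upwards [continuous_secondHalf.continuousAt.eventually (h' _ c hc hx)] with τ h₁ h₂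
    rw [trans_right γ γ' h₂, h₁]
  rcases lt_trichotomy (t : ℝ) (1 / 2) with ht | ht | ht
  · filter_upwards [H₁ ht.le, hco.continuousAt.eventually_lt_const ht] with τ h₁ h₂ using h₁ h₂.le
  · filter_upwards [H₁ ht.le, H₂ ht.ge] with τ h₁ h₂
    exact (le_total (τ : ℝ) (1 / 2)).elim h₁ h₂
  · filter_upwards [H₂ ht.le, hco.continuousAt.eventually_const_lt ht] with τ h₁ h₂ using h₁ h₂.le

lemma transports_trans {x y z : X} {γ : Path x y} {γ' : Path y z} {a c : X → RR q} :
    F.Transports (γ.trans γ') a c ↔ ∃ b, F.Transports γ a b ∧ F.Transports γ' b c := by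
  classical
  have hco : Continuous fun τ : unitInterval => (τ : ℝ) := continuous_subtype_val
  constructor
  · rintro ⟨σ, hσ, h0, h1⟩
    let u : unitInterval → unitInterval := fun t => ⟨t / 2, by
      constructor <;> [linarith [t.2.1]; linarith [t.2.2]]⟩
    let v : unitInterval → unitInterval := fun t => ⟨(t + 1) / 2, by
      constructor <;> [linarith [t.2.1]; linarith [t.2.2]]⟩
    have hu : Continuous u := by
      refine Continuous.subtype_mk ?_ _; fun_prop
    have hv : Continuous v := by
      refine Continuous.subtype_mk ?_ _; fun_prop
    have eu : (γ.trans γ') ∘ u = γ := by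
      funext t
      have h₁ : ((u t : unitInterval) : ℝ) ≤ 1 / 2 := by
        change (t : ℝ) / 2 ≤ 1 / 2; linarith [t.2.2]
      have h₂ : firstHalf (u t) = t := by
        unfold firstHalf
        rw [show 2 * ((u t : unitInterval) : ℝ) = t by change 2 * ((t : ℝ) / 2) = t; ring]
        exact projIcc_val _ t
      rw [Function.comp_apply, trans_left γ γ' h₁, h₂]
    have ev : (γ.trans γ') ∘ v = γ' := by
      funext t
      have h₁ : 1 / 2 ≤ ((v t : unitInterval) : ℝ) := by
        change 1 / 2 ≤ ((t : ℝ) + 1) / 2; linarith [t.2.1]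
      have h₂ : secondHalf (v t) = t := by
        unfold secondHalf
        rw [show 2 * ((v t : unitInterval) : ℝ) - 1 = t by
          change 2 * (((t : ℝ) + 1) / 2) - 1 = t; ring]
        exact projIcc_val _ t
      rw [Function.comp_apply, trans_right γ γ' h₁, h₂]
    have hu0 : u 0 = 0 := Subtype.ext (by change (0 : ℝ) / 2 = 0; norm_num)
    have huv : u 1 = v 0 := Subtype.ext (by change (1 : ℝ) / 2 = (0 + 1) / 2; norm_num)
    have hv1 : v 1 = 1 := Subtype.ext (by change ((1 : ℝ) + 1) / 2 = 1; norm_num)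
    refine ⟨σ (u 1), ⟨σ ∘ u, eu ▸ hσ.comp hu, ?_, EventuallyEq.rfl⟩,
      ⟨σ ∘ v, ev ▸ hσ.comp hv, ?_, ?_⟩⟩
    · rw [Function.comp_apply, hu0]; exact h0
    · rw [Function.comp_apply, huv]
    · rw [Function.comp_apply, hv1]; exact h1
  · rintro ⟨b, ⟨σ, hσ, h0, h1⟩, ⟨σ', hσ', h0', h1'⟩⟩
    have hd := hσ.comp continuous_firstHalf
    have hd' := hσ'.comp continuous_secondHalf
    have emid : ∀ t : unitInterval, (t : ℝ) = 1 / 2 →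
        σ (firstHalf t) =ᶠ[𝓝 (γ.trans γ' t)] σ' (secondHalf t) := by
      intro t ht
      have h₁ : firstHalf t = 1 := by unfold firstHalf; rw [ht]; norm_num
      have h₂ : secondHalf t = 0 := by unfold secondHalf; rw [ht]; norm_num
      rw [trans_left γ γ' ht.le, h₁, h₂, γ.target]
      exact h1.trans h0'.symm
    let ρ : unitInterval → X → RR q := fun t =>
      if (t : ℝ) ≤ 1 / 2 then σ (firstHalf t) else σ' (secondHalf t)
    have r₁ : ∀ t : unitInterval, (t : ℝ) ≤ 1 / 2 → ρ t = σ (firstHalf t) := fun t ht => if_pos ht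
    have r₂ : ∀ t : unitInterval, 1 / 2 ≤ (t : ℝ) →
        ρ t =ᶠ[𝓝 (γ.trans γ' t)] σ' (secondHalf t) := by
      intro t ht
      rcases eq_or_lt_of_le ht with h | h
      · rw [r₁ t h.symm.le]; exact emid t h.symm
      · rw [show ρ t = σ' (secondHalf t) from if_neg (not_le.mpr h)]
    have H₁ : ∀ t : unitInterval, (t : ℝ) ≤ 1 / 2 → ∀ᶠ τ : unitInterval in 𝓝 t, (τ : ℝ) ≤ 1 / 2 →
        ρ τ =ᶠ[𝓝 (γ.trans γ' τ)] ρ t := by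
      intro t ht
      filter_upwards [hd.locally_const t] with τ h₁ h₂
      rw [r₁ t ht, r₁ τ h₂, trans_left γ γ' h₂]
      exact h₁
    have H₂ : ∀ t : unitInterval, 1 / 2 ≤ (t : ℝ) → ∀ᶠ τ : unitInterval in 𝓝 t, 1 / 2 ≤ (τ : ℝ) →
        ρ τ =ᶠ[𝓝 (γ.trans γ' τ)] ρ t := by
      intro t ht
      have cont : Tendsto (γ.trans γ') (𝓝 t) (𝓝 (γ.trans γ' t)) :=
        (γ.trans γ').continuous.continuousAt
      filter_upwards [hd'.locally_const t, cont.eventually (r₂ t ht).eventually_nhds]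
        with τ h₁ h₃ h₂
      refine (r₂ τ h₂).trans (EventuallyEq.trans ?_ (EventuallyEq.symm h₃))
      rw [trans_right γ γ' h₂]
      exact h₁
    refine ⟨ρ, ⟨fun t => ?_, fun t => ?_⟩, ?_, ?_⟩
    · rcases le_total (t : ℝ) (1 / 2) with ht | ht
      · rw [r₁ t ht, trans_left γ γ' ht]; exact hd.transverse t
      · refine IsTransverseAt.congr ?_ (r₂ t ht)
        rw [trans_right γ γ' ht]; exact hd'.transverse t
    · rcases lt_trichotomy (t : ℝ) (1 / 2) with ht | ht | ht
      · filter_upwards [H₁ t ht.le, hco.continuousAt.eventually_lt_const ht] with τ h₁ h₂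
          using h₁ h₂.le
      · filter_upwards [H₁ t ht.le, H₂ t ht.ge] with τ h₁ h₂
        exact (le_total (τ : ℝ) (1 / 2)).elim h₁ h₂
      · filter_upwards [H₂ t ht.le, hco.continuousAt.eventually_const_lt ht] with τ h₁ h₂
          using h₁ h₂.le
    · rw [r₁ 0 (by norm_num)]
      have : firstHalf 0 = 0 := by unfold firstHalf; norm_num
      rw [this]; exact h0
    · have h₃ := r₂ 1 (by norm_num)
      have : secondHalf 1 = 1 := by unfold secondHalf; norm_num
      rw [(γ.trans γ').target, this] at h₃
      exact h₃.trans h1'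

end Transport

/-! #### The holonomy groupoid -/

section Holonomy

variable {F}

/-- The holonomy class of the constant path. -/
def HolClass.refl (x : X) : F.HolClass x x := Quotient.mk _ ⟨Path.refl x, isLeafwise_refl x⟩

/-- The inverse holonomy class. -/
def HolClass.symm {x y : X} : F.HolClass x y → F.HolClass y x :=
  Quotient.map (fun γ => ⟨γ.1.symm, isLeafwise_symm γ.2⟩) (fun _ _ h a b => by
    rw [transports_symm, transports_symm]
    exact (show ∀ a b, F.Transports _ a b ↔ F.Transports _ a b from h) b a)

/-- Concatenation of holonomy classes. -/
def HolClass.trans {x y z : X} : F.HolClass x y → F.HolClass y z → F.HolClass x z :=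
  Quotient.map₂ (fun γ γ' => ⟨γ.1.trans γ'.1, isLeafwise_trans γ.2 γ'.2⟩)
    (fun _ _ h _ _ h' a c => by
      rw [transports_trans, transports_trans]
      exact exists_congr fun b => and_congr (h a b) (h' b c))

/-- The holonomy of an arrow carries the germ at its source of the transverse coordinate `a` to the
germ at its target of the transverse coordinate `b`. -/
def HolArr.Carries (g : F.HolArr) (a b : X → RR q) : Prop :=
  Quotient.lift (fun γ : F.LeafPath g.1 g.2.1 => F.Transports γ.1 a b)
    (fun γ γ' h => propext
      ((show ∀ a b, F.Transports γ.1 a b ↔ F.Transports γ'.1 a b from h) a b)) g.2.2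

lemma HolClass.refl_trans {x y : X} (k : F.HolClass x y) : (HolClass.refl x).trans k = k := by
  refine Quotient.inductionOn k fun γ => Quotient.sound fun a b => ?_
  change F.Transports ((Path.refl x).trans γ.1) a b ↔ _
  rw [transports_trans]
  refine ⟨?_, fun h => ⟨a, transports_refl.mpr ⟨h.transverse_left, EventuallyEq.rfl⟩, h⟩⟩
  rintro ⟨c, h, h'⟩
  exact h'.congr (transports_refl.mp h).2.symm EventuallyEq.rfl

lemma HolClass.trans_refl {x y : X} (k : F.HolClass x y) : k.trans (HolClass.refl y) = k := by
  refine Quotient.inductionOn k fun γ => Quotient.sound fun a b => ?_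
  change F.Transports (γ.1.trans (Path.refl y)) a b ↔ _
  rw [transports_trans]
  refine ⟨?_, fun h => ⟨b, h, transports_refl.mpr
    ⟨(transports_symm.mpr h).transverse_left, EventuallyEq.rfl⟩⟩⟩
  rintro ⟨c, h, h'⟩
  exact h.congr EventuallyEq.rfl (transports_refl.mp h').2

lemma HolClass.trans_assoc {x y z w : X} (k : F.HolClass x y) (l : F.HolClass y z)
    (m : F.HolClass z w) : (k.trans l).trans m = k.trans (l.trans m) := by
  refine Quotient.inductionOn₃ k l m fun γ δ ε => Quotient.sound fun a b => ?_
  change F.Transports ((γ.1.trans δ.1).trans ε.1) a b ↔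
    F.Transports (γ.1.trans (δ.1.trans ε.1)) a b
  simp only [transports_trans]
  constructor
  · rintro ⟨r, ⟨s, h₁, h₂⟩, h₃⟩; exact ⟨s, h₁, r, h₂, h₃⟩
  · rintro ⟨s, h₁, r, h₂, h₃⟩; exact ⟨r, ⟨s, h₁, h₂⟩, h₃⟩

lemma HolClass.trans_symm {x y : X} (k : F.HolClass x y) : k.trans k.symm = HolClass.refl x := by
  refine Quotient.inductionOn k fun γ => Quotient.sound fun a b => ?_
  change F.Transports (γ.1.trans γ.1.symm) a b ↔ F.Transports (Path.refl x) a b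
  rw [transports_trans, transports_refl]
  constructor
  · rintro ⟨c, h, h'⟩
    exact ⟨h.transverse_left, h.left_unique γ.2 (transports_symm.mp h')⟩
  · rintro ⟨h, e⟩
    obtain ⟨c, hc⟩ := exists_continuation γ.2 h
    exact ⟨c, hc, (transports_symm.mpr hc).congr EventuallyEq.rfl e⟩

lemma HolClass.symm_trans {x y : X} (k : F.HolClass x y) : k.symm.trans k = HolClass.refl y := by
  have : k.symm.symm = k := by
    refine Quotient.inductionOn k fun γ => Quotient.sound fun a b => ?_
    change F.Transports γ.1.symm.symm a b ↔ _
    rw [Path.symm_symm]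
  have h := HolClass.trans_symm k.symm
  rwa [this] at h

/-- Composition of arrows of the holonomy groupoid: first `h`, then `g`. -/
def HolArr.comp : ∀ g h : F.HolArr, g.1 = h.2.1 → F.HolArr
  | ⟨_, y, k⟩, ⟨z, _, l⟩, rfl => ⟨z, y, l.trans k⟩

variable (F)

/-- The holonomy groupoid of `F`, as a groupoid: the class of `γ` is an arrow from `γ 0` to `γ 1`,
and multiplication is given by concatenation. -/
def holonomyGroupoid : Gpd X F.HolArr where
  src g := g.1
  tgt g := g.2.1
  one x := ⟨x, x, HolClass.refl x⟩
  inv g := ⟨g.2.1, g.1, g.2.2.symm⟩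
  mul := HolArr.comp
  src_one _ := rfl
  tgt_one _ := rfl
  src_inv _ := rfl
  tgt_inv _ := rfl
  src_mul := by
    rintro ⟨x, y, k⟩ ⟨z, x', l⟩ w
    obtain rfl : x = x' := w
    rfl
  tgt_mul := by
    rintro ⟨x, y, k⟩ ⟨z, x', l⟩ w
    obtain rfl : x = x' := w
    rfl
  one_mul := by
    rintro ⟨x, y, k⟩
    change (⟨x, y, k.trans (HolClass.refl y)⟩ : F.HolArr) = ⟨x, y, k⟩
    rw [HolClass.trans_refl]
  mul_one := by
    rintro ⟨x, y, k⟩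
    change (⟨x, y, (HolClass.refl x).trans k⟩ : F.HolArr) = ⟨x, y, k⟩
    rw [HolClass.refl_trans]
  mul_assoc := by
    rintro ⟨x, y, k⟩ ⟨u, x', l⟩ ⟨z, u', m⟩ w w'
    obtain rfl : x = x' := w
    obtain rfl : u = u' := w'
    change (⟨z, y, m.trans (l.trans k)⟩ : F.HolArr) = ⟨z, y, (m.trans l).trans k⟩
    rw [HolClass.trans_assoc]
  inv_mul := by
    rintro ⟨x, y, k⟩
    change (⟨x, x, k.trans k.symm⟩ : F.HolArr) = ⟨x, x, HolClass.refl x⟩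
    rw [HolClass.trans_symm]
  mul_inv := by
    rintro ⟨x, y, k⟩
    change (⟨y, y, k.symm.trans k⟩ : F.HolArr) = ⟨y, y, HolClass.refl y⟩
    rw [HolClass.symm_trans]

/-- The topology of the arrow space of the holonomy groupoid. A basic neighbourhood of the class of
a path `γ` consists of the classes of the paths "parallel to `γ`": they start in a neighbourhood `U`
of `γ 0`, end in a neighbourhood `V` of `γ 1`, and their holonomy carries `a` to `b`, where `a` on
`U` and `b` on `V` are transverse coordinates such that the holonomy of `γ` carries `a` to `b`. -/
instance : TopologicalSpace F.HolArr :=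
  TopologicalSpace.generateFrom
    {N | ∃ (U V : Set X) (a b : X → RR q), IsOpen U ∧ IsOpen V ∧
      (∀ x ∈ U, F.IsTransverseAt a x) ∧ (∀ y ∈ V, F.IsTransverseAt b y) ∧
      N = {g : F.HolArr | g.1 ∈ U ∧ g.2.1 ∈ V ∧ g.Carries a b}}

/-- The smooth atlas of the arrow space of the holonomy groupoid, a manifold of dimension `2 d + q`.
On a small basic open set as above, `(src, tgt)` is a homeomorphism onto an open subset of the
submanifold `{(x, y) | a x = b y}` of `X × X`. The charts `e` are those of this submanifold:
`(src, tgt) ∘ e⁻¹` is a smooth immersion, i.e. it is smooth and `e` is locally the composite of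
`(src, tgt)` and a smooth map on an open subset of `X × X`. -/
def holonomyAtlas : Set (OpenPartialHomeomorph F.HolArr (RR (d + d + q))) :=
  {e | ContMDiffOn 𝓘(ℝ, RR (d + d + q)) (𝓘(ℝ, RR (d + q)).prod 𝓘(ℝ, RR (d + q))) ∞
      (fun z => (((e.symm z).1, (e.symm z).2.1) : X × X)) e.target ∧
    ∀ g ∈ e.source, ∃ Ψ : X × X → RR (d + d + q),
      ContMDiffAt (𝓘(ℝ, RR (d + q)).prod 𝓘(ℝ, RR (d + q))) 𝓘(ℝ, RR (d + d + q)) ∞ Ψ (g.1, g.2.1) ∧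
      ∀ᶠ g' : F.HolArr in 𝓝 g, e g' = Ψ (g'.1, g'.2.1)}

end Holonomy

end Foliation

/-! ### Transverse Riemannian metrics -/

/-- A transversely Riemannian metric on a foliated manifold: a smooth symmetric `(0, 2)`-tensor,
zero on vectors tangent to the leaves, positive definite on the normal bundle, whose Lie derivative
`(L_Y g)(V, W) = Y (g(V, W)) - g([Y, V], W) - g(V, [Y, W])` vanishes for all vector fields `Y`
tangent to the leaves. -/
structure TransverseMetric {d q : ℕ} {X : Type u} [TopologicalSpace X]
    [ChartedSpace (RR (d + q)) X] [IsManifold 𝓘(ℝ, RR (d + q)) ∞ X] (F : Foliation d q X) where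
  val : ∀ x : X, TangentSpace 𝓘(ℝ, RR (d + q)) x →L[ℝ] TangentSpace 𝓘(ℝ, RR (d + q)) x →L[ℝ] ℝ
  smooth : ContMDiff 𝓘(ℝ, RR (d + q))
    (𝓘(ℝ, RR (d + q)).prod 𝓘(ℝ, RR (d + q) →L[ℝ] RR (d + q) →L[ℝ] ℝ)) ∞
    (fun x => Bundle.TotalSpace.mk' (RR (d + q) →L[ℝ] RR (d + q) →L[ℝ] ℝ)
      (E := fun x : X => TangentSpace 𝓘(ℝ, RR (d + q)) x →L[ℝ]
        TangentSpace 𝓘(ℝ, RR (d + q)) x →L[ℝ] ℝ) x (val x))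
  symm : ∀ x v w, val x v w = val x w v
  tangent : ∀ x v, F.IsTangent x v → ∀ w, val x v w = 0
  pos : ∀ x v, ¬ F.IsTangent x v → 0 < val x v v
  lie_eq_zero : ∀ Y V W : ∀ x : X, TangentSpace 𝓘(ℝ, RR (d + q)) x,
    (∀ x, F.IsTangent x (Y x)) →
    ContMDiff 𝓘(ℝ, RR (d + q)) 𝓘(ℝ, RR (d + q)).tangent ∞
      (fun x => (⟨x, Y x⟩ : TangentBundle 𝓘(ℝ, RR (d + q)) X)) →
    ContMDiff 𝓘(ℝ, RR (d + q)) 𝓘(ℝ, RR (d + q)).tangent ∞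
      (fun x => (⟨x, V x⟩ : TangentBundle 𝓘(ℝ, RR (d + q)) X)) →
    ContMDiff 𝓘(ℝ, RR (d + q)) 𝓘(ℝ, RR (d + q)).tangent ∞
      (fun x => (⟨x, W x⟩ : TangentBundle 𝓘(ℝ, RR (d + q)) X)) →
    ∀ x, (show ℝ from mfderiv 𝓘(ℝ, RR (d + q)) 𝓘(ℝ, ℝ) (fun z => val z (V z) (W z)) x (Y x))
        - val x (VectorField.mlieBracket 𝓘(ℝ, RR (d + q)) Y V x) (W x)
        - val x (V x) (VectorField.mlieBracket 𝓘(ℝ, RR (d + q)) Y W x) = 0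

/-! ### Developable foliations -/

section Developable

variable {d q : ℕ} {X X' M : Type u}
  [TopologicalSpace X] [ChartedSpace (RR (d + q)) X]
  [TopologicalSpace X'] [ChartedSpace (RR (d + q)) X']
  [TopologicalSpace M] [ChartedSpace (RR q) M]

/-- `p` is a cover of manifolds: a surjective covering map which is a local diffeomorphism. -/
structure IsSmoothCover (n : ℕ) {X' X : Type u} [TopologicalSpace X] [ChartedSpace (RR n) X]
    [TopologicalSpace X'] [ChartedSpace (RR n) X'] (p : X' → X) : Prop where
  isCoveringMap : IsCoveringMap p
  isLocalDiffeomorph : IsLocalDiffeomorph 𝓘(ℝ, RR n) 𝓘(ℝ, RR n) ∞ p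
  surjective : Function.Surjective p

/-- The group `Γ` of deck transformations of `p`. -/
def deckGroup {X' X : Type u} [TopologicalSpace X'] (p : X' → X) : Subgroup (X' ≃ₜ X') where
  carrier := {γ | ∀ x, p (γ x) = p x}
  one_mem' _ := rfl
  mul_mem' {γ γ'} h h' x := (h (γ' x)).trans (h' x)
  inv_mem' {γ} h x := by
    have := h (γ⁻¹ x)
    rw [← this]
    exact congrArg p (γ.apply_symm_apply x).symm ▸ rfl

/-- `p` is a Galois cover: deck transformations act transitively on the fibres. -/
def IsGaloisCover {X' X : Type u} [TopologicalSpace X'] (p : X' → X) : Prop :=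
  ∀ x y, p x = p y → ∃ γ ∈ deckGroup p, γ x = y

/-- A foliated chart of `X`, lifted to `X'` by a local diffeomorphism. -/
lemma Foliation.exists_lift_chart (F : Foliation d q X) {p : X' → X}
    (hp : IsLocalDiffeomorph 𝓘(ℝ, RR (d + q)) 𝓘(ℝ, RR (d + q)) ∞ p) (x : X')
    {c : OpenPartialHomeomorph X (RR d × RR q)} (hc : c ∈ F.charts) (hx : p x ∈ c.source) :
    ∃ e : OpenPartialHomeomorph X' (RR d × RR q), x ∈ e.source ∧
      (∀ z ∈ e.source, p z ∈ c.source ∧ e z = c (p z)) ∧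
      ContMDiffOn 𝓘(ℝ, RR d × RR q) 𝓘(ℝ, RR (d + q)) ∞ e.symm e.target := by
  obtain ⟨Φ, hΦ, e⟩ := hp x
  refine ⟨Φ.toOpenPartialHomeomorph.trans c,
    ⟨hΦ, show Φ x ∈ c.source by rw [← e hΦ]; exact hx⟩, ?_, ?_⟩
  · intro z hz
    have h₁ : z ∈ Φ.source := hz.1
    have h₂ : Φ z ∈ c.source := hz.2
    rw [← e h₁] at h₂
    exact ⟨h₂, congrArg c (e h₁).symm⟩
  · intro z hz
    have hz₁ : z ∈ c.target := hz.1
    have hz₂ : c.symm z ∈ Φ.target := hz.2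
    exact ContMDiffWithinAt.comp (t := Φ.target) z (Φ.contMDiffOn_invFun _ hz₂)
      ((F.smooth_symm c hc z hz₁).mono inter_subset_left) inter_subset_right

/-- The pullback foliation `p⁻¹(F)` along a local diffeomorphism `p`: its charts are the
diffeomorphisms which are restrictions of `c ∘ p`, for `c` a foliated chart. -/
def Foliation.comap (F : Foliation d q X) (p : X' → X)
    (hp : IsLocalDiffeomorph 𝓘(ℝ, RR (d + q)) 𝓘(ℝ, RR (d + q)) ∞ p) : Foliation d q X' where
  charts := {e | ∃ c ∈ F.charts, (∀ x ∈ e.source, p x ∈ c.source ∧ e x = c (p x)) ∧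
    ContMDiffOn 𝓘(ℝ, RR d × RR q) 𝓘(ℝ, RR (d + q)) ∞ e.symm e.target}
  cover x := by
    obtain ⟨c, hc, hx⟩ := F.cover (p x)
    obtain ⟨e, h₁, h₂, h₃⟩ := F.exists_lift_chart hp x hc hx
    exact ⟨e, ⟨c, hc, h₂, h₃⟩, h₁⟩
  smooth := by
    rintro e ⟨c, hc, h, -⟩
    exact ((F.smooth c hc).comp hp.contMDiff.contMDiffOn fun x hx => (h x hx).1).congr
      fun x hx => (h x hx).2
  smooth_symm := by
    rintro e ⟨c, hc, -, h⟩
    exact h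
  compat := by
    rintro e ⟨c, hc, h, -⟩ e' ⟨c', hc', h', -⟩ x hx hx'
    obtain ⟨k, hk, hk'⟩ := F.compat c hc c' hc' (p x) (h x hx).1 (h' x hx').1
    refine ⟨k, by rw [(h x hx).2]; exact hk, ?_⟩
    filter_upwards [hp.contMDiff.continuous.continuousAt.eventually hk',
      e.open_source.mem_nhds hx, e'.open_source.mem_nhds hx'] with z h₁ h₂ h₃
    rw [(h z h₂).2, (h' z h₃).2]
    exact h₁

/-- `f` is a developing map for the foliation `F` and the cover `p`: a surjective submersion onto a
manifold whose fibres are the leaves of the pullback foliation `p⁻¹(F)`. In other words, `p⁻¹(F)` is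
simple, with leaf space `M` and quotient map `f`. -/
structure IsDevelopingMap (F : Foliation d q X) (p : X' → X) (hp : IsSmoothCover (d + q) p)
    (f : X' → M) : Prop where
  smooth : ContMDiff 𝓘(ℝ, RR (d + q)) 𝓘(ℝ, RR q) ∞ f
  surjective : Function.Surjective f
  submersion : ∀ x, Function.Surjective (mfderiv 𝓘(ℝ, RR (d + q)) 𝓘(ℝ, RR q) f x)
  fiber_eq_leaf : ∀ x, f ⁻¹' {f x} = (F.comap p hp.isLocalDiffeomorph).leaf x

variable {F : Foliation d q X} {p : X' → X} {hp : IsSmoothCover (d + q) p} {f : X' → M}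

/-- Deck transformations preserve the leaves of the pullback foliation. -/
lemma IsDevelopingMap.deck_congr (h : IsDevelopingMap F p hp f) {γ : X' ≃ₜ X'}
    (hγ : γ ∈ deckGroup p) {x y : X'} (e : f x = f y) : f (γ x) = f (γ y) := by
  have hy : y ∈ (F.comap p hp.isLocalDiffeomorph).leaf x := by
    rw [← h.fiber_eq_leaf]; exact e.symm
  obtain ⟨⟨δ, hδ⟩⟩ := hy
  have : γ y ∈ (F.comap p hp.isLocalDiffeomorph).leaf (γ x) := by
    refine ⟨⟨δ.map γ.continuous, ?_⟩⟩
    rintro t c ⟨c₀, hc₀, hcc, hsm⟩ ht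
    have hpt : p (δ t) ∈ c₀.source := by
      have := (hcc _ ht).1
      rwa [Path.map_coe, Function.comp_apply, hγ] at this
    obtain ⟨c₁, hmem, hc₁, hsm₁⟩ := F.exists_lift_chart hp.isLocalDiffeomorph (δ t) hc₀ hpt
    have hchart : c₁ ∈ (F.comap p hp.isLocalDiffeomorph).charts := ⟨c₀, hc₀, hc₁, hsm₁⟩
    have cont : Continuous (δ.map γ.continuous) := (δ.map γ.continuous).continuous
    filter_upwards [hδ t c₁ hchart hmem,
      cont.continuousAt.eventually (c.open_source.mem_nhds ht),
      δ.continuous.continuousAt.eventually (c₁.open_source.mem_nhds hmem)] with τ h₁ h₂ h₃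
    rw [(hcc _ h₂).2, (hcc _ ht).2]
    rw [(hc₁ _ h₃).2, (hc₁ _ hmem).2] at h₁
    simp only [Path.map_coe, Function.comp_apply]
    rw [show p (γ (δ τ)) = p (δ τ) from hγ _, show p (γ (δ t)) = p (δ t) from hγ _]
    exact h₁
  rw [← h.fiber_eq_leaf] at this
  exact this.symm

/-- The action of the deck group `Γ` on the leaf space `M`, for which the developing map is
equivariant. -/
@[reducible]
def deckAction (h : IsDevelopingMap F p hp f) : MulAction (deckGroup p) M where
  smul γ m := f (γ.1 (Function.surjInv h.surjective m))
  one_smul m := Function.surjInv_eq h.surjective m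
  mul_smul γ _ _ := h.deck_congr γ.2 (Function.surjInv_eq h.surjective _).symm

lemma deckAction_apply (h : IsDevelopingMap F p hp f) (γ : deckGroup p) (x : X') :
    letI := deckAction h
    γ • f x = f (γ.1 x) :=
  h.deck_congr γ.2 (Function.surjInv_eq h.surjective _)

/-- The homomorphism from the deck group `Γ` to the permutations of `M`. Its kernel is the
normal subgroup `Γ_M` of the elements acting trivially on `M`. -/
def deckHom (h : IsDevelopingMap F p hp f) : deckGroup p →* Equiv.Perm M :=
  letI := deckAction h
  MulAction.toPermHom (deckGroup p) M

/-- The group `Γ_eff = Γ / Γ_M`. -/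
def EffDeckGroup (h : IsDevelopingMap F p hp f) : Type u := deckGroup p ⧸ (deckHom h).ker

instance (h : IsDevelopingMap F p hp f) : Group (EffDeckGroup h) :=
  inferInstanceAs (Group (deckGroup p ⧸ (deckHom h).ker))

/-- The induced action of `Γ_eff` on `M`: the class of `γ` sends `f x` to `f (γ x)`. -/
instance (h : IsDevelopingMap F p hp f) : MulAction (EffDeckGroup h) M :=
  MulAction.compHom M (QuotientGroup.kerLift (deckHom h))

lemma effDeckGroup_smul (h : IsDevelopingMap F p hp f) (γ : deckGroup p) (x : X') :
    (show EffDeckGroup h from QuotientGroup.mk γ) • f x = f (γ.1 x) :=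
  deckAction_apply h γ x

end Developable

end FolGpd

end

open FolGpd

noncomputable section

namespace FolGpd

namespace Foliation

variable {d q : ℕ} {X : Type u} [TopologicalSpace X] [ChartedSpace (RR (d + q)) X]
  {F : Foliation d q X}

/-! ### Transverse coordinates -/

/-! The groupoid that maps to both sides is the pullback of `Γ_eff ⋉ M` along `f`
(`pullbackGroupoid`). Its objects are the points of the cover, and its arrows are the triples `(x,
y, γ)` with `γ • f x = f y`. The map to `Γ_eff ⋉ M` is fully faithful by construction and covers a
surjective submersion whose derivative has the leaf directions as kernel, so it is a Morita map.

The map to the holonomy groupoid uses the developing property. If a deck transformation `η`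
represents `γ`, then `η x` and `y` lie in one fibre of `f`, hence on one leaf upstairs, and a
leafwise path between them projects to a leafwise path from `p x` to `p y`. Along such a path the
germs of `κ ∘ f ∘ p⁻¹`, with `κ` a coordinate of `M` and `p⁻¹` the local inverse following the lift,
form a locally constant family of transverse coordinates. Read in `M`, the holonomy is therefore
just the germ of `γ` (`IsDevelopingMap.transports`). A holonomy class is determined by its endpoints
and one pair of germs that it carries (`HolArr.ext_of_carries`), so the choices do not matter. The
map is full because leafwise paths lift and the cover is Galois (`Represents.exists_of_holArr`).

Faithfulness is where the metric enters: two elements with the same holonomy agree near a point of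
`M`, and they have to be equal in `Γ_eff`. The vanishing Lie derivatives make the metric locally a
pullback along transverse coordinates (`TransverseMetric.exists_eventually_form_eq`). It thus
descends to a Riemannian metric on `M`, which `Γ_eff` preserves. An isometry with trivial 1-jet at a
point is the identity nearby (`eventually_eq_id_of_isometry`): differentiating the isometry equation
bounds its second derivative by the deviation of its 1-jet from that of the identity, and Grönwall's
inequality applies. Hence the points where an element has trivial germ form an open and closed
subset of the connected space `M` (`TransverseMetric.eq_one_of_eventually`).

The smooth structures of the two arrow spaces over `X` and over the cover are handled together. In
both, source and target identify the arrows locally with `{(x, y) | a x = b y}`, for transverse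
coordinates `a` and `b` (`LocallyFibred`). A continuous map to the arrows is then smooth as soon as
its source and target are, and the orbits have the tangent spaces of the leaves
(`LocallyFibred.mem_orbitTangent`). The target isotropy groups are discrete, so the smoothness of
the inverse on isotropy is automatic (`IsFunctor.isMoritaMap`). -/

lemma _root_.IsLocalDiffeomorphAt.eventually_isLocalDiffeomorphAt {E H M E' H' M' : Type*}
    [NormedAddCommGroup E] [NormedSpace ℝ E] [NormedAddCommGroup E'] [NormedSpace ℝ E']
    [TopologicalSpace H] [TopologicalSpace H'] {I : ModelWithCorners ℝ E H}
    {I' : ModelWithCorners ℝ E' H'} [TopologicalSpace M] [ChartedSpace H M]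
    [TopologicalSpace M'] [ChartedSpace H' M'] {n : WithTop ℕ∞} {f : M → M'} {x : M}
    (h : IsLocalDiffeomorphAt I I' n f x) : ∀ᶠ z in 𝓝 x, IsLocalDiffeomorphAt I I' n f z := by
  obtain ⟨Φ, hΦ, e⟩ := h
  filter_upwards [Φ.open_source.mem_nhds hΦ] with z hz using ⟨Φ, hz, e⟩

lemma _root_.IsLocalDiffeomorphAt.eventually_injOn {E H M E' H' M' : Type*}
    [NormedAddCommGroup E] [NormedSpace ℝ E] [NormedAddCommGroup E'] [NormedSpace ℝ E']
    [TopologicalSpace H] [TopologicalSpace H'] {I : ModelWithCorners ℝ E H}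
    {I' : ModelWithCorners ℝ E' H'} [TopologicalSpace M] [ChartedSpace H M]
    [TopologicalSpace M'] [ChartedSpace H' M'] {n : WithTop ℕ∞} {f : M → M'} {x : M}
    (h : IsLocalDiffeomorphAt I I' n f x) : ∀ᶠ z in 𝓝 x, f z = f x ↔ z = x := by
  obtain ⟨Φ, hΦ, e⟩ := h
  filter_upwards [Φ.open_source.mem_nhds hΦ] with z hz
  rw [e hz, e hΦ]
  exact Φ.injOn.eq_iff hz hΦ

lemma IsTransverseAt.eventually {a : X → RR q} {x : X} (h : F.IsTransverseAt a x) :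
    ∀ᶠ z in 𝓝 x, F.IsTransverseAt a z := by
  obtain ⟨c, hc, hx, k, hk, e⟩ := h
  have cont : Tendsto (fun z => (c z).2) (𝓝 x) (𝓝 (c x).2) := by
    rw [← map_snd_chart c hx]; exact tendsto_map
  filter_upwards [c.open_source.mem_nhds hx, e.eventually_nhds,
    cont.eventually hk.eventually_isLocalDiffeomorphAt] with z h₁ h₂ h₃
  exact ⟨c, hc, h₁, k, h₃, h₂⟩

lemma IsTransverseAt.comp {a : X → RR q} {x : X} (h : F.IsTransverseAt a x) {k : RR q → RR q}
    (hk : IsLocalDiffeomorphAt 𝓘(ℝ, RR q) 𝓘(ℝ, RR q) ∞ k (a x)) :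
    F.IsTransverseAt (k ∘ a) x := by
  obtain ⟨c, hc, hx, l, hl, e⟩ := h
  refine ⟨c, hc, hx, k ∘ l, hl.comp 𝓘(ℝ, RR q) (RR q) ?_, ?_⟩
  · rw [← e.self_of_nhds]; exact hk
  · filter_upwards [e] with z hz
    simp only [Function.comp_apply, hz]

/-- A chart, a projection and a local diffeomorphism are each continuous and open, hence so is their
composite. Openness is what later produces intermediate points with a prescribed transverse value,
and turns identities of germs on `X` into identities of germs on `ℝ^q`. -/
lemma IsTransverseAt.map_nhds {a : X → RR q} {x : X} (h : F.IsTransverseAt a x) :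
    Filter.map a (𝓝 x) = 𝓝 (a x) := by
  obtain ⟨c, hc, hx, l, ⟨Φ, hΦ, e'⟩, e⟩ := h
  rw [Filter.map_congr e, show (fun z => l (c z).2) = l ∘ fun z => (c z).2 from rfl,
    ← Filter.map_map, map_snd_chart c hx, e.self_of_nhds]
  rw [Filter.map_congr (e'.eventuallyEq_of_mem (Φ.open_source.mem_nhds hΦ)), e' hΦ]
  exact Φ.toOpenPartialHomeomorph.map_nhds_eq hΦ

lemma IsTransverseAt.continuousAt {a : X → RR q} {x : X} (h : F.IsTransverseAt a x) :
    ContinuousAt a x := h.map_nhds.le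

/-- Both germs factor through the transverse part of the same foliated chart, and the local
diffeomorphism belonging to `a` can be inverted. Transverse coordinates at a point thus differ by
germs of diffeomorphisms of `ℝ^q`. -/
lemma IsTransverseAt.exists_factor {a b : X → RR q} {x : X} (h : F.IsTransverseAt a x)
    (h' : F.IsTransverseAt b x) :
    ∃ k : RR q → RR q, IsLocalDiffeomorphAt 𝓘(ℝ, RR q) 𝓘(ℝ, RR q) ∞ k (a x) ∧
      b =ᶠ[𝓝 x] k ∘ a := by
  obtain ⟨c, hc, hx, l, hl, e⟩ := h
  obtain ⟨k, hk, e'⟩ := h'.exists_eq hc hx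
  have hinv := hl.localInverse_isLocalDiffeomorphAt
  have hl' := hl.localInverse_eventuallyEq_left
  have cont : Tendsto (fun z => (c z).2) (𝓝 x) (𝓝 (c x).2) := by
    rw [← map_snd_chart c hx]; exact tendsto_map
  refine ⟨k ∘ hl.localInverse, ?_, ?_⟩
  · rw [e.self_of_nhds]
    refine hinv.comp 𝓘(ℝ, RR q) (RR q) ?_
    rw [show hl.localInverse (l (c x).2) = (c x).2 from hl'.self_of_nhds]
    exact hk
  · filter_upwards [e, e', cont.eventually hl'] with z h₁ h₂ h₃
    simp only [Function.comp_apply, id] at h₃ ⊢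
    rw [h₂, h₁, h₃]

lemma IsTransverseAt.eventually_eq_iff {a b : X → RR q} {x : X} (h : F.IsTransverseAt a x)
    (h' : F.IsTransverseAt b x) : ∀ᶠ z in 𝓝 x, a z = a x ↔ b z = b x := by
  obtain ⟨k, hk, e⟩ := h.exists_factor h'
  filter_upwards [e, h.continuousAt.eventually hk.eventually_injOn] with z h₁ h₂
  rw [h₁, e.self_of_nhds]
  exact h₂.symm

lemma isTransverseAt_chart {c : OpenPartialHomeomorph X (RR d × RR q)} (hc : c ∈ F.charts) {x : X}
    (hx : x ∈ c.source) : F.IsTransverseAt (fun z => (c z).2) x :=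
  ⟨c, hc, hx, id, (Diffeomorph.refl 𝓘(ℝ, RR q) (RR q) ∞).isLocalDiffeomorph _,
    Eventually.of_forall fun _ => rfl⟩

lemma exists_isTransverseAt (F : Foliation d q X) (x : X) : ∃ a, F.IsTransverseAt a x := by
  obtain ⟨c, hc, hx⟩ := F.cover x
  exact ⟨_, isTransverseAt_chart hc hx⟩

/-- Plaques do not depend on the transverse coordinate, by `IsTransverseAt.eventually_eq_iff`. A
condition that is required in every foliated chart can therefore be tested in one coordinate for
each time. -/
lemma isLeafwise_of_eventually {x y : X} {γ : Path x y}
    (h : ∀ t, ∃ a, F.IsTransverseAt a (γ t) ∧ ∀ᶠ τ in 𝓝 t, a (γ τ) = a (γ t)) :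
    F.IsLeafwise γ := by
  intro t c hc ht
  obtain ⟨a, ha, e⟩ := h t
  filter_upwards [e, γ.continuous.continuousAt.eventually
    (ha.eventually_eq_iff (isTransverseAt_chart hc ht))] with τ h₁ h₂ using h₂.mp h₁

lemma IsLeafwise.eventually_eq {x y : X} {γ : Path x y} (hγ : F.IsLeafwise γ) (t : unitInterval)
    {a : X → RR q} (ha : F.IsTransverseAt a (γ t)) : ∀ᶠ τ in 𝓝 t, a (γ τ) = a (γ t) := by
  obtain ⟨c, hc, hx⟩ := F.cover (γ t)
  filter_upwards [hγ t c hc hx, γ.continuous.continuousAt.eventually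
    (ha.eventually_eq_iff (isTransverseAt_chart hc hx))] with τ h₁ h₂ using h₂.mpr h₁

lemma IsTransverseAt.contMDiffAt {a : X → RR q} {x : X} (h : F.IsTransverseAt a x) :
    ContMDiffAt 𝓘(ℝ, RR (d + q)) 𝓘(ℝ, RR q) ∞ a x := by
  obtain ⟨c, hc, hx, l, hl, e⟩ := h
  refine ContMDiffAt.congr_of_eventuallyEq ?_ e
  refine ContMDiffAt.comp (I' := 𝓘(ℝ, RR q)) (g := l) (f := fun z => (c z).2) x hl.contMDiffAt ?_
  have h1 := (F.smooth c hc).contMDiffAt (c.open_source.mem_nhds hx)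
  exact (contDiff_snd (𝕜 := ℝ) (E := RR d) (F := RR q)).contMDiff.contMDiffAt.comp x h1

/-- A transverse coordinate is the second component of a smooth chart with convex target. -/
lemma IsTransverseAt.exists_chart {a : X → RR q} {x : X} (h : F.IsTransverseAt a x) {W : Set X}
    (hW : W ∈ 𝓝 x) :
    ∃ c : OpenPartialHomeomorph X (RR d × RR q), x ∈ c.source ∧ c.source ⊆ W ∧
      ContMDiffOn 𝓘(ℝ, RR (d + q)) 𝓘(ℝ, RR d × RR q) ∞ c c.source ∧
      ContMDiffOn 𝓘(ℝ, RR d × RR q) 𝓘(ℝ, RR (d + q)) ∞ c.symm c.target ∧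
      Convex ℝ c.target ∧ ∀ z ∈ c.source, (c z).2 = a z ∧ F.IsTransverseAt a z := by
  have hev := h.eventually
  obtain ⟨c, hc, hx, l, ⟨Φ, hΦ, e'⟩, e⟩ := h
  obtain ⟨U, hU, hUo, hxU⟩ := eventually_nhds_iff.mp ((hev.and e).and hW)
  -- Following the chart by the diffeomorphism `Φ` that extends the germ `l`, on the transverse
  -- factor only, turns its second component into `a`.
  let P := (OpenPartialHomeomorph.refl (RR d)).prod Φ.toOpenPartialHomeomorph
  have hP : ContMDiffOn 𝓘(ℝ, RR d × RR q) 𝓘(ℝ, RR d × RR q) ∞ P P.source := by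
    rw [contMDiffOn_iff_contDiffOn]
    exact contDiff_fst.contDiffOn.prodMk ((contMDiffOn_iff_contDiffOn.mp
      Φ.contMDiffOn_toFun).comp contDiff_snd.contDiffOn fun z hz => hz.2)
  have hP' : ContMDiffOn 𝓘(ℝ, RR d × RR q) 𝓘(ℝ, RR d × RR q) ∞ P.symm P.target := by
    rw [contMDiffOn_iff_contDiffOn]
    exact contDiff_fst.contDiffOn.prodMk ((contMDiffOn_iff_contDiffOn.mp
      Φ.contMDiffOn_invFun).comp contDiff_snd.contDiffOn fun z hz => hz.2)
  let c₁ := (c.trans P).restrOpen U hUo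
  have hx₁ : x ∈ c₁.source := ⟨⟨hx, trivial, hΦ⟩, hxU⟩
  obtain ⟨r, hr, hball⟩ := Metric.isOpen_iff.mp c₁.open_target _ (c₁.map_source hx₁)
  -- `restrOpen` shrinks a source, whereas convexity is wanted for the target: the chart is
  -- inverted, cut down to a ball, and inverted back.
  let c₂ := (c₁.symm.restrOpen (Metric.ball (c₁ x) r) Metric.isOpen_ball).symm
  have hsub : c₂.source ⊆ c₁.source := by
    intro z hz
    have := c₂.map_source hz
    have h₂ : c₂ z ∈ c₁.target := this.1
    have := c₁.map_target h₂
    rwa [show c₁.symm (c₂ z) = z from c₂.left_inv hz] at this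
  have htgt : c₂.target = Metric.ball (c₁ x) r := by
    change c₁.target ∩ _ = _
    exact inter_eq_right.mpr hball
  refine ⟨c₂, ?_, fun z hz => (hU z (hsub hz).2).2, ?_, ?_, ?_, ?_⟩
  · have : c₁ x ∈ c₂.target := by rw [htgt]; exact Metric.mem_ball_self hr
    have := c₂.map_target this
    rwa [show c₂.symm (c₁ x) = x from c₁.left_inv hx₁] at this
  · have : ContMDiffOn 𝓘(ℝ, RR (d + q)) 𝓘(ℝ, RR d × RR q) ∞ (P ∘ c) (c.trans P).source :=
      hP.comp ((F.smooth c hc).mono inter_subset_left) inter_subset_right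
    exact this.mono fun z hz => (hsub hz).1
  · have : ContMDiffOn 𝓘(ℝ, RR d × RR q) 𝓘(ℝ, RR (d + q)) ∞ (c.symm ∘ P.symm)
        (c.trans P).target :=
      (F.smooth_symm c hc).comp (hP'.mono inter_subset_left) inter_subset_right
    refine this.mono fun z hz => ?_
    exact (hball (htgt ▸ hz)).1
  · rw [htgt]; exact convex_ball _ _
  · intro z hz
    have h₁ := hsub hz
    refine ⟨?_, (hU z h₁.2).1.1⟩
    have h₂ : (c z).2 ∈ Φ.source := h₁.1.2.2
    rw [(hU z h₁.2).1.2, e' h₂]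
    rfl

/-! ### Transport and germs of arrows -/

/-- Locally in time the germ does not change and the path stays in a plaque, so the value of the
germ at the moving point is locally constant on the interval. -/
lemma IsContinuation.value_eq {x y : X} {γ : Path x y} (hγ : F.IsLeafwise γ)
    {σ : unitInterval → X → RR q} (h : F.IsContinuation γ σ) (s t : unitInterval) :
    σ s (γ s) = σ t (γ t) := by
  have key : IsLocallyConstant fun t => σ t (γ t) := by
    rw [IsLocallyConstant.iff_eventually_eq]
    intro t
    filter_upwards [h.locally_const t, hγ.eventually_eq t (h.transverse t)] with τ h₁ h₂
    rw [h₁.self_of_nhds, h₂]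
  exact key.apply_eq_of_preconnectedSpace s t

lemma Transports.value_eq {x y : X} {γ : Path x y} (hγ : F.IsLeafwise γ) {a b : X → RR q}
    (h : F.Transports γ a b) : a x = b y := by
  obtain ⟨σ, hσ, h0, h1⟩ := h
  rw [← h0.self_of_nhds, ← h1.self_of_nhds]
  have := hσ.value_eq hγ 0 1
  rwa [γ.source, γ.target] at this

/-- Composing a continuation with `k` gives a continuation. By `IsContinuation.value_eq` the
coordinate has one and the same value along the whole path, which is why it suffices that `k` is a
local diffeomorphism at that value. -/
lemma Transports.comp {x y : X} {γ : Path x y} (hγ : F.IsLeafwise γ) {a b : X → RR q}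
    (h : F.Transports γ a b) {k : RR q → RR q}
    (hk : IsLocalDiffeomorphAt 𝓘(ℝ, RR q) 𝓘(ℝ, RR q) ∞ k (a x)) :
    F.Transports γ (k ∘ a) (k ∘ b) := by
  have hv := h.value_eq hγ
  obtain ⟨σ, hσ, h0, h1⟩ := h
  refine ⟨fun t => k ∘ σ t, ⟨fun t => (hσ.transverse t).comp ?_, fun t => ?_⟩,
    h0.fun_comp k, h1.fun_comp k⟩
  · have := hσ.value_eq hγ t 1
    rw [this, γ.target, h1.self_of_nhds, ← hv]
    exact hk
  · filter_upwards [hσ.locally_const t] with τ h using h.fun_comp k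

lemma Transports.transverse_right {x y : X} {γ : Path x y} {a b : X → RR q}
    (h : F.Transports γ a b) : F.IsTransverseAt b y :=
  (transports_symm.mpr h).transverse_left

lemma Transports.right_unique {x y : X} {γ : Path x y} (hγ : F.IsLeafwise γ) {a b b' : X → RR q}
    (h : F.Transports γ a b) (h' : F.Transports γ a b') : b =ᶠ[𝓝 y] b' :=
  (transports_symm.mpr h).left_unique (isLeafwise_symm hγ) (transports_symm.mpr h')

/-- The arrow represented by a leafwise path. -/
def HolArr.mk {x y : X} (γ : Path x y) (hγ : F.IsLeafwise γ) : F.HolArr :=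
  ⟨x, y, Quotient.mk _ ⟨γ, hγ⟩⟩

lemma HolArr.carries_mk {x y : X} {γ : Path x y} {hγ : F.IsLeafwise γ} {a b : X → RR q} :
    (HolArr.mk γ hγ).Carries a b ↔ F.Transports γ a b := Iff.rfl

lemma HolArr.exists_path (g : F.HolArr) :
    ∃ γ : Path g.1 g.2.1, F.IsLeafwise γ ∧ ∀ a b, g.Carries a b ↔ F.Transports γ a b := by
  obtain ⟨x, y, k⟩ := g
  induction k using Quotient.inductionOn with
  | h γ => exact ⟨γ.1, γ.2, fun _ _ => Iff.rfl⟩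

namespace HolArr

variable {g : F.HolArr} {a b a' b' : X → RR q}

lemma Carries.transverse_src (h : g.Carries a b) : F.IsTransverseAt a g.1 := by
  obtain ⟨γ, hγ, e⟩ := g.exists_path
  exact ((e a b).mp h).transverse_left

lemma Carries.transverse_tgt (h : g.Carries a b) : F.IsTransverseAt b g.2.1 := by
  obtain ⟨γ, hγ, e⟩ := g.exists_path
  exact ((e a b).mp h).transverse_right

lemma Carries.value_eq (h : g.Carries a b) : a g.1 = b g.2.1 := by
  obtain ⟨γ, hγ, e⟩ := g.exists_path
  exact ((e a b).mp h).value_eq hγ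

lemma Carries.congr (h : g.Carries a b) (ea : a =ᶠ[𝓝 g.1] a') (eb : b =ᶠ[𝓝 g.2.1] b') :
    g.Carries a' b' := by
  obtain ⟨γ, hγ, e⟩ := g.exists_path
  exact (e _ _).mpr (((e a b).mp h).congr ea eb)

lemma Carries.comp (h : g.Carries a b) {k : RR q → RR q}
    (hk : IsLocalDiffeomorphAt 𝓘(ℝ, RR q) 𝓘(ℝ, RR q) ∞ k (a g.1)) :
    g.Carries (k ∘ a) (k ∘ b) := by
  obtain ⟨γ, hγ, e⟩ := g.exists_path
  exact (e _ _).mpr (((e a b).mp h).comp hγ hk)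

lemma Carries.right_unique (h : g.Carries a b) (h' : g.Carries a b') : b =ᶠ[𝓝 g.2.1] b' := by
  obtain ⟨γ, hγ, e⟩ := g.exists_path
  exact ((e _ _).mp h).right_unique hγ ((e _ _).mp h')

lemma Carries.left_unique (h : g.Carries a b) (h' : g.Carries a' b) : a =ᶠ[𝓝 g.1] a' := by
  obtain ⟨γ, hγ, e⟩ := g.exists_path
  exact ((e _ _).mp h).left_unique hγ ((e _ _).mp h')

lemma exists_carries (ha : F.IsTransverseAt a g.1) : ∃ b, g.Carries a b := by
  obtain ⟨γ, hγ, e⟩ := g.exists_path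
  obtain ⟨b, hb⟩ := exists_continuation hγ ha
  exact ⟨b, (e _ _).mpr hb⟩

/-- If an arrow carries `a` to `b`, then any other pair of germs that it carries is obtained by a
common change of transverse coordinate. -/
lemma Carries.exists_factor (h : g.Carries a b) (h' : g.Carries a' b') :
    ∃ k : RR q → RR q, IsLocalDiffeomorphAt 𝓘(ℝ, RR q) 𝓘(ℝ, RR q) ∞ k (a g.1) ∧
      a' =ᶠ[𝓝 g.1] k ∘ a ∧ b' =ᶠ[𝓝 g.2.1] k ∘ b := by
  obtain ⟨k, hk, e⟩ := h.transverse_src.exists_factor h'.transverse_src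
  exact ⟨k, hk, e, h'.right_unique ((h.comp hk).congr e.symm EventuallyEq.rfl)⟩

/-- Arrows with the same endpoints that carry one pair of germs to each other are equal. -/
lemma ext_of_carries {g g' : F.HolArr} (h₁ : g.1 = g'.1) (h₂ : g.2.1 = g'.2.1)
    (h : g.Carries a b) (h' : g'.Carries a b) : g = g' := by
  obtain ⟨x, y, k⟩ := g
  obtain ⟨x', y', k'⟩ := g'
  obtain rfl : x = x' := h₁
  obtain rfl : y = y' := h₂
  -- A class is determined by all the pairs that it carries, and each of these comes from `(a, b)`
  -- by a common change of coordinate.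
  have aux : ∀ k l : F.HolClass x y, HolArr.Carries ⟨x, y, k⟩ a b → HolArr.Carries ⟨x, y, l⟩ a b →
      ∀ a' b', HolArr.Carries ⟨x, y, k⟩ a' b' → HolArr.Carries ⟨x, y, l⟩ a' b' := by
    intro k l hk hl a' b' hk'
    obtain ⟨r, hr, e, e'⟩ := hk.exists_factor hk'
    exact (hl.comp hr).congr e.symm e'.symm
  have key : ∀ a' b', HolArr.Carries ⟨x, y, k⟩ a' b' ↔ HolArr.Carries ⟨x, y, k'⟩ a' b' :=
    fun a' b' => ⟨aux _ _ h h' a' b', aux _ _ h' h a' b'⟩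
  induction k using Quotient.inductionOn
  induction k' using Quotient.inductionOn
  exact congrArg (fun m => (⟨x, y, m⟩ : F.HolArr)) (Quotient.sound key)

lemma carries_one {x : X} (ha : F.IsTransverseAt a x) :
    HolArr.Carries (F.holonomyGroupoid.one x) a a :=
  transports_refl.mpr ⟨ha, EventuallyEq.rfl⟩

lemma Carries.inv (h : g.Carries a b) : HolArr.Carries (F.holonomyGroupoid.inv g) b a := by
  obtain ⟨x, y, k⟩ := g
  induction k using Quotient.inductionOn
  exact transports_symm.mpr h

lemma Carries.mul {g g' : F.HolArr} (w : F.holonomyGroupoid.src g = F.holonomyGroupoid.tgt g')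
    {c : X → RR q} (h' : g'.Carries a b) (h : g.Carries b c) :
    HolArr.Carries (F.holonomyGroupoid.mul g g' w) a c := by
  obtain ⟨x, y, k⟩ := g
  obtain ⟨x', y', k'⟩ := g'
  obtain rfl : x = y' := w
  induction k using Quotient.inductionOn
  induction k' using Quotient.inductionOn
  exact transports_trans.mpr ⟨b, h', h⟩

end HolArr

end Foliation

namespace Foliation

variable {d q : ℕ} {X : Type u} [TopologicalSpace X] [ChartedSpace (RR (d + q)) X]
  {F : Foliation d q X}

/-! ### Holonomy of nearby paths -/

/-- In a chart with convex target and second component `a`, the segment between two points with the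
same value of `a` stays in a plaque. Since `a` is defined near the whole segment, the constant
family `a` is a continuation along it. -/
lemma IsTransverseAt.eventually_exists_path {a : X → RR q} {x : X} (h : F.IsTransverseAt a x) :
    ∀ᶠ p : X × X in 𝓝 (x, x), a p.1 = a p.2 →
      ∃ γ : Path p.1 p.2, F.IsLeafwise γ ∧ F.Transports γ a a ∧ ∀ t, a (γ t) = a p.1 := by
  obtain ⟨c, hx, -, hs, hs', hconv, hc⟩ := h.exists_chart univ_mem
  filter_upwards [(c.open_source.prod c.open_source).mem_nhds (mk_mem_prod hx hx)]
  rintro ⟨y, z⟩ ⟨hy, hz⟩ e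
  change a y = a z at e
  have hmem : ∀ t : unitInterval, AffineMap.lineMap (c y) (c z) (t : ℝ) ∈ c.target := fun t =>
    hconv.lineMap_mem (c.map_source hy) (c.map_source hz) t.2
  let γ : Path y z :=
    { toFun := fun t => c.symm (AffineMap.lineMap (c y) (c z) (t : ℝ))
      continuous_toFun := c.continuousOn_symm.comp_continuous
        (by simp only [AffineMap.lineMap_apply]; fun_prop) hmem
      source' := by simp [c.left_inv hy]
      target' := by simp [c.left_inv hz] }
  have hγs : ∀ t, γ t ∈ c.source := fun t => c.map_target (hmem t)
  have hγa : ∀ t, a (γ t) = a y := by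
    intro t
    rw [← (hc _ (hγs t)).1]
    change (c (c.symm _)).2 = _
    rw [c.right_inv (hmem t)]
    have h1 : (c y).2 = (c z).2 := by rw [(hc y hy).1, (hc z hz).1, e]
    have h2 : (AffineMap.lineMap (c y) (c z) (t : ℝ)).2 = (c y).2 := by
      simp [AffineMap.lineMap_apply, h1]
    rw [h2, (hc y hy).1]
  refine ⟨γ, isLeafwise_of_eventually fun t => ⟨a, (hc _ (hγs t)).2, ?_⟩, ⟨fun _ => a,
    ⟨fun t => (hc _ (hγs t)).2, fun _ => Eventually.of_forall fun _ => EventuallyEq.rfl⟩,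
    EventuallyEq.rfl, EventuallyEq.rfl⟩, hγa⟩
  exact Eventually.of_forall fun τ => (hγa τ).trans (hγa t).symm

/-- The points near `x` and `y` with the same value of the transverse coordinates `a` and `b` are
joined by arrows that carry `a` to `b`. -/
def Slides (F : Foliation d q X) (x : X) (a : X → RR q) (y : X) (b : X → RR q) : Prop :=
  ∀ᶠ p : X × X in 𝓝 (x, y), a p.1 = b p.2 →
    ∃ g : F.HolArr, g.1 = p.1 ∧ g.2.1 = p.2 ∧ g.Carries a b

lemma Slides.symm {x y : X} {a b : X → RR q} (h : F.Slides x a y b) : F.Slides y b x a := by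
  have hsw : Tendsto (Prod.swap : X × X → X × X) (𝓝 (y, x)) (𝓝 (x, y)) :=
    continuous_swap.continuousAt
  filter_upwards [hsw.eventually h] with p hp e
  obtain ⟨g, h1, h2, h3⟩ := hp e.symm
  exact ⟨F.holonomyGroupoid.inv g, h2, h1, h3.inv⟩

/-- The two arrows are composed at a point near `y` where `b` has the common value. Such a point
exists because `b` is open at `y`. -/
lemma Slides.trans {x y z : X} {a b c : X → RR q} (h : F.Slides x a y b) (h' : F.Slides y b z c)
    (ha : F.IsTransverseAt a x) (hb : F.IsTransverseAt b y) (e : a x = b y) :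
    F.Slides x a z c := by
  unfold Slides at h h'
  rw [nhds_prod_eq, eventually_prod_iff] at h h'
  obtain ⟨P, hP, Q, hQ, H⟩ := h
  obtain ⟨P', hP', Q', hQ', H'⟩ := h'
  have him : b '' {w | Q w ∧ P' w} ∈ 𝓝 (b y) := by
    rw [← hb.map_nhds]; exact image_mem_map (hQ.and hP')
  have hU : ∀ᶠ x' in 𝓝 x, P x' ∧ a x' ∈ b '' {w | Q w ∧ P' w} :=
    hP.and (ha.continuousAt (by rw [e]; exact him))
  unfold Slides
  rw [nhds_prod_eq]
  filter_upwards [hU.prod_mk hQ'] with p hp ep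
  obtain ⟨⟨hp1, w, ⟨hw, hw'⟩, ew⟩, hp2⟩ := hp
  obtain ⟨g, g1, g2, g3⟩ := H hp1 hw ew.symm
  obtain ⟨g', g1', g2', g3'⟩ := H' hw' hp2 (ew.trans ep)
  have w₀ : F.holonomyGroupoid.src g' = F.holonomyGroupoid.tgt g := g1'.trans g2.symm
  exact ⟨F.holonomyGroupoid.mul g' g w₀, (F.holonomyGroupoid.src_mul _ _ _).trans g1,
    (F.holonomyGroupoid.tgt_mul _ _ _).trans g2', HolArr.Carries.mul w₀ g3 g3'⟩

lemma IsTransverseAt.slides_self {a : X → RR q} {x : X} (h : F.IsTransverseAt a x) :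
    F.Slides x a x a := by
  filter_upwards [h.eventually_exists_path] with p hp e
  obtain ⟨γ, h1, h2, -⟩ := hp e
  exact ⟨HolArr.mk γ h1, rfl, rfl, h2⟩

lemma IsContinuation.eventually_slides {x y : X} {γ : Path x y}
    {σ : unitInterval → X → RR q} (h : F.IsContinuation γ σ) (t : unitInterval) :
    ∀ᶠ τ in 𝓝 t, F.Slides (γ t) (σ t) (γ τ) (σ τ) := by
  have hcont : Tendsto (fun τ => (γ t, γ τ)) (𝓝 t) (𝓝 (γ t, γ t)) :=
    tendsto_const_nhds.prodMk_nhds γ.continuous.continuousAt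
  filter_upwards [hcont.eventually (h.transverse t).slides_self.eventually_nhds,
    h.locally_const t] with τ h₁ h₂
  have h₃ : ∀ᶠ p : X × X in 𝓝 (γ t, γ τ), σ τ =ᶠ[𝓝 p.2] σ t :=
    (continuous_snd.continuousAt (x := (γ t, γ τ))).eventually h₂.eventually_nhds
  filter_upwards [h₁, h₃] with p hp hp' e
  obtain ⟨g, g1, g2, g3⟩ := hp (by rw [e, hp'.self_of_nhds])
  exact ⟨g, g1, g2, g3.congr EventuallyEq.rfl (by rw [g2]; exact hp'.symm)⟩

/-- Sliding over a short time is possible inside one chart, and slides compose and invert, so the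
property is locally constant in `t`; at time `0` it is `IsTransverseAt.slides_self`. This takes the
place of chains of plaques: the leaves near that of `γ` are followed along `γ`. -/
lemma IsContinuation.slides {x y : X} {γ : Path x y} (hγ : F.IsLeafwise γ)
    {σ : unitInterval → X → RR q} (h : F.IsContinuation γ σ) (t : unitInterval) :
    F.Slides (γ 0) (σ 0) (γ t) (σ t) := by
  have key : IsLocallyConstant fun t => F.Slides (γ 0) (σ 0) (γ t) (σ t) := by
    rw [IsLocallyConstant.iff_eventually_eq]
    intro t
    filter_upwards [h.eventually_slides t] with τ h₁
    refine propext ⟨fun h₂ => ?_, fun h₂ => ?_⟩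
    · exact h₂.trans h₁.symm (h.transverse 0) (h.transverse τ) (h.value_eq hγ _ _)
    · exact h₂.trans h₁ (h.transverse 0) (h.transverse t) (h.value_eq hγ _ _)
  have := key.apply_eq_of_preconnectedSpace 0 t
  exact this ▸ (h.transverse 0).slides_self

lemma Slides.congr {x y : X} {a b a' b' : X → RR q} (h : F.Slides x a y b) (ea : a =ᶠ[𝓝 x] a')
    (eb : b =ᶠ[𝓝 y] b') : F.Slides x a' y b' := by
  have h₁ : ∀ᶠ p : X × X in 𝓝 (x, y), a =ᶠ[𝓝 p.1] a' :=
    (continuous_fst.continuousAt (x := (x, y))).eventually ea.eventually_nhds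
  have h₂ : ∀ᶠ p : X × X in 𝓝 (x, y), b =ᶠ[𝓝 p.2] b' :=
    (continuous_snd.continuousAt (x := (x, y))).eventually eb.eventually_nhds
  filter_upwards [h, h₁, h₂] with p hp h₁ h₂ e
  obtain ⟨g, g1, g2, g3⟩ := hp (by rw [h₁.self_of_nhds, e, h₂.self_of_nhds])
  exact ⟨g, g1, g2, g3.congr (by rw [g1]; exact h₁) (by rw [g2]; exact h₂)⟩

lemma HolArr.Carries.slides {g : F.HolArr} {a b : X → RR q} (h : g.Carries a b) :
    F.Slides g.1 a g.2.1 b := by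
  obtain ⟨γ, hγ, e⟩ := g.exists_path
  obtain ⟨σ, hσ, h0, h1⟩ := (e a b).mp h
  have := hσ.slides hγ 1
  rw [γ.source, γ.target] at this
  exact this.congr h0 h1

/-! ### The topology of the holonomy groupoid -/

namespace HolArr

lemma Carries.eventually {g : F.HolArr} {a b : X → RR q} (h : g.Carries a b) {U V : Set X}
    (hU : U ∈ 𝓝 g.1) (hV : V ∈ 𝓝 g.2.1) :
    ∀ᶠ g' : F.HolArr in 𝓝 g, g'.Carries a b ∧ g'.1 ∈ U ∧ g'.2.1 ∈ V := by
  obtain ⟨U', hU', hUo, hxU⟩ := eventually_nhds_iff.mp (h.transverse_src.eventually.and hU)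
  obtain ⟨V', hV', hVo, hyV⟩ := eventually_nhds_iff.mp (h.transverse_tgt.eventually.and hV)
  have ho : IsOpen {g' : F.HolArr | g'.1 ∈ U' ∧ g'.2.1 ∈ V' ∧ g'.Carries a b} :=
    TopologicalSpace.isOpen_generateFrom_of_mem ⟨U', V', a, b, hUo, hVo,
      fun z hz => (hU' z hz).1, fun z hz => (hV' z hz).1, rfl⟩
  filter_upwards [ho.mem_nhds ⟨hxU, hyV, h⟩] with g' hg'
  exact ⟨hg'.2.2, (hU' _ hg'.1).2, (hV' _ hg'.2.1).2⟩

lemma exists_carries_pair (g : F.HolArr) : ∃ a b, g.Carries a b := by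
  obtain ⟨a, ha⟩ := F.exists_isTransverseAt g.1
  exact ⟨a, exists_carries ha⟩

lemma continuous_src : Continuous fun g : F.HolArr => g.1 := by
  refine continuous_iff_continuousAt.mpr fun g U hU => ?_
  obtain ⟨a, b, h⟩ := g.exists_carries_pair
  exact (h.eventually hU univ_mem).mono fun g' hg' => hg'.2.1

lemma continuous_tgt : Continuous fun g : F.HolArr => g.2.1 := by
  refine continuous_iff_continuousAt.mpr fun g V hV => ?_
  obtain ⟨a, b, h⟩ := g.exists_carries_pair
  exact (h.eventually univ_mem hV).mono fun g' hg' => hg'.2.2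

/-- One carried pair gives a neighbourhood basis at `g`: any other pair carried by `g` is obtained
from it by a common change of coordinate, and this factorization persists at nearby endpoints. All
continuity statements about arrows reduce to following a single pair of germs. -/
lemma Carries.tendsto_iff {g : F.HolArr} {a b : X → RR q} (h : g.Carries a b) {ι : Type*}
    {l : Filter ι} {φ : ι → F.HolArr} :
    Tendsto φ l (𝓝 g) ↔ Tendsto (fun i => (φ i).1) l (𝓝 g.1) ∧
      Tendsto (fun i => (φ i).2.1) l (𝓝 g.2.1) ∧ ∀ᶠ i in l, (φ i).Carries a b := by
  constructor
  · intro H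
    refine ⟨(continuous_src.tendsto g).comp H, (continuous_tgt.tendsto g).comp H, ?_⟩
    filter_upwards [H.eventually (h.eventually univ_mem univ_mem)] with i hi using hi.1
  · rintro ⟨h₁, h₂, h₃⟩
    rw [TopologicalSpace.tendsto_nhds_generateFrom_iff]
    rintro _ ⟨U, V, a', b', hU, hV, -, -, rfl⟩ ⟨hgU, hgV, hg⟩
    obtain ⟨k, hk, ea, eb⟩ := h.exists_factor hg
    filter_upwards [h₁.eventually (hU.mem_nhds hgU), h₂.eventually (hV.mem_nhds hgV), h₃,
      h₁.eventually ea.eventually_nhds, h₂.eventually eb.eventually_nhds,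
      h₁.eventually (h.transverse_src.continuousAt.eventually
        hk.eventually_isLocalDiffeomorphAt)] with i i1 i2 i3 i4 i5 i6
    exact ⟨i1, i2, (i3.comp i6).congr (EventuallyEq.symm i4) (EventuallyEq.symm i5)⟩

end HolArr

/-- Near `g`, the map `(s, t) : A → X × X` identifies `A` with the fibre product
`{(x, y) | a x = b y}` of the transverse coordinates `a` and `b`, with inverse `r`. -/
structure IsLocalSection (F : Foliation d q X) {A : Type u} [TopologicalSpace A] (s t : A → X)
    (g : A) (a b : X → RR q) (r : X × X → A) : Prop where
  transverse_src : F.IsTransverseAt a (s g)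
  transverse_tgt : F.IsTransverseAt b (t g)
  left_inv : ∀ᶠ g' in 𝓝 g, a (s g') = b (t g') ∧ r (s g', t g') = g'
  right_inv : ∀ᶠ p in 𝓝[{p : X × X | a p.1 = b p.2}] (s g, t g), s (r p) = p.1 ∧ t (r p) = p.2 ∧
    ContinuousWithinAt r {p : X × X | a p.1 = b p.2} p

/-- `(s, t) : A → X × X` identifies `A` locally with the submanifolds `{(x, y) | a x = b y}` of
`X × X`, for transverse coordinates `a` and `b`. -/
structure LocallyFibred (F : Foliation d q X) {A : Type u} [TopologicalSpace A] (s t : A → X) :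
    Prop where
  continuous_src : Continuous s
  continuous_tgt : Continuous t
  exists_section : ∀ g, ∃ (a b : X → RR q) (r : X × X → A), F.IsLocalSection s t g a b r

/-- The inverse `r` sends `(x, y)` to the arrow from `x` to `y` that carries `a` to `b`. Near the
endpoints of `g` it exists by `HolArr.Carries.slides`, and it is unique by `HolArr.ext_of_carries`.
The value `g` elsewhere is a dummy. -/
lemma locallyFibred_holonomyGroupoid (F : Foliation d q X) :
    F.LocallyFibred F.holonomyGroupoid.src F.holonomyGroupoid.tgt := by
  classical
  refine ⟨HolArr.continuous_src, HolArr.continuous_tgt, fun g => ?_⟩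
  obtain ⟨a, b, h⟩ := g.exists_carries_pair
  let r : X × X → F.HolArr := fun p =>
    if w : ∃ g : F.HolArr, g.1 = p.1 ∧ g.2.1 = p.2 ∧ g.Carries a b then w.choose else g
  have hr : ∀ p, (∃ g : F.HolArr, g.1 = p.1 ∧ g.2.1 = p.2 ∧ g.Carries a b) →
      (r p).1 = p.1 ∧ (r p).2.1 = p.2 ∧ (r p).Carries a b := by
    intro p w
    have e : r p = w.choose := dif_pos w
    rw [e]
    exact w.choose_spec
  have hS : ∀ᶠ p in 𝓝[{p : X × X | a p.1 = b p.2}] (g.1, g.2.1),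
      (r p).1 = p.1 ∧ (r p).2.1 = p.2 ∧ (r p).Carries a b := by
    rw [eventually_nhdsWithin_iff]
    filter_upwards [h.slides] with p hp hpS using hr p (hp hpS)
  refine ⟨a, b, r, h.transverse_src, h.transverse_tgt, ?_, ?_⟩
  · filter_upwards [h.eventually univ_mem univ_mem] with g' hg'
    refine ⟨hg'.1.value_eq, ?_⟩
    obtain ⟨h1, h2, h3⟩ := hr (g'.1, g'.2.1) ⟨g', rfl, rfl, hg'.1⟩
    exact HolArr.ext_of_carries h1 h2 h3 hg'.1
  · filter_upwards [eventually_eventually_nhdsWithin.mpr hS, hS] with p hp hp₀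
    refine ⟨hp₀.1, hp₀.2.1, ?_⟩
    refine hp₀.2.2.tendsto_iff.mpr ⟨?_, ?_, ?_⟩
    · rw [hp₀.1]
      refine Tendsto.congr' (EventuallyEq.symm (hp.mono fun p' h => h.1)) ?_
      exact continuous_fst.continuousWithinAt
    · rw [hp₀.2.1]
      refine Tendsto.congr' (EventuallyEq.symm (hp.mono fun p' h => h.2.1)) ?_
      exact continuous_snd.continuousWithinAt
    · exact hp.mono fun p' h => h.2.2

/-! ### Continuity of the structure maps of the holonomy groupoid and separation of their fibres -/

lemma continuous_holonomyGroupoid_one (F : Foliation d q X) :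
    Continuous F.holonomyGroupoid.one := by
  refine continuous_iff_continuousAt.mpr fun x => ?_
  obtain ⟨a, ha⟩ := F.exists_isTransverseAt x
  refine (HolArr.carries_one ha).tendsto_iff.mpr ⟨tendsto_id, tendsto_id, ?_⟩
  exact ha.eventually.mono fun _ h => HolArr.carries_one h

lemma continuous_holonomyGroupoid_inv (F : Foliation d q X) :
    Continuous F.holonomyGroupoid.inv := by
  refine continuous_iff_continuousAt.mpr fun g => ?_
  obtain ⟨a, b, h⟩ := g.exists_carries_pair
  refine h.inv.tendsto_iff.mpr
    ⟨HolArr.continuous_tgt.tendsto g, HolArr.continuous_src.tendsto g, ?_⟩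
  exact (h.eventually univ_mem univ_mem).mono fun _ h => h.1.inv

open Classical in
lemma continuousOn_holonomyGroupoid_mul (F : Foliation d q X) :
    ContinuousOn (fun r : F.HolArr × F.HolArr =>
      if w : F.holonomyGroupoid.src r.1 = F.holonomyGroupoid.tgt r.2 then
        F.holonomyGroupoid.mul r.1 r.2 w else r.1)
      {r | F.holonomyGroupoid.src r.1 = F.holonomyGroupoid.tgt r.2} := by
  rintro ⟨g, g'⟩ (w : F.holonomyGroupoid.src g = F.holonomyGroupoid.tgt g')
  obtain ⟨a, b, h'⟩ := g'.exists_carries_pair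
  -- The germ `b` at which `g'` ends is continued along `g`, so that a single pair `(a, c)` controls
  -- the product near `(g, g')`.
  obtain ⟨c, h⟩ := HolArr.exists_carries (g := g) (a := b) (by
    rw [show g.1 = g'.2.1 from w]; exact h'.transverse_tgt)
  have hm := HolArr.Carries.mul w h' h
  have hs : Tendsto (fun r : F.HolArr × F.HolArr => r) (𝓝[{r | F.holonomyGroupoid.src r.1 =
      F.holonomyGroupoid.tgt r.2}] (g, g')) (𝓝 (g, g')) := tendsto_id.mono_right inf_le_left
  have h1 := (continuous_fst.tendsto (g, g')).comp hs
  have h2 := (continuous_snd.tendsto (g, g')).comp hs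
  set μ : F.HolArr × F.HolArr → F.HolArr := fun r =>
    if w : F.holonomyGroupoid.src r.1 = F.holonomyGroupoid.tgt r.2 then
        F.holonomyGroupoid.mul r.1 r.2 w else r.1 with hμ
  have hμ' : ∀ r w, μ r = F.holonomyGroupoid.mul r.1 r.2 w := fun r w => dif_pos w
  unfold ContinuousWithinAt
  rw [hμ' _ w]
  refine hm.tendsto_iff.mpr ⟨?_, ?_, ?_⟩
  · rw [show (F.holonomyGroupoid.mul g g' w).1 = g'.1 from F.holonomyGroupoid.src_mul g g' w]
    refine Tendsto.congr' ?_ ((HolArr.continuous_src.tendsto g').comp h2)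
    filter_upwards [self_mem_nhdsWithin] with r hr
    rw [hμ' r hr]
    exact (F.holonomyGroupoid.src_mul _ _ _).symm
  · rw [show (F.holonomyGroupoid.mul g g' w).2.1 = g.2.1 from F.holonomyGroupoid.tgt_mul g g' w]
    refine Tendsto.congr' ?_ ((HolArr.continuous_tgt.tendsto g).comp h1)
    filter_upwards [self_mem_nhdsWithin] with r hr
    rw [hμ' r hr]
    exact (F.holonomyGroupoid.tgt_mul _ _ _).symm
  · filter_upwards [self_mem_nhdsWithin, h1.eventually (h.eventually univ_mem univ_mem),
      h2.eventually (h'.eventually univ_mem univ_mem)] with r hr hr1 hr2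
    rw [hμ' r hr]
    exact HolArr.Carries.mul _ hr2.1 hr1.1

/-- Two arrows with the same source that are not equal are separated, relatively to the source
fibre. -/
lemma t2Space_holonomyGroupoid_src_fiber [T2Space X] (F : Foliation d q X) (x : X) :
    T2Space (F.holonomyGroupoid.src ⁻¹' {x}) := by
  refine t2_iff_nhds.mpr ?_
  rintro ⟨g, hg⟩ ⟨g', hg'⟩ hne
  have hg : g.1 = x := hg
  have hg' : g'.1 = x := hg'
  rw [nhds_subtype_eq_comap, nhds_subtype_eq_comap, ← comap_inf] at hne
  -- `t2_iff_nhds` asks for equality of two arrows whose neighbourhoods always meet. Here they meet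
  -- in the source fibre, which supplies an arrow `z` over `x` close to both.
  have hne' : ∃ᶠ z in 𝓝 g ⊓ 𝓝 g', z ∈ F.holonomyGroupoid.src ⁻¹' {x} := by
    have := (comap_neBot_iff_frequently.mp hne)
    refine this.mono ?_
    rintro _ ⟨z, rfl⟩
    exact z.2
  have ht : g.2.1 = g'.2.1 := by
    refine tendsto_nhds_unique_of_frequently_eq
      (l := 𝓝 g ⊓ 𝓝 g') (f := fun z => z.2.1) (g := fun z => z.2.1)
      ((HolArr.continuous_tgt.tendsto g).mono_left inf_le_left)
      ((HolArr.continuous_tgt.tendsto g').mono_left inf_le_right)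
      (hne'.mono fun _ _ => rfl)
  obtain ⟨a, b, h⟩ := g.exists_carries_pair
  obtain ⟨b', h'⟩ := HolArr.exists_carries (g := g') (a := a) (by
    rw [hg', ← hg]; exact h.transverse_src)
  have hb' : F.IsTransverseAt b' g.2.1 := by rw [ht]; exact h'.transverse_tgt
  obtain ⟨k, hk, e⟩ := h.transverse_tgt.exists_factor hb'
  have e₁ : ∀ᶠ z : F.HolArr in 𝓝 g ⊓ 𝓝 g', b' =ᶠ[𝓝 z.2.1] k ∘ b :=
    ((HolArr.continuous_tgt.tendsto g).eventually e.eventually_nhds).filter_mono inf_le_left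
  have e₂ : ∀ᶠ z : F.HolArr in 𝓝 g ⊓ 𝓝 g', z.Carries a b :=
    ((h.eventually univ_mem univ_mem).mono fun _ h => h.1).filter_mono inf_le_left
  have e₃ : ∀ᶠ z : F.HolArr in 𝓝 g ⊓ 𝓝 g', z.Carries a b' :=
    ((h'.eventually univ_mem univ_mem).mono fun _ h => h.1).filter_mono inf_le_right
  obtain ⟨z, hz, z1, z2, z3⟩ := (hne'.and_eventually (e₁.and (e₂.and e₃))).exists
  have hz : z.1 = x := hz
  have z4 := z2.right_unique z3
  have htr := z2.transverse_tgt
  -- This is where the common source is used. An arrow `z` near both carries `a` to `b` and to `b' =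
  -- k ∘ b`, so `k` is the identity near `b (tgt z)`. Since `z` and `g` start at the same point,
  -- that value is also `b (tgt g)`, and so `b'` and `b` have the same germ at the target of `g`.
  have hval : b z.2.1 = b g.2.1 := by rw [← z2.value_eq, ← h.value_eq, hz, hg]
  have hkid : ∀ᶠ w in 𝓝 (b z.2.1), k w = w := by
    rw [← htr.map_nhds]
    change ∀ᶠ w in 𝓝 z.2.1, k (b w) = b w
    filter_upwards [z4, z1] with w w1 w2
    exact w2.symm.trans w1.symm
  rw [hval] at hkid
  have hbb : b' =ᶠ[𝓝 g.2.1] b := by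
    filter_upwards [e, h.transverse_tgt.continuousAt.eventually hkid] with w w1 w2
    rw [w1]; exact w2
  refine Subtype.ext (HolArr.ext_of_carries (hg.trans hg'.symm) ht h ?_)
  exact h'.congr EventuallyEq.rfl (by rw [← ht]; exact hbb)

lemma t2Space_holonomyGroupoid_tgt_fiber [T2Space X] (F : Foliation d q X) (x : X) :
    T2Space (F.holonomyGroupoid.tgt ⁻¹' {x}) := by
  have := F.t2Space_holonomyGroupoid_src_fiber x
  have hinj : Function.Injective fun z : F.holonomyGroupoid.tgt ⁻¹' {x} =>
      (⟨F.holonomyGroupoid.inv z.1, z.2⟩ : F.holonomyGroupoid.src ⁻¹' {x}) := by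
    rintro ⟨z, hz⟩ ⟨z', hz'⟩ e
    have e' : F.holonomyGroupoid.inv z = F.holonomyGroupoid.inv z' := congrArg Subtype.val e
    refine Subtype.ext ?_
    obtain ⟨a, b, h⟩ := z.exists_carries_pair
    have h₁ := h.inv
    rw [e'] at h₁
    obtain ⟨a', b', h'⟩ := z'.exists_carries_pair
    obtain ⟨b₁, hb₁⟩ := HolArr.exists_carries (g := z') (a := a) (by
      have : z.1 = z'.1 := congrArg (fun g : F.HolArr => g.2.1) e'
      rw [← this]; exact h.transverse_src)
    have hs : z.1 = z'.1 := congrArg (fun g : F.HolArr => g.2.1) e'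
    have ht : z.2.1 = z'.2.1 := congrArg (fun g : F.HolArr => g.1) e'
    exact HolArr.ext_of_carries hs ht h
      (hb₁.congr EventuallyEq.rfl (hb₁.inv.left_unique h₁))
  exact T2Space.of_injective_continuous hinj
    ((F.continuous_holonomyGroupoid_inv.comp continuous_subtype_val).subtype_mk _)

end Foliation

namespace Foliation

variable {d q : ℕ} {X : Type u} [TopologicalSpace X] [ChartedSpace (RR (d + q)) X]
  {F : Foliation d q X} {A : Type u} [TopologicalSpace A] {s t : A → X}

/-! ### Manifolds that are locally fibre products of transverse coordinates -/

/-- The charts of the smooth structure on `A` for which `(s, t) : A → X × X` is an immersion. -/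
def fibredAtlas (d q : ℕ) {X : Type u} [TopologicalSpace X] [ChartedSpace (RR (d + q)) X]
    {A : Type u} [TopologicalSpace A] (s t : A → X) :
    Set (OpenPartialHomeomorph A (RR (d + d + q))) :=
  {e | ContMDiffOn 𝓘(ℝ, RR (d + d + q)) (𝓘(ℝ, RR (d + q)).prod 𝓘(ℝ, RR (d + q))) ∞
      (fun z => (s (e.symm z), t (e.symm z))) e.target ∧
    ∀ g ∈ e.source, ∃ Ψ : X × X → RR (d + d + q),
      ContMDiffAt (𝓘(ℝ, RR (d + q)).prod 𝓘(ℝ, RR (d + q))) 𝓘(ℝ, RR (d + d + q)) ∞ Ψ (s g, t g) ∧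
      ∀ᶠ g' in 𝓝 g, e g' = Ψ (s g', t g')}

/-- A linear identification of the model spaces. -/
def modelEquiv (d q : ℕ) : (RR d × RR d × RR q) ≃L[ℝ] RR (d + d + q) :=
  ContinuousLinearEquiv.ofFinrankEq (by simp [Module.finrank_prod, add_assoc])

/-- In charts `(u, y)` at `s g` and `(v, y')` at `t g` that straighten `a` and `b`, the fibre
product is the submanifold `y = y'`, with coordinates `(u, v, y)`. The chart is `ψ ∘ (s, t)`, where
`ψ` reads off these coordinates, and its inverse is `r ∘ m`, where `m` parametrizes the submanifold.
-/
lemma IsLocalSection.exists_chart {g : A} {a b : X → RR q} {r : X × X → A}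
    (h : F.IsLocalSection s t g a b r) (hs : Continuous s) (ht : Continuous t) :
    ∃ e ∈ fibredAtlas d q s t, g ∈ e.source := by
  obtain ⟨ca, ha0, -, hca, hca', -, ha⟩ := h.transverse_src.exists_chart univ_mem
  obtain ⟨cb, hb0, -, hcb, hcb', -, hb⟩ := h.transverse_tgt.exists_chart univ_mem
  obtain ⟨N, hN, hNo, hgN⟩ := eventually_nhds_iff.mp h.left_inv
  set S : Set (X × X) := {p | a p.1 = b p.2} with hSdef
  have hgS : (s g, t g) ∈ S := (hN g hgN).1
  have hrg : r (s g, t g) = g := (hN g hgN).2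
  have hrc : ContinuousWithinAt r S (s g, t g) := (h.right_inv.self_of_nhdsWithin hgS).2.2
  have hrN : ∀ᶠ p in 𝓝[S] (s g, t g), r p ∈ N :=
    hrc.eventually (by rw [hrg]; exact hNo.mem_nhds hgN)
  obtain ⟨W₁, hW₁, hW₁o, hgW₁⟩ :=
    eventually_nhds_iff.mp (eventually_nhdsWithin_iff.mp (h.right_inv.and hrN))
  let W : Set (X × X) := W₁ ∩ ca.source ×ˢ cb.source
  have hWo : IsOpen W := hW₁o.inter (ca.open_source.prod cb.open_source)
  let L := modelEquiv d q
  let m : RR (d + d + q) → X × X := fun z =>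
    (ca.symm ((L.symm z).1, (L.symm z).2.2), cb.symm ((L.symm z).2.1, (L.symm z).2.2))
  let T₀ : Set (RR (d + d + q)) := {z | ((L.symm z).1, (L.symm z).2.2) ∈ ca.target ∧
    ((L.symm z).2.1, (L.symm z).2.2) ∈ cb.target}
  have hL1 : ContDiff ℝ ∞ fun z => ((L.symm z).1, (L.symm z).2.2) := by fun_prop
  have hL2 : ContDiff ℝ ∞ fun z => ((L.symm z).2.1, (L.symm z).2.2) := by fun_prop
  have hT₀ : IsOpen T₀ := (ca.open_target.preimage hL1.continuous).inter
    (cb.open_target.preimage hL2.continuous)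
  have hmsm : ContMDiffOn 𝓘(ℝ, RR (d + d + q)) (𝓘(ℝ, RR (d + q)).prod 𝓘(ℝ, RR (d + q))) ∞ m T₀ :=
    (hca'.comp hL1.contMDiff.contMDiffOn fun z hz => hz.1).prodMk
      (hcb'.comp hL2.contMDiff.contMDiffOn fun z hz => hz.2)
  have hmS : ∀ z ∈ T₀, m z ∈ S := by
    intro z hz
    change a (ca.symm _) = b (cb.symm _)
    rw [← (ha _ (ca.map_target hz.1)).1, ← (hb _ (cb.map_target hz.2)).1, ca.right_inv hz.1,
      cb.right_inv hz.2]
  let T : Set (RR (d + d + q)) := T₀ ∩ m ⁻¹' W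
  have hTo : IsOpen T := hmsm.continuousOn.isOpen_inter_preimage hT₀ hWo
  let ψ : X × X → RR (d + d + q) := fun p => L ((ca p.1).1, (cb p.2).1, (ca p.1).2)
  have hψ : ContMDiffOn (𝓘(ℝ, RR (d + q)).prod 𝓘(ℝ, RR (d + q))) 𝓘(ℝ, RR (d + d + q)) ∞ ψ
      (ca.source ×ˢ cb.source) := by
    have h1 : ContMDiffOn (𝓘(ℝ, RR (d + q)).prod 𝓘(ℝ, RR (d + q))) 𝓘(ℝ, RR d × RR q) ∞
        (fun p : X × X => ca p.1) (ca.source ×ˢ cb.source) :=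
      hca.comp contMDiff_fst.contMDiffOn fun p hp => hp.1
    have h2 : ContMDiffOn (𝓘(ℝ, RR (d + q)).prod 𝓘(ℝ, RR (d + q))) 𝓘(ℝ, RR d × RR q) ∞
        (fun p : X × X => cb p.2) (ca.source ×ˢ cb.source) :=
      hcb.comp contMDiff_snd.contMDiffOn fun p hp => hp.2
    have h3 : ContDiff ℝ ∞ fun z : (RR d × RR q) × (RR d × RR q) => L (z.1.1, z.2.1, z.1.2) := by
      fun_prop
    exact h3.contMDiff.comp_contMDiffOn (h1.prodMk_space h2)
  let N' : Set A := N ∩ (fun g => (s g, t g)) ⁻¹' W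
  have hjc : Continuous fun g => (s g, t g) := hs.prodMk ht
  have hmψ : ∀ g' ∈ N', m (ψ (s g', t g')) = (s g', t g') := by
    rintro g' ⟨h1, h2⟩
    have h3 : (cb (t g')).2 = (ca (s g')).2 := by
      rw [(ha _ h2.2.1).1, (hb _ h2.2.2).1, (hN g' h1).1]
    refine Prod.ext ?_ ?_
    · simp only [m, ψ, L.symm_apply_apply]
      exact ca.left_inv h2.2.1
    · simp only [m, ψ, L.symm_apply_apply]
      rw [← h3]
      exact cb.left_inv h2.2.2
  have hψT : ∀ g' ∈ N', ψ (s g', t g') ∈ T := by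
    rintro g' ⟨h1, h2⟩
    refine ⟨⟨?_, ?_⟩, ?_⟩
    · simp only [ψ, L.symm_apply_apply]
      exact ca.map_source h2.2.1
    · simp only [ψ, L.symm_apply_apply]
      rw [(ha _ h2.2.1).1, (hN g' h1).1, ← (hb _ h2.2.2).1]
      exact cb.map_source h2.2.2
    · change m _ ∈ W
      rw [hmψ g' ⟨h1, h2⟩]
      exact h2
  have hrm : ∀ z ∈ T, s (r (m z)) = (m z).1 ∧ t (r (m z)) = (m z).2 := fun z hz =>
    have := hW₁ _ hz.2.1 (hmS z hz.1)
    ⟨this.1.1, this.1.2.1⟩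
  let e : OpenPartialHomeomorph A (RR (d + d + q)) :=
    { toFun := fun g => ψ (s g, t g)
      invFun := fun z => r (m z)
      source := N'
      target := T
      map_source' := hψT
      map_target' := fun z hz => by
        have := hW₁ _ hz.2.1 (hmS z hz.1)
        refine ⟨this.2, ?_⟩
        change (s (r (m z)), t (r (m z))) ∈ W
        rw [(hrm z hz).1, (hrm z hz).2]
        exact hz.2
      left_inv' := fun g' hg' => by
        rw [hmψ g' hg', (hN g' hg'.1).2]
      right_inv' := fun z hz => by
        rw [(hrm z hz).1, (hrm z hz).2]
        simp only [m, ψ]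
        rw [ca.right_inv hz.1.1, cb.right_inv hz.1.2]
        exact L.apply_symm_apply z
      open_source := hNo.inter (hWo.preimage hjc)
      open_target := hTo
      continuousOn_toFun := hψ.continuousOn.comp hjc.continuousOn fun g' hg' => hg'.2.2
      continuousOn_invFun := fun z hz => by
        have h1 := (hW₁ _ hz.2.1 (hmS z hz.1)).1.2.2
        exact h1.comp ((hmsm.continuousOn z hz.1).mono inter_subset_left)
          fun z' hz' => hmS z' hz'.1 }
  refine ⟨e, ⟨?_, ?_⟩, hgN, hgW₁, ha0, hb0⟩
  · exact (hmsm.mono inter_subset_left).congr fun z hz => Prod.ext (hrm z hz).1 (hrm z hz).2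
  · intro g' hg'
    refine ⟨ψ, ?_, Eventually.of_forall fun _ => rfl⟩
    exact hψ.contMDiffAt ((ca.open_source.prod cb.open_source).mem_nhds hg'.2.2)

/-- The charted space structure on `A` with atlas `fibredAtlas d q s t`. -/
@[reducible]
def LocallyFibred.chartedSpace (h : F.LocallyFibred s t) : ChartedSpace (RR (d + d + q)) A where
  atlas := fibredAtlas d q s t
  chartAt g := (h.exists_section g).choose_spec.choose_spec.choose_spec.exists_chart
    h.continuous_src h.continuous_tgt |>.choose
  mem_chart_source g := ((h.exists_section g).choose_spec.choose_spec.choose_spec.exists_chart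
    h.continuous_src h.continuous_tgt).choose_spec.2
  chart_mem_atlas g := ((h.exists_section g).choose_spec.choose_spec.choose_spec.exists_chart
    h.continuous_src h.continuous_tgt).choose_spec.1

section Smooth

variable [ChartedSpace (RR (d + d + q)) A]

/-- A change of charts `e' ∘ e⁻¹` is locally `Ψ ∘ ((s, t) ∘ e⁻¹)`. The first factor is smooth by the
second condition on `e'`, the other by the first condition on `e`. -/
lemma isManifold_of_atlas_eq (hA : atlas (RR (d + d + q)) A = fibredAtlas d q s t) :
    IsManifold 𝓘(ℝ, RR (d + d + q)) ∞ A := by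
  refine isManifold_of_contDiffOn _ _ _ fun e e' he he' => ?_
  rw [hA] at he he'
  simp only [modelWithCornersSelf_coe, modelWithCornersSelf_coe_symm, Function.id_comp,
    Function.comp_id, preimage_id, range_id, inter_univ]
  rw [← contMDiffOn_iff_contDiffOn]
  intro z hz
  have hz1 : z ∈ e.target := hz.1
  have hz2 : e.symm z ∈ e'.source := hz.2
  obtain ⟨Ψ, hΨ, hΨe⟩ := he'.2 _ hz2
  have h1 := he.1.contMDiffAt (e.open_target.mem_nhds hz1)
  have h2 := ContMDiffAt.comp (g := Ψ) z hΨ h1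
  refine (h2.congr_of_eventuallyEq ?_).contMDiffWithinAt
  filter_upwards [(e.continuousAt_symm hz1).eventually hΨe] with w hw using hw

variable (hA : atlas (RR (d + d + q)) A = fibredAtlas d q s t)
include hA

lemma contMDiff_of_atlas_eq : ContMDiff 𝓘(ℝ, RR (d + d + q))
    (𝓘(ℝ, RR (d + q)).prod 𝓘(ℝ, RR (d + q))) ∞ fun g => (s g, t g) := by
  have := isManifold_of_atlas_eq hA
  intro g
  have he := chart_mem_atlas (RR (d + d + q)) g
  rw [hA] at he
  have hg := mem_chart_source (RR (d + d + q)) g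
  have h1 := he.1.contMDiffAt ((chartAt (RR (d + d + q)) g).open_target.mem_nhds
    ((chartAt (RR (d + d + q)) g).map_source hg))
  have h2 := (contMDiffOn_chart (I := 𝓘(ℝ, RR (d + d + q))) (n := ∞) (x := g)).contMDiffAt
    ((chartAt (RR (d + d + q)) g).open_source.mem_nhds hg)
  refine (h1.comp g h2).congr_of_eventuallyEq ?_
  filter_upwards [(chartAt (RR (d + d + q)) g).open_source.mem_nhds hg] with g' hg'
  simp only [Function.comp_apply, (chartAt (RR (d + d + q)) g).left_inv hg']

/-- A continuous map to `A` is smooth if its composite with `(s, t)` is. -/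
lemma contMDiffWithinAt_of_atlas_eq {E H N : Type*} [NormedAddCommGroup E] [NormedSpace ℝ E]
    [TopologicalSpace H] {I : ModelWithCorners ℝ E H} [TopologicalSpace N] [ChartedSpace H N]
    {φ : N → A} {U : Set N} {x : N} (hc : ContinuousWithinAt φ U x)
    (hs : ContMDiffWithinAt I 𝓘(ℝ, RR (d + q)) ∞ (fun z => s (φ z)) U x)
    (ht : ContMDiffWithinAt I 𝓘(ℝ, RR (d + q)) ∞ (fun z => t (φ z)) U x) :
    ContMDiffWithinAt I 𝓘(ℝ, RR (d + d + q)) ∞ φ U x := by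
  have := isManifold_of_atlas_eq hA
  set e := chartAt (RR (d + d + q)) (φ x) with hedef
  have he : e ∈ atlas (RR (d + d + q)) A := chart_mem_atlas (RR (d + d + q)) (φ x)
  rw [hA] at he
  have hg : φ x ∈ e.source := mem_chart_source (RR (d + d + q)) (φ x)
  obtain ⟨Ψ, hΨ, hΨe⟩ := he.2 _ hg
  have h1 : ContMDiffWithinAt I 𝓘(ℝ, RR (d + d + q)) ∞ (fun z => Ψ (s (φ z), t (φ z))) U x :=
    ContMDiffAt.comp_contMDiffWithinAt (g := Ψ) x hΨ (hs.prodMk ht)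
  have h2 := (contMDiffOn_chart_symm (I := 𝓘(ℝ, RR (d + d + q))) (n := ∞) (x := φ x)).contMDiffAt
    (e.open_target.mem_nhds (e.map_source hg))
  have e1 := (hΨe.and (e.open_source.mem_nhds hg)).self_of_nhds
  have h3 : ContMDiffWithinAt I 𝓘(ℝ, RR (d + d + q)) ∞
      (e.symm ∘ fun z => Ψ (s (φ z), t (φ z))) U x := by
    refine ContMDiffAt.comp_contMDiffWithinAt (g := e.symm) x ?_ h1
    rw [← e1.1]; exact h2
  refine h3.congr_of_eventuallyEq ?_ ?_
  · filter_upwards [hc.eventually (hΨe.and (e.open_source.mem_nhds hg))] with z hz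
    simp only [Function.comp_apply, ← hz.1]
    exact (e.left_inv hz.2).symm
  · simp only [Function.comp_apply, ← e1.1]
    exact (e.left_inv hg).symm

lemma contMDiffAt_of_atlas_eq {E H N : Type*} [NormedAddCommGroup E] [NormedSpace ℝ E]
    [TopologicalSpace H] {I : ModelWithCorners ℝ E H} [TopologicalSpace N] [ChartedSpace H N]
    {φ : N → A} {x : N} (hc : ContinuousAt φ x)
    (hs : ContMDiffAt I 𝓘(ℝ, RR (d + q)) ∞ (fun z => s (φ z)) x)
    (ht : ContMDiffAt I 𝓘(ℝ, RR (d + q)) ∞ (fun z => t (φ z)) x) :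
    ContMDiffAt I 𝓘(ℝ, RR (d + d + q)) ∞ φ x :=
  contMDiffWithinAt_of_atlas_eq hA hc.continuousWithinAt hs ht

/-- A smooth map to `{(x, y) | a x = b y}` lifts locally to `A`. -/
lemma IsLocalSection.contMDiffAt_comp {g : A} {a b : X → RR q} {r : X × X → A}
    (h : F.IsLocalSection s t g a b r) {E H N : Type*} [NormedAddCommGroup E] [NormedSpace ℝ E]
    [TopologicalSpace H] {I : ModelWithCorners ℝ E H} [TopologicalSpace N] [ChartedSpace H N]
    {m₁ m₂ : N → X} {x : N} (h₁ : ContMDiffAt I 𝓘(ℝ, RR (d + q)) ∞ m₁ x)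
    (h₂ : ContMDiffAt I 𝓘(ℝ, RR (d + q)) ∞ m₂ x) (e₁ : m₁ x = s g) (e₂ : m₂ x = t g)
    (he : ∀ᶠ z in 𝓝 x, a (m₁ z) = b (m₂ z)) :
    ContMDiffAt I 𝓘(ℝ, RR (d + d + q)) ∞ (fun z => r (m₁ z, m₂ z)) x ∧
      (fun z => s (r (m₁ z, m₂ z))) =ᶠ[𝓝 x] m₁ ∧ (fun z => t (r (m₁ z, m₂ z))) =ᶠ[𝓝 x] m₂ := by
  have hgS : a (s g) = b (t g) := h.left_inv.self_of_nhds.1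
  have hT : Tendsto (fun z => (m₁ z, m₂ z)) (𝓝 x) (𝓝[{p : X × X | a p.1 = b p.2}] (s g, t g)) := by
    refine tendsto_nhdsWithin_iff.mpr ⟨?_, he⟩
    rw [← e₁, ← e₂]
    exact h₁.continuousAt.prodMk_nhds h₂.continuousAt
  have hr := hT.eventually h.right_inv
  have hs' : (fun z => s (r (m₁ z, m₂ z))) =ᶠ[𝓝 x] m₁ := hr.mono fun z hz => hz.1
  have ht' : (fun z => t (r (m₁ z, m₂ z))) =ᶠ[𝓝 x] m₂ := hr.mono fun z hz => hz.2.1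
  refine ⟨contMDiffAt_of_atlas_eq hA ?_ (h₁.congr_of_eventuallyEq hs')
    (h₂.congr_of_eventuallyEq ht'), hs', ht'⟩
  have hc : ContinuousWithinAt r {p : X × X | a p.1 = b p.2} (s g, t g) :=
    (h.right_inv.self_of_nhdsWithin hgS).2.2
  have := hc.tendsto.comp hT
  change Tendsto _ _ (𝓝 (r (m₁ x, m₂ x)))
  rw [e₁, e₂]
  exact this

end Smooth

end Foliation

/-! ### Derivatives with values in the model spaces -/

section Der

variable {E E' E'' : Type*} [NormedAddCommGroup E] [NormedSpace ℝ E] [NormedAddCommGroup E']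
  [NormedSpace ℝ E'] [NormedAddCommGroup E''] [NormedSpace ℝ E'']
  {M M' M'' : Type*} [TopologicalSpace M] [ChartedSpace E M] [TopologicalSpace M']
  [ChartedSpace E' M'] [TopologicalSpace M''] [ChartedSpace E'' M'']

variable (E E') in
/-- The derivative of a map of manifolds without boundary, as a linear map of the model spaces. -/
def der (f : M → M') (x : M) : E →L[ℝ] E' := mfderiv 𝓘(ℝ, E) 𝓘(ℝ, E') f x

lemma der_comp {g : M' → M''} {f : M → M'} {x : M} (hg : ContMDiffAt 𝓘(ℝ, E') 𝓘(ℝ, E'') ∞ g (f x))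
    (hf : ContMDiffAt 𝓘(ℝ, E) 𝓘(ℝ, E') ∞ f x) :
    der E E'' (g ∘ f) x = (der E' E'' g (f x)).comp (der E E' f x) :=
  mfderiv_comp x (hg.mdifferentiableAt (by simp)) (hf.mdifferentiableAt (by simp))

lemma der_comp_apply {g : M' → M''} {f : M → M'} {x : M}
    (hg : ContMDiffAt 𝓘(ℝ, E') 𝓘(ℝ, E'') ∞ g (f x)) (hf : ContMDiffAt 𝓘(ℝ, E) 𝓘(ℝ, E') ∞ f x)
    (v : E) : der E E'' (g ∘ f) x v = der E' E'' g (f x) (der E E' f x v) := by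
  rw [der_comp hg hf, ContinuousLinearMap.comp_apply]

lemma der_congr {f g : M → M'} {x : M} (h : f =ᶠ[𝓝 x] g) : der E E' f x = der E E' g x :=
  h.mfderiv_eq

lemma der_id (x : M) : der E E (id : M → M) x = ContinuousLinearMap.id ℝ E := mfderiv_id

lemma der_const (x : M) (y : M') : der E E' (fun _ : M => y) x = 0 := mfderiv_const

lemma der_eq_fderiv (f : E → E') (x : E) : der E E' f x = fderiv ℝ f x := mfderiv_eq_fderiv

lemma exists_equiv_eq_der {f : M → M'} {x : M}
    (h : IsLocalDiffeomorphAt 𝓘(ℝ, E) 𝓘(ℝ, E') ∞ f x) :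
    ∃ L : E ≃L[ℝ] E', (L : E →L[ℝ] E') = der E E' f x :=
  ⟨h.mfderivToContinuousLinearEquiv (by simp), h.mfderivToContinuousLinearEquiv_coe (by simp)⟩

/-- The chain rule for a map with a local left inverse. -/
lemma der_comp_eq_id {g : M' → M} {f : M → M'} {x : M}
    (hg : ContMDiffAt 𝓘(ℝ, E') 𝓘(ℝ, E) ∞ g (f x)) (hf : ContMDiffAt 𝓘(ℝ, E) 𝓘(ℝ, E') ∞ f x)
    (h : ∀ᶠ z in 𝓝 x, g (f z) = z) (v : E) : der E' E g (f x) (der E E' f x v) = v := by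
  rw [← der_comp_apply hg hf, der_congr (f := g ∘ f) (g := id) (by exact h), der_id]
  rfl

end Der

namespace Foliation

variable {d q : ℕ} {X : Type u} [TopologicalSpace X] [ChartedSpace (RR (d + q)) X]
  {F : Foliation d q X} {A : Type u} [TopologicalSpace A] {s t : A → X}

/-! ### Tangent spaces -/

lemma IsTransverseAt.der_eq_zero_iff {a b : X → RR q} {x : X} (ha : F.IsTransverseAt a x)
    (hb : F.IsTransverseAt b x) (v : RR (d + q)) :
    der (RR (d + q)) (RR q) a x v = 0 ↔
      der (RR (d + q)) (RR q) b x v = 0 := by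
  obtain ⟨k, hk, e⟩ := ha.exists_factor hb
  obtain ⟨L, hL⟩ := exists_equiv_eq_der hk
  rw [der_congr e, der_comp_apply hk.contMDiffAt ha.contMDiffAt, ← hL]
  exact L.map_eq_zero_iff.symm

lemma IsTransverseAt.isTangent_iff {a : X → RR q} {x : X} (ha : F.IsTransverseAt a x)
    (v : RR (d + q)) :
    F.IsTangent x v ↔ der (RR (d + q)) (RR q) a x v = 0 := by
  constructor
  · intro h
    obtain ⟨c, hc, hx⟩ := F.cover x
    exact (ha.der_eq_zero_iff (isTransverseAt_chart hc hx) v).mpr (h c hc hx)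
  · intro h c hc hx
    exact (ha.der_eq_zero_iff (isTransverseAt_chart hc hx) v).mp h

section Smooth

variable [ChartedSpace (RR (d + d + q)) A] (hA : atlas (RR (d + d + q)) A = fibredAtlas d q s t)
include hA

lemma contMDiff_src_of_atlas_eq : ContMDiff 𝓘(ℝ, RR (d + d + q)) 𝓘(ℝ, RR (d + q)) ∞ s :=
  contMDiff_fst.comp (contMDiff_of_atlas_eq hA)

lemma contMDiff_tgt_of_atlas_eq : ContMDiff 𝓘(ℝ, RR (d + d + q)) 𝓘(ℝ, RR (d + q)) ∞ t :=
  contMDiff_snd.comp (contMDiff_of_atlas_eq hA)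

/-- There is a smooth local section `z ↦ r (z, m z)` of `s` through `g`: the point `m z` has the
leaf coordinate of `t g` and the transverse coordinate `a z`. -/
lemma IsLocalSection.surjective_der_src {g : A} {a b : X → RR q} {r : X × X → A}
    (h : F.IsLocalSection s t g a b r) :
    Function.Surjective (der (RR (d + d + q)) (RR (d + q)) s g) := by
  obtain ⟨c, hx, -, hc, hc', -, hb⟩ := h.transverse_tgt.exists_chart univ_mem
  have hab : a (s g) = b (t g) := h.left_inv.self_of_nhds.1
  let m : X → X := fun x => c.symm ((c (t g)).1, a x)
  have hy : ((c (t g)).1, a (s g)) = c (t g) := by rw [hab, ← (hb _ hx).1]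
  have hm0 : m (s g) = t g := by
    simp only [m]; rw [hy]; exact c.left_inv hx
  have hpair : ContMDiffAt 𝓘(ℝ, RR (d + q)) 𝓘(ℝ, RR d × RR q) ∞
      (fun x => ((c (t g)).1, a x)) (s g) :=
    contMDiffAt_const.prodMk_space h.transverse_src.contMDiffAt
  have hmem : ((c (t g)).1, a (s g)) ∈ c.target := by rw [hy]; exact c.map_source hx
  have hm : ContMDiffAt 𝓘(ℝ, RR (d + q)) 𝓘(ℝ, RR (d + q)) ∞ m (s g) :=
    ContMDiffAt.comp (g := c.symm) (s g) (hc'.contMDiffAt (c.open_target.mem_nhds hmem)) hpair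
  have hev : ∀ᶠ z in 𝓝 (s g), a (id z) = b (m z) := by
    filter_upwards [hpair.continuousAt.eventually (c.open_target.mem_nhds hmem)] with z hz
    rw [← (hb _ (c.map_target hz)).1, c.right_inv hz]; rfl
  obtain ⟨h1, h2, -⟩ := h.contMDiffAt_comp hA (m₁ := id) contMDiffAt_id hm rfl hm0 hev
  have hg : r (id (s g), m (s g)) = g := by
    rw [hm0]; exact h.left_inv.self_of_nhds.2
  intro v
  have hds : ContMDiffAt 𝓘(ℝ, RR (d + d + q)) 𝓘(ℝ, RR (d + q)) ∞ s (r (id (s g), m (s g))) :=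
    contMDiff_src_of_atlas_eq hA _
  let ρ : X → A := fun z => r (id z, m z)
  have h5 := der_comp_apply (g := s) (f := ρ) hds h1 v
  rw [show ρ (s g) = g from hg, der_congr (f := s ∘ ρ) (g := id) (by exact h2), der_id] at h5
  exact ⟨_, h5.symm⟩

/-- Differentiate `a ∘ s = b ∘ t`, which holds near `g`. -/
lemma IsLocalSection.isTangent_der_tgt {g : A} {a b : X → RR q} {r : X × X → A}
    (h : F.IsLocalSection s t g a b r) (v : RR (d + d + q))
    (hv : der (RR (d + d + q)) (RR (d + q)) s g v = 0) :
    F.IsTangent (t g) (der (RR (d + d + q)) (RR (d + q)) t g v) := by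
  rw [h.transverse_tgt.isTangent_iff]
  have e : (a ∘ s) =ᶠ[𝓝 g] (b ∘ t) := h.left_inv.mono fun z hz => hz.1
  have h1 := der_comp_apply h.transverse_src.contMDiffAt (contMDiff_src_of_atlas_eq hA g) v
  rw [der_congr e, der_comp_apply h.transverse_tgt.contMDiffAt (contMDiff_tgt_of_atlas_eq hA g),
    hv, map_zero] at h1
  exact h1

/-- Keep the source fixed and move the target in its plaque: `z ↦ r (s g, m z)` lifts the plaque of
`t g` to the source fibre. -/
lemma IsLocalSection.exists_der_tgt_eq {g : A} {a b : X → RR q} {r : X × X → A}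
    (h : F.IsLocalSection s t g a b r) (w : RR (d + q))
    (hw : F.IsTangent (t g) w) : ∃ v : RR (d + d + q),
      der (RR (d + d + q)) (RR (d + q)) s g v = 0 ∧
      der (RR (d + d + q)) (RR (d + q)) t g v = w := by
  obtain ⟨c, hx, -, hc, hc', -, hb⟩ := h.transverse_tgt.exists_chart univ_mem
  have hab : a (s g) = b (t g) := h.left_inv.self_of_nhds.1
  let u₀ : RR d := (c (t g)).1
  let ι : RR d → RR d × RR q := fun u => (u, (c (t g)).2)
  let m : RR d → X := c.symm ∘ ι
  have hι : ι u₀ = c (t g) := rfl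
  have hιs : ContMDiff 𝓘(ℝ, RR d) 𝓘(ℝ, RR d × RR q) ∞ ι :=
    (contDiff_id.prodMk contDiff_const).contMDiff
  have hm0 : m u₀ = t g := c.left_inv hx
  have hcs : ContMDiffAt 𝓘(ℝ, RR d × RR q) 𝓘(ℝ, RR (d + q)) ∞ c.symm (c (t g)) :=
    hc'.contMDiffAt (c.open_target.mem_nhds (c.map_source hx))
  have hm : ContMDiffAt 𝓘(ℝ, RR d) 𝓘(ℝ, RR (d + q)) ∞ m u₀ :=
    ContMDiffAt.comp (g := c.symm) u₀ hcs hιs.contMDiffAt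
  have hev : ∀ᶠ z in 𝓝 u₀, a (s g) = b (m z) := by
    have : ι u₀ ∈ c.target := c.map_source hx
    filter_upwards [hιs.continuous.continuousAt.eventually (c.open_target.mem_nhds this)] with z hz
    change a (s g) = b (c.symm (ι z))
    rw [hab, ← (hb _ (c.map_target hz)).1, c.right_inv hz, ← (hb _ hx).1]
  obtain ⟨h1, h2, h3⟩ := h.contMDiffAt_comp hA (m₁ := fun _ : RR d => s g)
    (contMDiffAt_const (I := 𝓘(ℝ, RR d))) hm rfl hm0 hev
  have hg : r (s g, m u₀) = g := by
    rw [hm0]; exact h.left_inv.self_of_nhds.2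
  -- The leaf component of `w` in the chart; the transverse component vanishes because `w` is
  -- tangent to the leaf.
  let e : RR d := (der (RR (d + q)) (RR d × RR q) c (t g) w).1
  have hcd : ContMDiffAt 𝓘(ℝ, RR (d + q)) 𝓘(ℝ, RR d × RR q) ∞ c (t g) :=
    hc.contMDiffAt (c.open_source.mem_nhds hx)
  have hw0 : (der (RR (d + q)) (RR d × RR q) c (t g) w).2 = 0 := by
    have h4 : b =ᶠ[𝓝 (t g)] (Prod.snd : RR d × RR q → RR q) ∘ c := by
      filter_upwards [c.open_source.mem_nhds hx] with z hz using (hb z hz).1.symm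
    have h5 := (h.transverse_tgt.isTangent_iff w).mp hw
    rwa [der_congr h4, der_comp_apply contDiff_snd.contMDiff.contMDiffAt hcd, der_eq_fderiv,
      fderiv_snd] at h5
  have hdm : der (RR d) (RR (d + q)) m u₀ e = w := by
    have h7 : der (RR d) (RR d × RR q) ι u₀ e = der (RR (d + q)) (RR d × RR q) c (t g) w := by
      have h8 : HasFDerivAt ι ((ContinuousLinearMap.id ℝ (RR d)).prod 0) u₀ :=
        (hasFDerivAt_id u₀).prodMk (hasFDerivAt_const _ _)
      rw [der_eq_fderiv, h8.fderiv]
      exact Prod.ext rfl hw0.symm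
    have h10 : ∀ᶠ z in 𝓝 (t g), c.symm (c z) = z := by
      filter_upwards [c.open_source.mem_nhds hx] with z hz using c.left_inv hz
    have h11 := der_comp_apply (g := c.symm) (f := ι) (x := u₀) hcs hιs.contMDiffAt e
    rw [h7] at h11
    exact h11.trans (der_comp_eq_id hcs hcd h10 w)
  let ρ : RR d → A := fun z => r (s g, m z)
  have hρ : ρ u₀ = g := hg
  have hd1 := der_comp_apply (g := s) (f := ρ) (contMDiff_src_of_atlas_eq hA _) h1 e
  have hd2 := der_comp_apply (g := t) (f := ρ) (contMDiff_tgt_of_atlas_eq hA _) h1 e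
  rw [hρ, der_congr (f := s ∘ ρ) (g := fun _ => s g) (by exact h2), der_const] at hd1
  rw [hρ, der_congr (f := t ∘ ρ) (g := m) (by exact h3), hdm] at hd2
  exact ⟨_, hd1.symm, hd2.symm⟩

end Smooth

/-- The description of the arrows is symmetric, so that what is proved for the source holds for the
target. -/
lemma IsLocalSection.swap {g : A} {a b : X → RR q} {r : X × X → A}
    (h : F.IsLocalSection s t g a b r) :
    F.IsLocalSection t s g b a (r ∘ Prod.swap) where
  transverse_src := h.transverse_tgt
  transverse_tgt := h.transverse_src
  left_inv := h.left_inv.mono fun _ hz => ⟨hz.1.symm, hz.2⟩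
  right_inv := by
    have hsw : Tendsto (Prod.swap : X × X → X × X)
        (𝓝[{p : X × X | b p.1 = a p.2}] (t g, s g)) (𝓝[{p : X × X | a p.1 = b p.2}] (s g, t g)) :=
      continuous_swap.continuousWithinAt.tendsto_nhdsWithin fun p hp => hp.symm
    filter_upwards [hsw.eventually h.right_inv] with p hp
    refine ⟨hp.2.1, hp.1, ?_⟩
    exact ContinuousWithinAt.comp (g := r) (f := Prod.swap) hp.2.2
      continuous_swap.continuousWithinAt fun p hp => hp.symm

lemma fibredAtlas_swap : fibredAtlas d q t s = fibredAtlas d q s t := by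
  have aux : ∀ s t : A → X, fibredAtlas d q s t ⊆ fibredAtlas d q t s := by
    rintro s t e ⟨h, h'⟩
    refine ⟨(contMDiff_snd.comp_contMDiffOn h).prodMk (contMDiff_fst.comp_contMDiffOn h), ?_⟩
    intro g hg
    obtain ⟨Ψ, hΨ, e⟩ := h' g hg
    exact ⟨Ψ ∘ Prod.swap, ContMDiffAt.comp (g := Ψ) (f := Prod.swap) (t g, s g) hΨ
      (contMDiff_snd.prodMk contMDiff_fst).contMDiffAt, e⟩
  exact (aux t s).antisymm (aux s t)

/-! ### Lie groupoids from locally fibred groupoids, and their orbits -/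

open Classical in
/-- A topological groupoid over a foliated manifold whose arrows are locally the fibre products of
transverse coordinates is a Lie groupoid. -/
lemma LocallyFibred.isLie [T2Space X] [SecondCountableTopology X]
    [IsManifold 𝓘(ℝ, RR (d + q)) ∞ X] {G : Gpd X A} (h : F.LocallyFibred G.src G.tgt)
    [ChartedSpace (RR (d + d + q)) A]
    (hA : atlas (RR (d + d + q)) A = fibredAtlas d q G.src G.tgt)
    (hs : ∀ x, T2Space (G.src ⁻¹' {x})) (ht : ∀ x, T2Space (G.tgt ⁻¹' {x}))
    (h_one : Continuous G.one) (h_inv : Continuous G.inv)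
    (h_mul : ContinuousOn (fun r : A × A => if w : G.src r.1 = G.tgt r.2 then G.mul r.1 r.2 w
      else r.1) {r | G.src r.1 = G.tgt r.2}) : G.IsLie (d + q) (d + d + q) := by
  have hA' : atlas (RR (d + d + q)) A = fibredAtlas d q G.tgt G.src := by
    rw [hA, fibredAtlas_swap]
  have := isManifold_of_atlas_eq hA
  have hsm := contMDiff_src_of_atlas_eq hA
  have htm := contMDiff_tgt_of_atlas_eq hA
  refine ⟨‹_›, ‹_›, ‹_›, ‹_›, hsm, htm, ?_, ?_, hs, ht, ?_, ?_, ?_⟩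
  · intro g
    obtain ⟨a, b, r, hr⟩ := h.exists_section g
    exact hr.surjective_der_src hA
  · intro g
    obtain ⟨a, b, r, hr⟩ := h.exists_section g
    exact hr.swap.surjective_der_src hA'
  · intro x
    refine contMDiffAt_of_atlas_eq hA h_one.continuousAt ?_ ?_
    · simp only [G.src_one]; exact contMDiffAt_id
    · simp only [G.tgt_one]; exact contMDiffAt_id
  · intro g
    refine contMDiffAt_of_atlas_eq hA h_inv.continuousAt ?_ ?_
    · simpa only [G.src_inv] using htm g
    · simpa only [G.tgt_inv] using hsm g
  · intro r hr
    refine contMDiffWithinAt_of_atlas_eq hA (h_mul r hr) ?_ ?_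
    · refine ((hsm.comp contMDiff_snd).contMDiffAt.contMDiffWithinAt (s := _)
        (x := r)).congr_of_mem ?_ hr
      intro r' hr'
      rw [dif_pos (show G.src r'.1 = G.tgt r'.2 from hr'), G.src_mul]; rfl
    · refine ((htm.comp contMDiff_fst).contMDiffAt.contMDiffWithinAt (s := _)
        (x := r)).congr_of_mem ?_ hr
      intro r' hr'
      rw [dif_pos (show G.src r'.1 = G.tgt r'.2 from hr'), G.tgt_mul]; rfl

lemma LocallyFibred.mem_orbitTangent {G : Gpd X A} (h : F.LocallyFibred G.src G.tgt)
    [ChartedSpace (RR (d + d + q)) A]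
    (hA : atlas (RR (d + d + q)) A = fibredAtlas d q G.src G.tgt) {x : X} {w : RR (d + q)} :
    w ∈ G.orbitTangent (d + q) (d + d + q) x ↔ F.IsTangent x w := by
  obtain ⟨a, b, r, hr⟩ := h.exists_section (G.one x)
  have key : F.IsTangent (G.tgt (G.one x)) w ↔ F.IsTangent x w := by rw [G.tgt_one]
  rw [← key]
  constructor
  · rintro ⟨v, hv, rfl⟩
    exact hr.isTangent_der_tgt hA v hv
  · intro hw
    obtain ⟨v, hv, hv'⟩ := hr.exists_der_tgt_eq hA w hw
    exact ⟨v, hv, hv'⟩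

lemma isLie_holonomyGroupoid [T2Space X] [SecondCountableTopology X]
    [IsManifold 𝓘(ℝ, RR (d + q)) ∞ X] [ChartedSpace (RR (d + d + q)) F.HolArr]
    (hA : atlas (RR (d + d + q)) F.HolArr = F.holonomyAtlas) :
    F.holonomyGroupoid.IsLie (d + q) (d + d + q) :=
  F.locallyFibred_holonomyGroupoid.isLie hA F.t2Space_holonomyGroupoid_src_fiber
    F.t2Space_holonomyGroupoid_tgt_fiber F.continuous_holonomyGroupoid_one
    F.continuous_holonomyGroupoid_inv F.continuousOn_holonomyGroupoid_mul

end Foliation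

/-! ### Local diffeomorphisms -/

section LocalDiffeo

/-- The inverse function theorem, for smooth maps near a point. -/
lemma isLocalDiffeomorphAt_of_surjective {q : ℕ} {h : RR q → RR q} {w : RR q}
    (hh : ∀ᶠ z in 𝓝 w, ContDiffAt ℝ ∞ h z) (hs : Function.Surjective (fderiv ℝ h w)) :
    IsLocalDiffeomorphAt 𝓘(ℝ, RR q) 𝓘(ℝ, RR q) ∞ h w := by
  have hw := hh.self_of_nhds
  have hinj : Function.Injective (fderiv ℝ h w) :=
    (LinearMap.injective_iff_surjective (f := (fderiv ℝ h w).toLinearMap)).mpr hs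
  let L : RR q ≃L[ℝ] RR q := (LinearEquiv.ofBijective (fderiv ℝ h w).toLinearMap
    ⟨hinj, hs⟩).toContinuousLinearEquiv
  have hL : (L : RR q →L[ℝ] RR q) = fderiv ℝ h w := by ext v; rfl
  have hd : HasFDerivAt h (L : RR q →L[ℝ] RR q) w := by
    rw [hL]; exact (hw.differentiableAt (by simp)).hasFDerivAt
  let Φ := hw.toOpenPartialHomeomorph h hd (by simp)
  have hΦw : w ∈ Φ.source := hw.mem_toOpenPartialHomeomorph_source hd (by simp)
  -- The inverse has to be smooth on a whole neighbourhood, so the derivative must be invertible at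
  -- nearby points as well; invertible operators form an open set.
  have hinv : ∀ᶠ z in 𝓝 w, ∃ L' : RR q ≃L[ℝ] RR q, (L' : RR q →L[ℝ] RR q) = fderiv ℝ h z := by
    have hc : ContinuousAt (fderiv ℝ h) w := (hw.fderiv_right (m := 0) (by simp)).continuousAt
    exact hc.eventually (by
      have := ContinuousLinearEquiv.nhds (𝕜 := ℝ) L
      rw [hL] at this
      exact this)
  obtain ⟨U, hU, hUo, hwU⟩ := eventually_nhds_iff.mp (hh.and hinv)
  let Ψ := Φ.restrOpen U hUo
  refine ⟨⟨Ψ.toPartialEquiv, Ψ.open_source, Ψ.open_target, ?_, ?_⟩, ⟨hΦw, hwU⟩, ?_⟩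
  · exact contMDiffOn_iff_contDiffOn.mpr fun z hz => (hU z hz.2).1.contDiffWithinAt
  · refine contMDiffOn_iff_contDiffOn.mpr fun z hz => ContDiffAt.contDiffWithinAt ?_
    have hz' : Ψ.symm z ∈ U := (Ψ.map_target hz).2
    obtain ⟨L', hL'⟩ := (hU _ hz').2
    refine Ψ.contDiffAt_symm hz (f₀' := L') ?_ (hU _ hz').1
    rw [hL']
    exact ((hU _ hz').1.differentiableAt (by simp)).hasFDerivAt
  · intro z _; rfl

lemma isLocalDiffeomorphAt_chart {E M : Type*} [NormedAddCommGroup E] [NormedSpace ℝ E]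
    [TopologicalSpace M] [ChartedSpace E M] [IsManifold 𝓘(ℝ, E) ∞ M] {e : OpenPartialHomeomorph M E}
    (he : e ∈ atlas E M) {x : M} (hx : x ∈ e.source) :
    IsLocalDiffeomorphAt 𝓘(ℝ, E) 𝓘(ℝ, E) ∞ e x :=
  have he' := IsManifold.subset_maximalAtlas (I := 𝓘(ℝ, E)) (n := ∞) he
  ⟨⟨e.toPartialEquiv, e.open_source, e.open_target, contMDiffOn_of_mem_maximalAtlas he',
    contMDiffOn_symm_of_mem_maximalAtlas he'⟩, hx, fun _ _ => rfl⟩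

end LocalDiffeo

/-! ### Action groupoids -/

section Action

variable {Γ M : Type u} [TopologicalSpace M] {q : ℕ} [ChartedSpace (RR q) M]

/-- The arrow of `Γ ⋉ M` given by `γ` and `m`. -/
def ActionArr.mk (γ : Γ) (m : M) : ActionArr Γ M := (γ, m)

lemma continuous_actionArr_snd : Continuous fun z : ActionArr Γ M => z.2 :=
  letI : TopologicalSpace Γ := ⊥
  continuous_snd

/-- The sheets `{γ} × M` are open. Near an arrow the group element can therefore be frozen, and
smoothness questions on `Γ ⋉ M` become questions about a fixed `γ` on `M`. -/
lemma actionArr_eventually_fst_eq (z : ActionArr Γ M) : ∀ᶠ z' in 𝓝 z, z'.1 = z.1 := by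
  let : TopologicalSpace Γ := ⊥
  have : DiscreteTopology Γ := ⟨rfl⟩
  have h : Continuous fun z : ActionArr Γ M => z.1 := continuous_fst
  exact h.continuousAt.eventually ((isOpen_discrete {z.1}).mem_nhds rfl)

instance [T2Space M] : T2Space (ActionArr Γ M) :=
  letI : TopologicalSpace Γ := ⊥
  haveI : DiscreteTopology Γ := ⟨rfl⟩
  inferInstanceAs (T2Space (Γ × M))

variable [IsManifold 𝓘(ℝ, RR q) ∞ M]

instance : IsManifold 𝓘(ℝ, RR q) ∞ (ActionArr Γ M) := by
  refine isManifold_of_contDiffOn _ _ _ ?_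
  rintro _ _ ⟨γ, e, he, rfl⟩ ⟨γ', e', he', rfl⟩
  simp only [modelWithCornersSelf_coe, modelWithCornersSelf_coe_symm, Function.id_comp,
    Function.comp_id, preimage_id, range_id, inter_univ]
  rw [← contMDiffOn_iff_contDiffOn]
  have he₁ := IsManifold.subset_maximalAtlas (I := 𝓘(ℝ, RR q)) (n := ∞) he
  have he₂ := IsManifold.subset_maximalAtlas (I := 𝓘(ℝ, RR q)) (n := ∞) he'
  have h : ContMDiffOn 𝓘(ℝ, RR q) 𝓘(ℝ, RR q) ∞ (e' ∘ e.symm) (e.target ∩ e.symm ⁻¹' e'.source) :=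
    (contMDiffOn_of_mem_maximalAtlas he₂).comp ((contMDiffOn_symm_of_mem_maximalAtlas he₁).mono
      inter_subset_left) inter_subset_right
  refine h.mono ?_
  intro z hz
  exact ⟨hz.1, hz.2.2⟩

lemma contMDiff_actionArr_snd :
    ContMDiff 𝓘(ℝ, RR q) 𝓘(ℝ, RR q) ∞ fun z : ActionArr Γ M => z.2 := by
  intro z
  have hz := mem_chart_source (RR q) z
  have hm := mem_chart_source (RR q) z.2
  have h1 := (contMDiffOn_chart (I := 𝓘(ℝ, RR q)) (n := ∞) (x := z)).contMDiffAt
    ((chartAt (RR q) z).open_source.mem_nhds hz)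
  have h2 := (contMDiffOn_chart_symm (I := 𝓘(ℝ, RR q)) (n := ∞) (x := z.2)).contMDiffAt
    ((chartAt (RR q) z.2).open_target.mem_nhds ((chartAt (RR q) z.2).map_source hm))
  refine (ContMDiffAt.comp (g := (chartAt (RR q) z.2).symm) (f := chartAt (RR q) z) z h2
    h1).congr_of_eventuallyEq ?_
  filter_upwards [continuous_actionArr_snd.continuousAt.eventually
    ((chartAt (RR q) z.2).open_source.mem_nhds hm)] with z' hz'
  exact ((chartAt (RR q) z.2).left_inv hz').symm

lemma contMDiff_actionArr_mk (γ : Γ) :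
    ContMDiff 𝓘(ℝ, RR q) 𝓘(ℝ, RR q) ∞ fun m : M => ActionArr.mk γ m := by
  intro m
  let z : ActionArr Γ M := .mk γ m
  have hz := mem_chart_source (RR q) z
  have hm := mem_chart_source (RR q) m
  have h1 := (contMDiffOn_chart (I := 𝓘(ℝ, RR q)) (n := ∞) (x := m)).contMDiffAt
    ((chartAt (RR q) m).open_source.mem_nhds hm)
  have h2 := (contMDiffOn_chart_symm (I := 𝓘(ℝ, RR q)) (n := ∞) (x := z)).contMDiffAt
    ((chartAt (RR q) z).open_target.mem_nhds ((chartAt (RR q) z).map_source hz))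
  refine (ContMDiffAt.comp (g := (chartAt (RR q) z).symm) (f := chartAt (RR q) m) m h2
    h1).congr_of_eventuallyEq ?_
  filter_upwards [(chartAt (RR q) m).open_source.mem_nhds hm] with m' hm'
  exact Prod.ext rfl ((chartAt (RR q) m).left_inv hm').symm

/-- A map with a smooth local section has surjective derivative. -/
lemma surjective_der_of_section {E E' M M' : Type*} [NormedAddCommGroup E] [NormedSpace ℝ E]
    [NormedAddCommGroup E'] [NormedSpace ℝ E'] [TopologicalSpace M] [ChartedSpace E M]
    [TopologicalSpace M'] [ChartedSpace E' M'] {f : M → M'} {φ : M' → M} {x : M} {y : M'}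
    (hf : ContMDiffAt 𝓘(ℝ, E) 𝓘(ℝ, E') ∞ f x) (hφ : ContMDiffAt 𝓘(ℝ, E') 𝓘(ℝ, E) ∞ φ y)
    (e : φ y = x) (h : ∀ᶠ z in 𝓝 y, f (φ z) = z) : Function.Surjective (der E E' f x) := by
  subst e
  exact fun v => ⟨_, der_comp_eq_id hf hφ h v⟩

variable [Group Γ] [MulAction Γ M]

omit [ChartedSpace (RR q) M] [IsManifold 𝓘(ℝ, RR q) ∞ M] in
lemma mem_isotropy_actionGroupoid_eventually {m : M} {z : ActionArr Γ M}
    (hz : z ∈ (actionGroupoid Γ M).isotropy m) :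
    ∀ᶠ z' in 𝓝[(actionGroupoid Γ M).isotropy m] z, z' = z := by
  filter_upwards [nhdsWithin_le_nhds (actionArr_eventually_fst_eq z), self_mem_nhdsWithin]
    with z' h1 h2
  exact Prod.ext h1 (h2.1.trans hz.1.symm)

lemma isLie_actionGroupoid [T2Space M] [SecondCountableTopology M]
    (h : ∀ γ : Γ, ContMDiff 𝓘(ℝ, RR q) 𝓘(ℝ, RR q) ∞ fun m : M => γ • m) :
    (actionGroupoid Γ M).IsLie q q := by
  have htm : ContMDiff 𝓘(ℝ, RR q) 𝓘(ℝ, RR q) ∞ (actionGroupoid Γ M).tgt := by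
    intro z
    refine (((h z.1).comp contMDiff_actionArr_snd) z).congr_of_eventuallyEq ?_
    filter_upwards [actionArr_eventually_fst_eq z] with z' hz'
    change z'.1 • z'.2 = z.1 • z'.2
    rw [hz']
  refine ⟨‹_›, ‹_›, ‹_›, inferInstance, contMDiff_actionArr_snd, htm, ?_, ?_,
    fun _ => inferInstance, fun _ => inferInstance, contMDiff_actionArr_mk 1, ?_, ?_⟩
  · intro z
    exact surjective_der_of_section (E := RR q) (E' := RR q) (φ := fun m => ActionArr.mk z.1 m)
      (contMDiff_actionArr_snd z) (contMDiff_actionArr_mk z.1 z.2) rfl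
      (Eventually.of_forall fun _ => rfl)
  · intro z
    refine surjective_der_of_section (E := RR q) (E' := RR q) (y := z.1 • z.2) (htm z)
      (((contMDiff_actionArr_mk z.1).comp (h z.1⁻¹)) _) ?_ (Eventually.of_forall fun m => ?_)
    · exact Prod.ext rfl (inv_smul_smul z.1 z.2)
    · exact smul_inv_smul z.1 m
  · intro z
    refine (((contMDiff_actionArr_mk z.1⁻¹).comp htm) z).congr_of_eventuallyEq ?_
    filter_upwards [actionArr_eventually_fst_eq z] with z' hz'
    exact Prod.ext (congrArg (·⁻¹) hz') rfl
  · rintro ⟨z, z'⟩ hz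
    refine ((((contMDiff_actionArr_mk (z.1 * z'.1)).comp contMDiff_actionArr_snd).comp
      contMDiff_snd).contMDiffAt.contMDiffWithinAt (x := (z, z'))).congr_of_eventuallyEq_of_mem
      ?_ hz
    have h1 : ∀ᶠ r : ActionArr Γ M × ActionArr Γ M in 𝓝 (z, z'), r.1.1 = z.1 ∧ r.2.1 = z'.1 := by
      rw [nhds_prod_eq]
      exact (actionArr_eventually_fst_eq z).prod_mk (actionArr_eventually_fst_eq z')
    filter_upwards [self_mem_nhdsWithin, nhdsWithin_le_nhds h1] with r hr hr'
    rw [dif_pos (show (actionGroupoid Γ M).src r.1 = (actionGroupoid Γ M).tgt r.2 from hr)]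
    exact Prod.ext (by rw [← hr'.1, ← hr'.2]; rfl) rfl

/-- The groupoid is étale: near a unit, `m ↦ (1, m)` is inverse to the source map, so the derivative
of the source has zero kernel there. -/
lemma orbitTangent_actionGroupoid (m : M) :
    (actionGroupoid Γ M).orbitTangent q q m = ⊥ := by
  refine (Submodule.eq_bot_iff _).mpr ?_
  rintro _ ⟨v, hv, rfl⟩
  have hv : der (RR q) (RR q) (fun z : ActionArr Γ M => z.2) (.mk 1 m) v = 0 := hv
  have h := der_comp_eq_id (E := RR q) (E' := RR q) (f := fun z : ActionArr Γ M => z.2)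
    (g := fun m : M => (ActionArr.mk 1 m : ActionArr Γ M)) (x := ActionArr.mk 1 m)
    (contMDiff_actionArr_mk 1 m)
    (contMDiff_actionArr_snd _) (by
      filter_upwards [actionArr_eventually_fst_eq (ActionArr.mk (1 : Γ) m)] with z hz
      exact Prod.ext hz.symm rfl) v
  have h0 : v = 0 := by rw [hv, map_zero] at h; exact h.symm
  rw [h0]
  exact map_zero _

end Action

/-! ### Developing maps -/

section Developable

variable {d q : ℕ} {X X' M : Type u}
  [TopologicalSpace X] [ChartedSpace (RR (d + q)) X]
  [TopologicalSpace X'] [ChartedSpace (RR (d + q)) X']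
  [TopologicalSpace M] [ChartedSpace (RR q) M]
  {F : Foliation d q X} {p : X' → X} {hp : IsSmoothCover (d + q) p} {f : X' → M}

lemma IsDevelopingMap.map_eq_of_isLeafwise (hf : IsDevelopingMap F p hp f) {x y : X'}
    {γ : Path x y} (hγ : (F.comap p hp.isLocalDiffeomorph).IsLeafwise γ) : f y = f x := by
  have : y ∈ f ⁻¹' {f x} := by
    rw [hf.fiber_eq_leaf]; exact ⟨⟨γ, hγ⟩⟩
  exact this

/-- Since `f` is constant on leaves, it factors near `z` as `(f ∘ ι) ∘ a`, where `a` is a foliated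
transverse coordinate and `ι` a transversal through `z`. As `f` is a submersion, `κ ∘ f ∘ ι` has
surjective derivative; it maps between spaces of equal dimension, so the inverse function theorem
makes it a local diffeomorphism. -/
lemma IsDevelopingMap.isTransverseAt (hf : IsDevelopingMap F p hp f) {z : X'} {κ : M → RR q}
    (hκ : IsLocalDiffeomorphAt 𝓘(ℝ, RR q) 𝓘(ℝ, RR q) ∞ κ (f z)) :
    (F.comap p hp.isLocalDiffeomorph).IsTransverseAt (κ ∘ f) z := by
  obtain ⟨c₀, hc₀, hz₀⟩ := (F.comap p hp.isLocalDiffeomorph).cover z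
  let a : X' → RR q := fun z => (c₀ z).2
  have ha : (F.comap p hp.isLocalDiffeomorph).IsTransverseAt a z :=
    Foliation.isTransverseAt_chart hc₀ hz₀
  obtain ⟨c, hz, -, -, hc', -, hca⟩ := ha.exists_chart univ_mem
  let ι : RR q → X' := fun w => c.symm ((c z).1, w)
  have hι₀ : ι (a z) = z := by
    simp only [ι]; rw [← (hca z hz).1]; exact c.left_inv hz
  have hmem : ∀ᶠ w in 𝓝 (a z), ((c z).1, w) ∈ c.target := by
    have h0 : ((c z).1, a z) ∈ c.target := by rw [← (hca z hz).1]; exact c.map_source hz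
    exact (Continuous.prodMk_right (c z).1).continuousAt.eventually (c.open_target.mem_nhds h0)
  have hιs : ∀ᶠ w in 𝓝 (a z), ContMDiffAt 𝓘(ℝ, RR q) 𝓘(ℝ, RR (d + q)) ∞ ι w := by
    filter_upwards [hmem] with w hw
    exact ContMDiffAt.comp (g := c.symm) w (hc'.contMDiffAt (c.open_target.mem_nhds hw))
      (contDiff_const.prodMk contDiff_id).contMDiff.contMDiffAt
  -- The points `x` and `ι (a x)` are both near `z` and have the same value of `a`, so a leafwise
  -- path joins them.
  have hfac : ∀ᶠ x in 𝓝 z, f x = f (ι (a x)) := by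
    have hT : Tendsto (fun x => (x, ι (a x))) (𝓝 z) (𝓝 (z, z)) := by
      refine tendsto_id.prodMk_nhds ?_
      have h2 : ContinuousAt (ι ∘ a) z := hιs.self_of_nhds.continuousAt.comp ha.continuousAt
      unfold ContinuousAt at h2
      rwa [Function.comp_apply, hι₀] at h2
    filter_upwards [hT.eventually ha.eventually_exists_path, ha.continuousAt.eventually hmem]
      with x hx hx'
    obtain ⟨γ, hγ, -⟩ := hx (by
      simp only [ι]
      rw [← (hca _ (c.map_target hx')).1, c.right_inv hx'])
    exact (hf.map_eq_of_isLeafwise hγ).symm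
  have hκs : ∀ᶠ w in 𝓝 (a z), ContDiffAt ℝ ∞ (κ ∘ f ∘ ι) w := by
    have h3 : Tendsto (f ∘ ι) (𝓝 (a z)) (𝓝 (f z)) := by
      have h4 : ContinuousAt (f ∘ ι) (a z) :=
        ContinuousAt.comp hf.smooth.continuous.continuousAt hιs.self_of_nhds.continuousAt
      unfold ContinuousAt at h4
      rwa [Function.comp_apply, hι₀] at h4
    filter_upwards [hιs, h3.eventually hκ.eventually_isLocalDiffeomorphAt] with w h1 h2
    rw [← contMDiffAt_iff_contDiffAt]
    exact ContMDiffAt.comp (g := κ) w h2.contMDiffAt (hf.smooth.contMDiffAt.comp w h1)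
  -- The witness is the original chart `c₀`: the straightened chart `c` is smooth but need not
  -- belong to the foliated atlas.
  refine ⟨c₀, hc₀, hz₀, κ ∘ f ∘ ι, isLocalDiffeomorphAt_of_surjective hκs ?_, ?_⟩
  · intro v
    obtain ⟨L, hL⟩ := exists_equiv_eq_der hκ
    obtain ⟨w, hw⟩ : ∃ w, der (RR (d + q)) (RR q) f z w = L.symm v :=
      hf.submersion z (L.symm v)
    refine ⟨der (RR (d + q)) (RR q) a z w, ?_⟩
    have e1 : κ ∘ f =ᶠ[𝓝 z] (κ ∘ f ∘ ι) ∘ a := hfac.mono fun x hx => congrArg κ hx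
    have h1 := der_comp_apply (g := κ) (f := f) hκ.contMDiffAt hf.smooth.contMDiffAt w
    rw [der_congr e1, der_comp_apply (contMDiffAt_iff_contDiffAt.mpr hκs.self_of_nhds)
      ha.contMDiffAt, der_eq_fderiv, hw, ← hL] at h1
    exact h1.trans (L.apply_symm_apply v)
  · exact hfac.mono fun x hx => congrArg κ hx

section Manifold

variable [IsManifold 𝓘(ℝ, RR q) ∞ M]

lemma isLocalDiffeomorphAt_chartAt (m : M) :
    IsLocalDiffeomorphAt 𝓘(ℝ, RR q) 𝓘(ℝ, RR q) ∞ (chartAt (RR q) m) m :=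
  isLocalDiffeomorphAt_chart (chart_mem_atlas (RR q) m) (mem_chart_source (RR q) m)

/-- In a chart whose second component is `κ ∘ f`, freeze the leaf coordinate at that of `z`. The
chart is taken inside the preimage of the domain of `κ`, so that equality of `κ`-values gives
equality in `M`. -/
lemma IsDevelopingMap.exists_section (hf : IsDevelopingMap F p hp f) (z : X') :
    ∃ S : M → X', S (f z) = z ∧ (∀ᶠ m in 𝓝 (f z), f (S m) = m) ∧
      ∀ᶠ m in 𝓝 (f z), ContMDiffAt 𝓘(ℝ, RR q) 𝓘(ℝ, RR (d + q)) ∞ S m := by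
  let κ := chartAt (RR q) (f z)
  have hκ : IsLocalDiffeomorphAt 𝓘(ℝ, RR q) 𝓘(ℝ, RR q) ∞ κ (f z) := isLocalDiffeomorphAt_chartAt _
  have hfz : f z ∈ κ.source := mem_chart_source (RR q) (f z)
  obtain ⟨c, hz, hcW, -, hc', -, hca⟩ := (hf.isTransverseAt hκ).exists_chart
    (hf.smooth.continuous.continuousAt (κ.open_source.mem_nhds hfz))
  have h0 : ((c z).1, κ (f z)) = c z := Prod.ext rfl (hca z hz).1.symm
  have hsm : ∀ᶠ m in 𝓝 (f z), ContMDiffAt 𝓘(ℝ, RR q) 𝓘(ℝ, RR d × RR q) ∞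
      (fun m => ((c z).1, κ m)) m := by
    filter_upwards [hκ.eventually_isLocalDiffeomorphAt] with m hm
    exact contMDiffAt_const.prodMk_space hm.contMDiffAt
  have hmem : ∀ᶠ m in 𝓝 (f z), ((c z).1, κ m) ∈ c.target := by
    refine hsm.self_of_nhds.continuousAt.eventually (c.open_target.mem_nhds ?_)
    change ((c z).1, κ (f z)) ∈ c.target
    rw [h0]; exact c.map_source hz
  refine ⟨fun m => c.symm ((c z).1, κ m), ?_, ?_, ?_⟩
  · change c.symm ((c z).1, κ (f z)) = z
    rw [h0, c.left_inv hz]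
  · filter_upwards [hmem, κ.open_source.mem_nhds hfz] with m h1 h2
    refine κ.injOn (hcW (c.map_target h1)) h2 ?_
    have := (hca _ (c.map_target h1)).1
    rw [c.right_inv h1] at this
    exact this.symm
  · filter_upwards [hmem, hsm] with m h1 h2
    exact ContMDiffAt.comp (g := c.symm) m (hc'.contMDiffAt (c.open_target.mem_nhds h1)) h2

lemma IsDevelopingMap.isOpenMap (hf : IsDevelopingMap F p hp f) : IsOpenMap f := by
  refine IsOpenMap.of_nhds_le fun z U hU => ?_
  obtain ⟨S, hS0, hS, hSs⟩ := hf.exists_section z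
  have hSc := hSs.self_of_nhds.continuousAt
  unfold ContinuousAt at hSc
  rw [hS0] at hSc
  filter_upwards [hS, hSc.eventually hU] with m h1 h2
  rw [← h1]; exact h2

include hp in
omit [ChartedSpace (RR q) M] [TopologicalSpace M] [IsManifold 𝓘(ℝ, RR q) ∞ M] in
-- Deck transformations are defined as homeomorphisms. Since `p ∘ γ = p`, near `z` they are the
-- local inverse of `p` at `γ z` composed with `p`, which is smooth.
lemma contMDiff_deckGroup {γ : X' ≃ₜ X'} (hγ : γ ∈ deckGroup p) :
    ContMDiff 𝓘(ℝ, RR (d + q)) 𝓘(ℝ, RR (d + q)) ∞ γ := by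
  intro z
  have hl := hp.isLocalDiffeomorph (γ z)
  have h1 : ContMDiffAt 𝓘(ℝ, RR (d + q)) 𝓘(ℝ, RR (d + q)) ∞ hl.localInverse (p z) := by
    rw [← show p (γ z) = p z from hγ z]; exact hl.localInverse_contMDiffAt
  refine (ContMDiffAt.comp (g := hl.localInverse) z h1
    (hp.isLocalDiffeomorph z).contMDiffAt).congr_of_eventuallyEq ?_
  filter_upwards [γ.continuous.continuousAt.eventually hl.localInverse_eventuallyEq_left] with w hw
  rw [Function.comp_apply, ← show p (γ w) = p w from hγ w]
  exact hw.symm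

/-- With `S` a local section of `f`, the action of the class of `γ` is locally `m ↦ f (γ (S m))`. -/
lemma contMDiff_effDeckGroup_smul (hf : IsDevelopingMap F p hp f) (g : EffDeckGroup hf) :
    ContMDiff 𝓘(ℝ, RR q) 𝓘(ℝ, RR q) ∞ fun m : M => g • m := by
  obtain ⟨γ, rfl⟩ := QuotientGroup.mk_surjective g
  intro m
  obtain ⟨z, rfl⟩ := hf.surjective m
  obtain ⟨S, hS0, hS, hSs⟩ := hf.exists_section z
  refine ((hf.smooth.comp (contMDiff_deckGroup (hp := hp) γ.2)).contMDiffAt.comp (f z)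
    hSs.self_of_nhds).congr_of_eventuallyEq ?_
  filter_upwards [hS] with m hm
  conv_lhs => rw [← hm]
  exact effDeckGroup_smul hf γ (S m)

end Manifold

end Developable

/-! ### Isometries are determined by their value and derivative at one point -/

section Isometry

set_option maxSynthPendingDepth 3

variable {E : Type*} [NormedAddCommGroup E] [NormedSpace ℝ E]

lemma exists_forall_mul_sq_le [FiniteDimensional ℝ E] (B : E →L[ℝ] E →L[ℝ] ℝ)
    (hB : ∀ v, v ≠ 0 → 0 < B v v) : ∃ c > 0, ∀ v, c * ‖v‖ ^ 2 ≤ B v v := by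
  rcases subsingleton_or_nontrivial E with hE | hE
  · exact ⟨1, one_pos, fun v => by simp [Subsingleton.elim v 0]⟩
  have hc : Continuous fun v : E => B v v := B.continuous.clm_apply continuous_id
  obtain ⟨u, hu, hmin⟩ := (isCompact_sphere (0 : E) 1).exists_isMinOn
    (NormedSpace.sphere_nonempty.mpr zero_le_one) hc.continuousOn
  have hu1 : ‖u‖ = 1 := by simpa using hu
  refine ⟨B u u, hB u (by rintro rfl; simp at hu1), fun v => ?_⟩
  rcases eq_or_ne v 0 with rfl | hv
  · simp
  have hv' : ‖v‖ ≠ 0 := norm_ne_zero_iff.mpr hv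
  have h : B u u ≤ B (‖v‖⁻¹ • v) (‖v‖⁻¹ • v) := hmin (by simp [norm_smul, hv'])
  simp only [map_smul, _root_.smul_apply, smul_eq_mul] at h
  calc B u u * ‖v‖ ^ 2 ≤ (‖v‖⁻¹ * (‖v‖⁻¹ * B v v)) * ‖v‖ ^ 2 := by gcongr
    _ = B v v := by field_simp

omit [NormedAddCommGroup E] [NormedSpace ℝ E] in
/-- The Koszul formula: `T` is determined by its symmetry in the first two variables and its
symmetrization in the last two. -/
lemma two_mul_eq_of_symm {T R : E → E → E → ℝ} (h : ∀ u v w, T u v w = T v u w)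
    (hR : ∀ u v w, T u v w + T u w v = R u v w) (u v w : E) :
    2 * T u v w = R u v w + R v u w - R w u v := by
  rw [← hR, ← hR, ← hR, h v u w, h w u v, h w v u]
  ring

/-- Exchange `D` for `D'`, then replace `u`, `v`, `w` by their images under `A` one at a time. As
`‖A‖ ≤ 2`, the three replacements cost `C ε` times `1`, `2` and `4`, whence the factor `7`. -/
lemma abs_trilinear_sub_le {D D' : E →L[ℝ] E →L[ℝ] E →L[ℝ] ℝ} {A : E →L[ℝ] E} {δ ε C : ℝ}
    (hD : ‖D - D'‖ ≤ δ) (hA : ‖A - ContinuousLinearMap.id ℝ E‖ ≤ ε) (hA1 : ‖A‖ ≤ 2)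
    (hC : ‖D'‖ ≤ C) (u v w : E) :
    |D u v w - D' (A u) (A v) (A w)| ≤ (δ + 7 * C * ε) * ‖u‖ * ‖v‖ * ‖w‖ := by
  have hsub : ∀ u, ‖u - A u‖ ≤ ε * ‖u‖ := fun u => by
    rw [norm_sub_rev]
    exact (A - ContinuousLinearMap.id ℝ E).le_of_opNorm_le hA u
  have hA2 : ∀ u, ‖A u‖ ≤ 2 * ‖u‖ := fun u => A.le_of_opNorm_le hA1 u
  have tri : ∀ (T : E →L[ℝ] E →L[ℝ] E →L[ℝ] ℝ) {K : ℝ}, ‖T‖ ≤ K → ∀ x y z,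
      |T x y z| ≤ K * ‖x‖ * ‖y‖ * ‖z‖ := fun T K hK x y z => by
    rw [← Real.norm_eq_abs]
    exact (T x y).le_of_opNorm_le ((T x).le_of_opNorm_le (T.le_of_opNorm_le hK x) y) z
  have hC0 : 0 ≤ C := (norm_nonneg _).trans hC
  have hε : 0 ≤ ε := (norm_nonneg _).trans hA
  have e : D u v w - D' (A u) (A v) (A w) = (D - D') u v w + D' (u - A u) v w
      + D' (A u) (v - A v) w + D' (A u) (A v) (w - A w) := by
    simp only [_root_.sub_apply, map_sub]
    ring
  have h1 := tri _ hD u v w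
  have h2 : |D' (u - A u) v w| ≤ C * (ε * ‖u‖) * ‖v‖ * ‖w‖ := (tri _ hC _ _ _).trans (by
    gcongr; exact hsub u)
  have h3 : |D' (A u) (v - A v) w| ≤ C * (2 * ‖u‖) * (ε * ‖v‖) * ‖w‖ := (tri _ hC _ _ _).trans (by
    gcongr; exacts [hA2 u, hsub v])
  have h4 : |D' (A u) (A v) (w - A w)| ≤ C * (2 * ‖u‖) * (2 * ‖v‖) * (ε * ‖w‖) :=
    (tri _ hC _ _ _).trans (by gcongr; exacts [hA2 u, hA2 v, hsub w])
  rw [e]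
  refine (abs_add_le _ _).trans ((add_le_add ((abs_add_le _ _).trans (add_le_add
    ((abs_add_le _ _).trans (add_le_add h1 h2)) h3)) h4).trans (le_of_eq ?_))
  ring

/-- If a symmetric bilinear form is coercive, the second derivative of an isometry is bounded by the
deviation of its 1-jet from that of the identity. -/
lemma norm_second_deriv_le {D D' : E →L[ℝ] E →L[ℝ] E →L[ℝ] ℝ} {B : E →L[ℝ] E →L[ℝ] ℝ}
    {A : E →L[ℝ] E} {H : E →L[ℝ] E →L[ℝ] E} {δ ε C c : ℝ} (hc : 0 < c)
    (hcoer : ∀ v, c * ‖v‖ ^ 2 ≤ B v (A v)) (hB : ∀ v w, B v w = B w v)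
    (hH : ∀ u v, H u v = H v u)
    (hDH : ∀ u v w, D' (A u) (A v) (A w) + B (H u v) (A w) + B (A v) (H u w) = D u v w)
    (hD : ‖D - D'‖ ≤ δ) (hA : ‖A - ContinuousLinearMap.id ℝ E‖ ≤ ε) (hA1 : ‖A‖ ≤ 2)
    (hC : ‖D'‖ ≤ C) : ‖H‖ ≤ 3 / (2 * c) * (δ + 7 * C * ε) := by
  have hC0 : 0 ≤ C := (norm_nonneg _).trans hC
  have hε : 0 ≤ ε := (norm_nonneg _).trans hA
  have hδ : 0 ≤ δ := (norm_nonneg _).trans hD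
  refine ContinuousLinearMap.opNorm_le_bound₂ _ (by positivity) fun u v => ?_
  set ζ := H u v
  -- The differentiated isometry equation gives only the sum of `B (H u v) (A w)` and `B (H u w) (A
  -- v)`. Because `H` is symmetric, the Koszul trick isolates `B (H u v) (A w)` as half a
  -- combination of three error terms. Taking `w = H u v` makes coercivity applicable, which
  -- explains the constant `3 / (2 * c)`.
  have key := two_mul_eq_of_symm (T := fun u v w => B (H u v) (A w))
    (R := fun u v w => D u v w - D' (A u) (A v) (A w))
    (fun u v w => by simp only [hH u v]) (fun u v w => by
      simp only [← hDH u v w, hB (A v)]; ring) u v ζ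
  have bd := abs_trilinear_sub_le hD hA hA1 hC
  have h1 := (abs_le.mp (bd u v ζ)).2
  have h2 := (abs_le.mp (bd v u ζ)).2
  have h3 := (abs_le.mp (bd ζ u v)).1
  have h4 := hcoer ζ
  have h5 : 2 * c * ‖ζ‖ ^ 2 ≤ 3 * ((δ + 7 * C * ε) * ‖u‖ * ‖v‖) * ‖ζ‖ := by
    change 2 * B ζ (A ζ) = _ at key
    nlinarith
  rcases (norm_nonneg ζ).eq_or_lt with h0 | h0
  · rw [← h0]; positivity
  have h6 : 2 * c * ‖ζ‖ ≤ 3 * ((δ + 7 * C * ε) * ‖u‖ * ‖v‖) := by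
    refine le_of_mul_le_mul_right ?_ h0
    linarith [h5, sq ‖ζ‖]
  rw [show 3 / (2 * c) * (δ + 7 * C * ε) * ‖u‖ * ‖v‖ =
    3 * ((δ + 7 * C * ε) * ‖u‖ * ‖v‖) / (2 * c) by field_simp, le_div_iff₀ (by positivity)]
  linarith

/-- A map whose second derivative is bounded by the deviation of its 1-jet from that of the identity
is the identity if its 1-jet at one point is. -/
lemma eventually_eq_id_of_norm_fderiv_le {φ : E → E} {y₀ : E} (hφ : ContDiffAt ℝ 2 φ y₀)
    (h0 : φ y₀ = y₀) (h1 : fderiv ℝ φ y₀ = ContinuousLinearMap.id ℝ E) {K : ℝ}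
    (hK : ∀ᶠ y in 𝓝 y₀, ‖fderiv ℝ (fderiv ℝ φ) y‖ ≤
      K * (‖φ y - y‖ + ‖fderiv ℝ φ y - ContinuousLinearMap.id ℝ E‖)) :
    ∀ᶠ y in 𝓝 y₀, φ y = y := by
  -- `K` is not assumed nonnegative; `max K 0` makes the estimates below monotone.
  have hK' : ∀ᶠ y in 𝓝 y₀, ‖fderiv ℝ (fderiv ℝ φ) y‖ ≤
      max K 0 * (‖φ y - y‖ + ‖fderiv ℝ φ y - ContinuousLinearMap.id ℝ E‖) :=
    hK.mono fun y hy => hy.trans (by gcongr; exact le_max_left _ _)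
  obtain ⟨r, hr, hball⟩ := Metric.eventually_nhds_iff_ball.mp
    (hK'.and (hφ.eventually (by simp)))
  refine Metric.eventually_nhds_iff_ball.mpr ⟨r, hr, fun y hy => ?_⟩
  let v := y - y₀
  let ℓ : ℝ → E := fun t => y₀ + t • v
  have hℓ : ∀ t ∈ Icc (0 : ℝ) 1, ℓ t ∈ Metric.ball y₀ r := fun t ht =>
    (convex_ball y₀ r).add_smul_sub_mem (Metric.mem_ball_self hr) hy ht
  have hℓ' : ∀ t, HasDerivAt ℓ v t := fun t => by
    simpa [ℓ] using ((hasDerivAt_id t).smul_const v).const_add y₀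
  -- The deviation of the 1-jet of `φ` from that of the identity along the segment from `y₀` to `y`.
  -- It vanishes at `0` and its derivative is bounded by a multiple of itself, so Grönwall's
  -- inequality makes it vanish.
  let f : ℝ → E × (E →L[ℝ] E) := fun t =>
    (φ (ℓ t) - ℓ t, fderiv ℝ φ (ℓ t) - ContinuousLinearMap.id ℝ E)
  let f' : ℝ → E × (E →L[ℝ] E) := fun t =>
    (fderiv ℝ φ (ℓ t) v - v, fderiv ℝ (fderiv ℝ φ) (ℓ t) v)
  have hf : ∀ t ∈ Icc (0 : ℝ) 1, HasDerivAt f (f' t) t := fun t ht => by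
    have h2 := (hball _ (hℓ t ht)).2
    have d1 : HasFDerivAt φ (fderiv ℝ φ (ℓ t)) (ℓ t) :=
      (h2.differentiableAt (by simp)).hasFDerivAt
    have d2 : HasFDerivAt (fderiv ℝ φ) (fderiv ℝ (fderiv ℝ φ) (ℓ t)) (ℓ t) :=
      ((h2.fderiv_right (m := 1) (by norm_num)).differentiableAt (by simp)).hasFDerivAt
    exact ((d1.comp_hasDerivAt t (hℓ' t)).sub (hℓ' t)).prodMk
      ((d2.comp_hasDerivAt t (hℓ' t)).sub_const _)
  -- The derivative of the first component costs `‖v‖ * ‖f t‖`. For the second, each of the two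
  -- deviations in the hypothesis is at most `‖f t‖`, which gives the `2 * max K 0`. The constant
  -- dominates both.
  have hbound : ∀ t ∈ Icc (0 : ℝ) 1, ‖f' t‖ ≤ ((1 + 2 * max K 0) * ‖v‖) * ‖f t‖ := fun t ht => by
    have e1 : ‖φ (ℓ t) - ℓ t‖ ≤ ‖f t‖ := norm_fst_le (f t)
    have e2 : ‖fderiv ℝ φ (ℓ t) - ContinuousLinearMap.id ℝ E‖ ≤ ‖f t‖ := norm_snd_le (f t)
    have hM : 0 ≤ max K 0 := le_max_right _ _
    refine norm_prod_le_iff.mpr ⟨?_, ?_⟩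
    · calc ‖fderiv ℝ φ (ℓ t) v - v‖ ≤ ‖fderiv ℝ φ (ℓ t) - ContinuousLinearMap.id ℝ E‖ * ‖v‖ :=
            (fderiv ℝ φ (ℓ t) - ContinuousLinearMap.id ℝ E).le_opNorm v
        _ ≤ ‖f t‖ * ‖v‖ := by gcongr
        _ ≤ ((1 + 2 * max K 0) * ‖v‖) * ‖f t‖ := by
          have : 0 ≤ max K 0 * (‖v‖ * ‖f t‖) := by positivity
          linarith
    · calc ‖fderiv ℝ (fderiv ℝ φ) (ℓ t) v‖ ≤ ‖fderiv ℝ (fderiv ℝ φ) (ℓ t)‖ * ‖v‖ :=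
            ContinuousLinearMap.le_opNorm _ v
        _ ≤ (max K 0 * (‖f t‖ + ‖f t‖)) * ‖v‖ := by
          gcongr; exact (hball _ (hℓ t ht)).1.trans (by gcongr)
        _ ≤ ((1 + 2 * max K 0) * ‖v‖) * ‖f t‖ := by
          have : 0 ≤ ‖v‖ * ‖f t‖ := by positivity
          linarith
  have := eq_zero_of_abs_deriv_le_mul_abs_self_of_eq_zero_right (f := f) (f' := f')
    (a := 0) (b := 1)
    (fun t ht => (hf t ht).continuousAt.continuousWithinAt)
    (fun t ht => (hf t (Ico_subset_Icc_self ht)).hasDerivWithinAt)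
    (by simp [f, ℓ, h0, h1]) (fun t ht => hbound t (Ico_subset_Icc_self ht)) 1
    (right_mem_Icc.mpr zero_le_one)
  have h7 : φ (ℓ 1) - ℓ 1 = 0 := congrArg Prod.fst this
  have h8 : ℓ 1 = y := by simp [ℓ, v]
  rw [h8] at h7
  exact sub_eq_zero.mp h7

/-- An isometry of a Riemannian metric is the identity near a point where its 1-jet is that of the
identity. -/
theorem eventually_eq_id_of_isometry [FiniteDimensional ℝ E] {G : E → E →L[ℝ] E →L[ℝ] ℝ} {φ : E → E}
    {y₀ : E} (hG : ContDiffAt ℝ 2 G y₀) (hφ : ContDiffAt ℝ 2 φ y₀)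
    (hpos : ∀ v, v ≠ 0 → 0 < G y₀ v v) (hsymm : ∀ᶠ y in 𝓝 y₀, ∀ v w, G y v w = G y w v)
    (h0 : φ y₀ = y₀) (h1 : fderiv ℝ φ y₀ = ContinuousLinearMap.id ℝ E)
    (hiso : ∀ᶠ y in 𝓝 y₀, ∀ v w, G (φ y) (fderiv ℝ φ y v) (fderiv ℝ φ y w) = G y v w) :
    ∀ᶠ y in 𝓝 y₀, φ y = y := by
  obtain ⟨c, hc, hcoer⟩ := exists_forall_mul_sq_le (G y₀) hpos
  have hφt : Tendsto φ (𝓝 y₀) (𝓝 y₀) := by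
    have := hφ.continuousAt
    unfold ContinuousAt at this
    rwa [h0] at this
  have hG1 : ContDiffAt ℝ 1 (fderiv ℝ G) y₀ := hG.fderiv_right (by norm_num)
  have hφ1 : ContDiffAt ℝ 1 (fderiv ℝ φ) y₀ := hφ.fderiv_right (by norm_num)
  obtain ⟨L, s, hs, hL⟩ := hG1.exists_lipschitzOnWith
  have hC : ∀ᶠ y in 𝓝 y₀, ‖fderiv ℝ G y‖ < ‖fderiv ℝ G y₀‖ + 1 :=
    hG1.continuousAt.norm.eventually (gt_mem_nhds (lt_add_one _))
  have hA : ∀ᶠ y in 𝓝 y₀, ‖fderiv ℝ φ y‖ ≤ 2 := by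
    have : ‖fderiv ℝ φ y₀‖ < 2 := by
      rw [h1]; exact ContinuousLinearMap.norm_id_le.trans_lt one_lt_two
    exact (hφ1.continuousAt.norm.eventually (gt_mem_nhds this)).mono fun _ h => h.le
  have hcoer' : ∀ᶠ y in 𝓝 y₀, ∀ v, c / 2 * ‖v‖ ^ 2 ≤ G (φ y) v (fderiv ℝ φ y v) := by
    -- The bilinear form `(v, w) ↦ G (φ y) v (Dφ w)` tends to `G y₀` in operator norm, so half of
    -- the coercivity constant survives near `y₀`.
    have hcont : ContinuousAt
        (fun y => (ContinuousLinearMap.compL ℝ E E ℝ).flip (fderiv ℝ φ y) ∘L G (φ y)) y₀ := by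
      have h2 : ContinuousAt (fun y => G (φ y)) y₀ :=
        ContinuousAt.comp (by rw [h0]; exact hG.continuousAt) hφ.continuousAt
      exact ((((ContinuousLinearMap.compL ℝ E E ℝ).flip).continuous.continuousAt.comp
        hφ1.continuousAt)).clm_comp h2
    have h3 := Metric.tendsto_nhds.mp hcont (c / 2) (by positivity)
    filter_upwards [h3] with y hy v
    rw [dist_eq_norm] at hy
    have h4 := ContinuousLinearMap.le_of_opNorm_le _
      (ContinuousLinearMap.le_of_opNorm_le _ hy.le v) v
    rw [Real.norm_eq_abs] at h4
    have h5 := (abs_le.mp h4).1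
    simp only [_root_.sub_apply, ContinuousLinearMap.comp_apply,
      ContinuousLinearMap.flip_apply, ContinuousLinearMap.compL_apply, h0, h1,
      ContinuousLinearMap.id_apply] at h5
    nlinarith [hcoer v]
  -- `L` is a local Lipschitz constant of `DG`, which bounds `DG y - DG (φ y)` by `L * ‖φ y - y‖`,
  -- and `‖fderiv ℝ G y₀‖ + 1` bounds `DG` near `y₀`. These are the `δ` and `C` of
  -- `norm_second_deriv_le`, with `c / 2` as coercivity constant.
  refine eventually_eq_id_of_norm_fderiv_le hφ h0 h1
    (K := 3 / (2 * (c / 2)) * (L + 7 * (‖fderiv ℝ G y₀‖ + 1))) ?_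
  filter_upwards [hcoer', hA, hφt.eventually hC, hφt.eventually hsymm, hs, hφt hs,
    hφ.eventually (by simp), hG.eventually (by simp), hφt.eventually (hG.eventually (by simp)),
    hiso.eventually_nhds] with y e1 e2 e3 e4 e5 e6 e7 e8 e9 e10
  have hDlip : ‖fderiv ℝ G y - fderiv ℝ G (φ y)‖ ≤ L * ‖φ y - y‖ := by
    rw [norm_sub_rev (φ y)]; exact hL.norm_sub_le e5 e6
  have d1 : HasFDerivAt φ (fderiv ℝ φ y) y := (e7.differentiableAt (by simp)).hasFDerivAt
  have d2 : HasFDerivAt (fderiv ℝ φ) (fderiv ℝ (fderiv ℝ φ) y) y :=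
    ((e7.fderiv_right (m := 1) (by norm_num)).differentiableAt (by simp)).hasFDerivAt
  have dG : HasFDerivAt G (fderiv ℝ G y) y := (e8.differentiableAt (by simp)).hasFDerivAt
  have dG' : HasFDerivAt (fun z => G (φ z)) ((fderiv ℝ G (φ y)).comp (fderiv ℝ φ y)) y :=
    ((e9.differentiableAt (by simp)).hasFDerivAt).comp y d1
  refine (norm_second_deriv_le (D := fderiv ℝ G y) (D' := fderiv ℝ G (φ y)) (B := G (φ y))
    (A := fderiv ℝ φ y) (half_pos hc) e1 e4 (fun u v => ?_) (fun u v w => ?_) hDlip le_rfl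
    e2 e3.le).trans ?_
  · exact e7.isSymmSndFDerivAt (by simp) u v
  -- Differentiate the isometry identity in the direction `u`, with `v` and `w` held fixed.
  · have l := ((dG'.clm_apply (d2.clm_apply (hasFDerivAt_const v y))).clm_apply
      (d2.clm_apply (hasFDerivAt_const w y)))
    have r := (dG.clm_apply (hasFDerivAt_const v y)).clm_apply (hasFDerivAt_const w y)
    have heq : (fun z => G (φ z) (fderiv ℝ φ z v) (fderiv ℝ φ z w)) =ᶠ[𝓝 y] fun z => G z v w :=
      e10.mono fun z hz => hz v w
    have := congrArg (fun T : E →L[ℝ] ℝ => T u) (l.unique (r.congr_of_eventuallyEq heq))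
    simp at this
    linarith
  · have hL0 : (0 : ℝ) ≤ L := L.2
    refine (mul_le_mul_of_nonneg_left ?_ (by positivity)).trans_eq (mul_assoc _ _ _).symm
    nlinarith [norm_nonneg (φ y - y), norm_nonneg (fderiv ℝ G y₀),
      norm_nonneg (fderiv ℝ φ y - ContinuousLinearMap.id ℝ E),
      mul_nonneg hL0 (norm_nonneg (fderiv ℝ φ y - ContinuousLinearMap.id ℝ E)),
      mul_nonneg (norm_nonneg (fderiv ℝ G y₀)) (norm_nonneg (φ y - y))]

end Isometry

/-! ### Transverse metrics in foliated coordinates -/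

section CoordinateField

open VectorField

variable {E E' X : Type*} [NormedAddCommGroup E] [NormedSpace ℝ E] [FiniteDimensional ℝ E]
  [NormedAddCommGroup E'] [NormedSpace ℝ E'] [TopologicalSpace X]
  [ChartedSpace E X] [IsManifold 𝓘(ℝ, E) ∞ X] {c : OpenPartialHomeomorph X E'}

variable (E) in
/-- The vector field on `X` with constant coordinates `ξ` in the chart `c`. -/
def coordField (c : OpenPartialHomeomorph X E') (ξ : E') (x : X) : TangentSpace 𝓘(ℝ, E) x :=
  mpullback 𝓘(ℝ, E) 𝓘(ℝ, E') c (fun _ => ξ) x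

omit [FiniteDimensional ℝ E] [IsManifold 𝓘(ℝ, E) ∞ X] in
lemma isInvertible_mfderiv_chart (hc : ContMDiffOn 𝓘(ℝ, E) 𝓘(ℝ, E') ∞ c c.source)
    (hc' : ContMDiffOn 𝓘(ℝ, E') 𝓘(ℝ, E) ∞ c.symm c.target) {x : X} (hx : x ∈ c.source) :
    (mfderiv 𝓘(ℝ, E) 𝓘(ℝ, E') c x).IsInvertible := by
  obtain ⟨L, hL⟩ := exists_equiv_eq_der (E := E) (E' := E') (f := c) (x := x)
    ⟨⟨c.toPartialEquiv, c.open_source, c.open_target, hc, hc'⟩, hx, fun _ _ => rfl⟩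
  exact ⟨L, hL⟩

omit [FiniteDimensional ℝ E] [IsManifold 𝓘(ℝ, E) ∞ X] in
lemma coordField_eq (hc : ContMDiffOn 𝓘(ℝ, E) 𝓘(ℝ, E') ∞ c c.source)
    (hc' : ContMDiffOn 𝓘(ℝ, E') 𝓘(ℝ, E) ∞ c.symm c.target) (ξ : E') {x : X} (hx : x ∈ c.source) :
    coordField E c ξ x = der E' E c.symm (c x) ξ := by
  obtain ⟨L, hL⟩ := isInvertible_mfderiv_chart hc hc' hx
  have hL' : ∀ v : E, L v = der E E' c x v := fun v => DFunLike.congr_fun hL v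
  have h1 : coordField E c ξ x = L.symm ξ := by
    change (mfderiv 𝓘(ℝ, E) 𝓘(ℝ, E') c x).inverse ξ = L.symm ξ
    rw [← hL, ContinuousLinearMap.inverse_equiv]
    rfl
  rw [h1]
  have h2 := der_comp_eq_id (E := E) (E' := E') (f := c) (g := c.symm)
    (hc'.contMDiffAt (c.open_target.mem_nhds (c.map_source hx)))
    (hc.contMDiffAt (c.open_source.mem_nhds hx)) (c.eventually_left_inverse hx) (L.symm ξ)
  exact h2.symm.trans (congrArg (der E' E c.symm (c x))
    ((hL' _).symm.trans (L.apply_symm_apply ξ)))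

/-- The Lie derivative condition is stated for globally defined vector fields, so coordinate fields
are extended by zero after multiplication by a bump function. One function serves all `ξ`. -/
lemma exists_smooth_cutoff [T2Space X] (hc : ContMDiffOn 𝓘(ℝ, E) 𝓘(ℝ, E') ∞ c c.source)
    (hc' : ContMDiffOn 𝓘(ℝ, E') 𝓘(ℝ, E) ∞ c.symm c.target) {x : X} (hx : x ∈ c.source) :
    ∃ ρ : X → ℝ, ρ =ᶠ[𝓝 x] 1 ∧ (∀ z ∉ c.source, ρ z = 0) ∧ ∀ ξ,
      ContMDiff 𝓘(ℝ, E) 𝓘(ℝ, E).tangent ∞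
        (fun z => (⟨z, ρ z • coordField E c ξ z⟩ : TangentBundle 𝓘(ℝ, E) X)) := by
  obtain ⟨ρ, -, hρ⟩ := (SmoothBumpFunction.nhds_basis_tsupport (I := 𝓘(ℝ, E)) x).mem_iff.mp
    (c.open_source.mem_nhds hx)
  refine ⟨ρ, ρ.eventuallyEq_one, fun z hz => ?_, fun ξ => ?_⟩
  · exact image_eq_zero_of_notMem_tsupport fun h => hz (hρ h)
  · refine ContMDiffOn.smul_section_of_tsupport (V := TangentSpace 𝓘(ℝ, E)) (F := E)
      ρ.contMDiff.contMDiffOn c.open_source hρ ?_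
    intro z hz
    refine (ContMDiffAt.mpullback_vectorField_preimage (n := ∞) ?_
      (hc.contMDiffAt (c.open_source.mem_nhds hz)) (isInvertible_mfderiv_chart hc hc' hz)
      (by simp)).contMDiffWithinAt
    exact contMDiffAt_vectorSpace_iff_contDiffAt.mpr contDiffAt_const

/-- Brackets commute with pullback along the chart, and constant fields on a vector space commute.
-/
lemma mlieBracket_coordField [CompleteSpace E'] (hc : ContMDiffOn 𝓘(ℝ, E) 𝓘(ℝ, E') ∞ c c.source)
    (ξ η : E') {x : X}
    (hx : x ∈ c.source) : mlieBracket 𝓘(ℝ, E) (coordField E c ξ) (coordField E c η) x = 0 := by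
  have : IsManifold 𝓘(ℝ, E) (minSmoothness ℝ 2) X := by
    rw [minSmoothness_of_isRCLikeNormedField]
    exact IsManifold.of_le (n := ∞) (by exact ENat.LEInfty.out)
  have : IsManifold 𝓘(ℝ, E') (minSmoothness ℝ 2) E' := by
    rw [minSmoothness_of_isRCLikeNormedField]; infer_instance
  have hd : ∀ ζ : E', MDifferentiableAt 𝓘(ℝ, E') 𝓘(ℝ, E').tangent
      (fun y : E' => (⟨y, ζ⟩ : TangentBundle 𝓘(ℝ, E') E')) (c x) := fun ζ =>
    (contMDiffAt_vectorSpace_iff_contDiffAt.mpr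
      (contDiffAt_const (n := 1))).mdifferentiableAt (by simp)
  have := mpullback_mlieBracket (I := 𝓘(ℝ, E)) (I' := 𝓘(ℝ, E')) (f := c) (x₀ := x) (n := ∞)
    (hd ξ) (hd η) (hc.contMDiffAt (c.open_source.mem_nhds hx))
    (by rw [minSmoothness_of_isRCLikeNormedField]; exact ENat.LEInfty.out)
  refine this.symm.trans ?_
  have h0 : mlieBracket 𝓘(ℝ, E') (fun _ : E' => ξ) (fun _ => η) (c x) = 0 := by
    have h1 := congrFun (mlieBracketWithin_eq_lieBracketWithin (𝕜 := ℝ) (E := E')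
      (V := fun _ => ξ) (W := fun _ => η) (s := univ)) (c x)
    refine (congrFun mlieBracketWithin_univ (c x)).symm.trans (h1.trans ?_)
    rw [lieBracketWithin_univ]
    exact (congrFun lieBracket_eq (c x)).trans (by simp; rfl)
  rw [mpullback_apply, h0, map_zero]

end CoordinateField

section TransverseMetric

open VectorField

variable {d q : ℕ} {X : Type u} [TopologicalSpace X] [ChartedSpace (RR (d + q)) X]
  [IsManifold 𝓘(ℝ, RR (d + q)) ∞ X] {F : Foliation d q X}

/-- The metric, as a bilinear form on the model space. -/
def TransverseMetric.form (g : TransverseMetric F) (x : X) :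
    RR (d + q) →L[ℝ] RR (d + q) →L[ℝ] ℝ := g.val x

variable [T2Space X] (g : TransverseMetric F) {c : OpenPartialHomeomorph X (RR d × RR q)}
  (hc : ContMDiffOn 𝓘(ℝ, RR (d + q)) 𝓘(ℝ, RR d × RR q) ∞ c c.source)
  (hc' : ContMDiffOn 𝓘(ℝ, RR d × RR q) 𝓘(ℝ, RR (d + q)) ∞ c.symm c.target)
  (hct : ∀ z ∈ c.source, F.IsTransverseAt (fun z => (c z).2) z)

include hc hc' hct

omit [IsManifold 𝓘(ℝ, RR (d + q)) ∞ X] [T2Space X] in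
lemma isTangent_coordField (e : RR d) {x : X} (hx : x ∈ c.source) :
    F.IsTangent x (coordField (RR (d + q)) c (e, (0 : RR q)) x) := by
  rw [coordField_eq hc hc' _ hx]
  refine ((hct x hx).isTangent_iff _).mpr ?_
  have hcx := hc.contMDiffAt (c.open_source.mem_nhds hx)
  have hcx' := hc'.contMDiffAt (c.open_target.mem_nhds (c.map_source hx))
  have h1 : ContMDiffAt 𝓘(ℝ, RR d × RR q) 𝓘(ℝ, RR q) ∞ (Prod.snd : RR d × RR q → RR q) (c x) :=
    contDiff_snd.contMDiff.contMDiffAt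
  have h2 := der_comp_apply (E := RR (d + q)) (E' := RR d × RR q) (E'' := RR q) (f := c)
    (g := Prod.snd) h1 hcx (der (RR d × RR q) (RR (d + q)) c.symm (c x) (e, 0))
  refine h2.trans ?_
  have h3 : der (RR (d + q)) (RR d × RR q) c x
      (der (RR d × RR q) (RR (d + q)) c.symm (c x) (e, 0)) = (e, 0) := by
    have := der_comp_eq_id (f := c.symm) (g := c) (x := c x) (by rwa [c.left_inv hx]) hcx'
      (c.eventually_right_inverse (c.map_source hx)) (e, (0 : RR q))
    rwa [c.left_inv hx] at this
  rw [h3, der_eq_fderiv, fderiv_snd]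
  rfl

/-- The coefficients of the metric in a foliated chart are smooth and constant along plaques. -/
lemma contMDiffAt_metric_coeff (ξ η : RR d × RR q) {x : X} (hx : x ∈ c.source) :
    ContMDiffAt 𝓘(ℝ, RR (d + q)) 𝓘(ℝ, ℝ) ∞ (fun z =>
      g.form z (der _ (RR (d + q)) c.symm (c z) ξ) (der _ (RR (d + q)) c.symm (c z) η)) x ∧
    ∀ e : RR d, der (RR (d + q)) ℝ (fun z =>
      g.form z (der _ (RR (d + q)) c.symm (c z) ξ) (der _ (RR (d + q)) c.symm (c z) η)) x
        (der _ (RR (d + q)) c.symm (c x) (e, (0 : RR q))) = 0 := by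
  obtain ⟨ρ, hρ, hρ0, hsm⟩ := exists_smooth_cutoff hc hc' hx
  let V : (RR d × RR q) → ∀ z : X, TangentSpace 𝓘(ℝ, RR (d + q)) z :=
    fun ζ z => ρ z • coordField (RR (d + q)) c ζ z
  have hE : ∀ ζ, V ζ =ᶠ[𝓝 x] coordField (RR (d + q)) c ζ := fun ζ => hρ.mono fun z hz => by
    change ρ z • coordField (RR (d + q)) c ζ z = _
    rw [hz]; exact one_smul _ _
  have hE' : ∀ ζ, ∀ᶠ z in 𝓝 x, V ζ z = der _ (RR (d + q)) c.symm (c z) ζ := fun ζ => by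
    filter_upwards [hE ζ, c.open_source.mem_nhds hx] with z h1 h2
    exact h1.trans (coordField_eq hc hc' _ h2)
  let h : X → ℝ := fun z => g.val z (V ξ z) (V η z)
  have hh : ContMDiffAt 𝓘(ℝ, RR (d + q)) 𝓘(ℝ, ℝ) ∞ h x := by
    have := ContMDiffAt.clm_bundle_apply₂ (F₁ := RR (d + q)) (F₂ := RR (d + q)) (F₃ := ℝ)
      (E₃ := fun _ : X => ℝ) (g.smooth x) (hsm ξ x) (hsm η x)
    exact (Bundle.contMDiffAt_totalSpace.mp this).2
  have heq : (fun z => g.form z (der _ (RR (d + q)) c.symm (c z) ξ)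
      (der _ (RR (d + q)) c.symm (c z) η)) =ᶠ[𝓝 x] h := by
    filter_upwards [hE' ξ, hE' η] with z h1 h2
    rw [← h1, ← h2]
    rfl
  refine ⟨hh.congr_of_eventuallyEq heq, fun e => ?_⟩
  rw [der_congr heq, ← (hE' _).self_of_nhds]
  have hb : ∀ ζ, mlieBracket 𝓘(ℝ, RR (d + q)) (V (e, 0)) (V ζ) x = 0 := fun ζ =>
    ((hE _).mlieBracket_vectorField_eq (hE ζ)).trans (mlieBracket_coordField hc _ _ hx)
  -- The field must be tangent to the leaves everywhere: in the chart because its coordinates are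
  -- constant in a leaf direction, outside it because the cutoff vanishes.
  have ht : ∀ z, F.IsTangent z (V (e, 0) z) := fun z => by
    obtain ⟨a, ha⟩ := F.exists_isTransverseAt z
    refine (ha.isTangent_iff _).mpr ?_
    by_cases hz : z ∈ c.source
    · refine (map_smul _ _ _).trans ?_
      rw [(ha.isTangent_iff _).mp (isTangent_coordField hc hc' hct e hz), smul_zero]
    · have h0 : V (e, 0) z = 0 := by
        change ρ z • coordField (RR (d + q)) c (e, 0) z = 0
        rw [hρ0 z hz]; exact zero_smul _ _
      rw [h0]; exact map_zero _
  -- Near `x` the three fields are commuting coordinate fields, so both bracket terms vanish at `x`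
  -- and only the derivative of the coefficient remains.
  have := g.lie_eq_zero _ _ _ ht (hsm (e, 0)) (hsm ξ) (hsm η) x
  have h1 : g.val x (mlieBracket 𝓘(ℝ, RR (d + q)) (V (e, 0)) (V ξ) x) (V η x) = 0 := by
    rw [hb ξ, map_zero]; rfl
  have h2 : g.val x (V ξ x) (mlieBracket 𝓘(ℝ, RR (d + q)) (V (e, 0)) (V η) x) = 0 := by
    rw [hb η, map_zero]
  have h3 := ((sub_eq_zero.mp this).trans h2)
  exact (sub_eq_zero.mp h3).trans h1

end TransverseMetric

/-! ### Transverse metrics are locally pulled back along transverse coordinates -/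

section LocalForm

variable {d q : ℕ} {X : Type u} [TopologicalSpace X] [ChartedSpace (RR (d + q)) X]
  [IsManifold 𝓘(ℝ, RR (d + q)) ∞ X] {F : Foliation d q X} (g : TransverseMetric F)

lemma TransverseMetric.form_symm (x : X) (v w : RR (d + q)) : g.form x v w = g.form x w v :=
  g.symm x v w

lemma TransverseMetric.form_of_isTangent {x : X} {v : RR (d + q)} (hv : F.IsTangent x v)
    (w : RR (d + q)) : g.form x v w = 0 :=
  g.tangent x v hv w

lemma TransverseMetric.form_congr {x : X} {v v' w w' : RR (d + q)}
    (hv : F.IsTangent x (v - v' : RR (d + q))) (hw : F.IsTangent x (w - w' : RR (d + q))) :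
    g.form x v w = g.form x v' w' := by
  have h1 : g.form x v w = g.form x v' w := by
    rw [← sub_eq_zero, ← g.form_of_isTangent hv w, map_sub]; rfl
  have h2 : g.form x v' w = g.form x v' w' := by
    rw [← sub_eq_zero, ← map_sub, g.form_symm, g.form_of_isTangent hw]
  exact h1.trans h2

lemma contDiffAt_of_apply_apply {E F : Type*} [NormedAddCommGroup E] [NormedSpace ℝ E]
    [NormedAddCommGroup F] [NormedSpace ℝ F] [FiniteDimensional ℝ F]
    {G : E → F →L[ℝ] F →L[ℝ] ℝ} {y : E} {n : ℕ}
    (h : ∀ᶠ z in 𝓝 y, ∀ u v, ContDiffAt ℝ n (fun w => G w u v) z) : ContDiffAt ℝ n G y := by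
  obtain ⟨U, hU, hUo, hyU⟩ := eventually_nhds_iff.mp h
  refine ContDiffOn.contDiffAt (s := U) ?_ (hUo.mem_nhds hyU)
  exact contDiffOn_clm_apply.mpr fun u => contDiffOn_clm_apply.mpr fun v z hz =>
    (hU z hz u v).contDiffWithinAt

/-- In a chart straightening `a`, the form depends only on the transverse components of vectors,
because leaf directions lie in its kernel. Its coefficients have zero derivative in the leaf
directions, and the slices of the convex target are connected, so the coefficients depend on `a`
alone. -/
lemma TransverseMetric.exists_eventually_form_eq [T2Space X] {a : X → RR q} {x : X}
    (ha : F.IsTransverseAt a x) : ∃ G : RR q → RR q →L[ℝ] RR q →L[ℝ] ℝ,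
      ContDiffAt ℝ 2 G (a x) ∧ ∀ᶠ z in 𝓝 x, ∀ v w, g.form z v w =
        G (a z) (der (RR (d + q)) (RR q) a z v) (der (RR (d + q)) (RR q) a z w) := by
  obtain ⟨c, hx, -, hc, hc', hconv, hca⟩ := ha.exists_chart univ_mem
  have hct : ∀ z ∈ c.source, F.IsTransverseAt (fun z => (c z).2) z := fun z hz =>
    (hca z hz).2.congr (by
      filter_upwards [c.open_source.mem_nhds hz] with z' hz' using (hca z' hz').1)
  have hcz := fun z hz => hc.contMDiffAt (c.open_source.mem_nhds (x := z) hz)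
  have hcw := fun w hw => hc'.contMDiffAt (c.open_target.mem_nhds (x := w) hw)
  let D : RR d × RR q → (RR d × RR q →L[ℝ] RR (d + q)) :=
    fun w => der (RR d × RR q) (RR (d + q)) c.symm w
  let h : RR q → RR q → X → ℝ := fun u v z => g.form z (D (c z) (0, u)) (D (c z) (0, v))
  have hh : ∀ u v, ∀ z ∈ c.source, ContMDiffAt 𝓘(ℝ, RR (d + q)) 𝓘(ℝ, ℝ) ∞ (h u v) z ∧
      ∀ e, der (RR (d + q)) ℝ (h u v) z (D (c z) (e, 0)) = 0 := fun u v z hz =>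
    contMDiffAt_metric_coeff g hc hc' hct (0, u) (0, v) hz
  let H : RR q → RR q → RR d × RR q → ℝ := fun u v w => h u v (c.symm w)
  have hH : ∀ u v, ∀ w ∈ c.target, ContDiffAt ℝ ∞ (H u v) w ∧
      ∀ e, fderiv ℝ (H u v) w (e, 0) = 0 := fun u v w hw => by
    obtain ⟨h1, h2⟩ := hh u v _ (c.map_target hw)
    refine ⟨contMDiffAt_iff_contDiffAt.mp (ContMDiffAt.comp (g := h u v) w h1 (hcw w hw)),
      fun e => ?_⟩
    have h3 := der_comp_apply (g := h u v) (f := c.symm) h1 (hcw w hw) (e, 0)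
    have h4 := h2 e
    rw [c.right_inv hw] at h4
    rw [← der_eq_fderiv]
    exact h3.trans h4
  have hconst : ∀ u v e e' y, (e, y) ∈ c.target → (e', y) ∈ c.target →
      H u v (e, y) = H u v (e', y) := fun u v e e' y he he' => by
    let s : Set (RR d) := {e | (e, y) ∈ c.target}
    have hs : IsOpen s := c.open_target.preimage (Continuous.prodMk_left y)
    have hs' : Convex ℝ s := by
      intro e₁ h₁ e₂ h₂ α β hα hβ hαβ
      have h5 := hconv h₁ h₂ hα hβ hαβ
      have h6 : α • y + β • y = y := by rw [← add_smul, hαβ, one_smul]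
      change (α • e₁ + β • e₂, y) ∈ c.target
      rwa [Prod.smul_mk, Prod.smul_mk, Prod.mk_add_mk, h6] at h5
    have hd : ∀ e ∈ s, HasFDerivAt (fun e => H u v (e, y)) (0 : RR d →L[ℝ] ℝ) e := fun e he => by
      have h7 := HasFDerivAt.comp (g := H u v) (f := fun e : RR d => (e, y)) e
        ((hH u v _ he).1.differentiableAt (by simp)).hasFDerivAt (hasFDerivAt_prodMk_left e y)
      refine h7.congr_fderiv ?_
      ext e'
      exact (hH u v _ he).2 e'
    exact hs.is_const_of_fderiv_eq_zero hs'.isPreconnected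
      (fun e he => (hd e he).differentiableAt.differentiableWithinAt)
      (fun e he => (hd e he).fderiv) he he'
  have hform : ∀ z ∈ c.source, ∀ v w, g.form z v w =
      h (der (RR (d + q)) (RR q) a z v) (der (RR (d + q)) (RR q) a z w) z := fun z hz v w => by
    have hd : ∀ v, der (RR (d + q)) (RR q) a z
        (D (c z) (0, der (RR (d + q)) (RR q) a z v)) = der (RR (d + q)) (RR q) a z v := fun v => by
      have h8 : der (RR (d + q)) (RR q) (fun z => (c z).2) z = der (RR (d + q)) (RR q) a z :=
        der_congr (by
          filter_upwards [c.open_source.mem_nhds hz] with z' hz' using (hca z' hz').1)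
      have h9 := der_comp_apply (g := fun w => (c w).2) (f := c.symm) (x := c z)
        (by
          rw [c.left_inv hz]
          exact (contDiff_snd (𝕜 := ℝ) (E := RR d) (F := RR q)).contMDiff.contMDiffAt.comp z
            (hcz z hz))
        (hcw _ (c.map_source hz)) (0, der (RR (d + q)) (RR q) a z v)
      rw [c.left_inv hz, h8] at h9
      rw [← h9, der_congr (f := (fun w => (c w).2) ∘ c.symm) (g := Prod.snd)
        ((c.eventually_right_inverse (c.map_source hz)).mono
        fun w hw => congrArg Prod.snd hw), der_eq_fderiv, fderiv_snd]
      rfl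
    have hta : ∀ v, F.IsTangent z (v - D (c z) (0, der (RR (d + q)) (RR q) a z v) :
        RR (d + q)) := fun v => by
      rw [(hca z hz).2.isTangent_iff, map_sub, hd, sub_self]
    exact g.form_congr (hta v) (hta w)
  have hmem : ∀ᶠ y in 𝓝 (a x), ((c x).1, y) ∈ c.target :=
    (Continuous.prodMk_right (c x).1).continuousAt.eventually (c.open_target.mem_nhds (by
      rw [← (hca x hx).1]; exact c.map_source hx))
  -- `G` is the metric restricted to the transversal through `x` on which the leaf coordinate is
  -- that of `x`.
  refine ⟨fun y => (g.form (c.symm ((c x).1, y))).bilinearComp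
      ((D ((c x).1, y)).comp (ContinuousLinearMap.inr ℝ (RR d) (RR q)))
      ((D ((c x).1, y)).comp (ContinuousLinearMap.inr ℝ (RR d) (RR q))), ?_, ?_⟩
  · refine contDiffAt_of_apply_apply ?_
    filter_upwards [hmem.eventually_nhds] with y hy u v
    have h10 : ContDiffAt ℝ 2 (fun y => H u v ((c x).1, y)) y :=
      ContDiffAt.comp (g := H u v) y ((hH u v _ hy.self_of_nhds).1.of_le ENat.LEInfty.out)
        (contDiffAt_const.prodMk contDiffAt_id)
    refine h10.congr_of_eventuallyEq ?_
    filter_upwards [hy] with y' hy'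
    change _ = g.form _ (D (c (c.symm _)) _) (D (c (c.symm _)) _)
    rw [c.right_inv hy']
    rfl
  · filter_upwards [c.open_source.mem_nhds hx, ha.continuousAt.eventually hmem] with z hz hz' v w
    have h11 : ((c z).1, a z) = c z := Prod.ext rfl (hca z hz).1.symm
    have h12 := hconst (der (RR (d + q)) (RR q) a z v) (der (RR (d + q)) (RR q) a z w) (c z).1
      (c x).1 (a z) (by rw [h11]; exact c.map_source hz) hz'
    rw [hform z hz]
    refine Eq.trans ?_ (h12.trans ?_)
    · rw [h11]
      change h _ _ z = h _ _ (c.symm (c z))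
      rw [c.left_inv hz]
    · change g.form _ (D (c (c.symm _)) _) (D (c (c.symm _)) _) = _
      rw [c.right_inv hz']
      rfl

end LocalForm

/-! ### Covers -/

section Cover

variable {d q : ℕ} {X X' : Type u} [TopologicalSpace X] [ChartedSpace (RR (d + q)) X]
  [TopologicalSpace X'] [ChartedSpace (RR (d + q)) X'] {F : Foliation d q X} {p : X' → X}

/-- The germ at `p z` of the inverse of `p` with value `z`. -/
def IsSmoothCover.germInv {n : ℕ} {X' X : Type u} [TopologicalSpace X] [ChartedSpace (RR n) X]
    [TopologicalSpace X'] [ChartedSpace (RR n) X'] {p : X' → X} (hp : IsSmoothCover n p) (z : X') :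
    X → X' :=
  (hp.isLocalDiffeomorph z).localInverse

variable (hp : IsSmoothCover (d + q) p) (z : X')

lemma IsSmoothCover.continuous (hp : IsSmoothCover (d + q) p) : Continuous p :=
  hp.isLocalDiffeomorph.contMDiff.continuous

lemma IsSmoothCover.germInv_apply : hp.germInv z (p z) = z :=
  (hp.isLocalDiffeomorph z).localInverse_eventuallyEq_left.self_of_nhds

lemma IsSmoothCover.eventually_germInv_apply : ∀ᶠ w in 𝓝 z, hp.germInv z (p w) = w :=
  (hp.isLocalDiffeomorph z).localInverse_eventuallyEq_left

lemma IsSmoothCover.eventually_apply_germInv : ∀ᶠ x in 𝓝 (p z), p (hp.germInv z x) = x :=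
  (hp.isLocalDiffeomorph z).localInverse_eventuallyEq_right

lemma IsSmoothCover.contMDiffAt_germInv :
    ContMDiffAt 𝓘(ℝ, RR (d + q)) 𝓘(ℝ, RR (d + q)) ∞ (hp.germInv z) (p z) :=
  (hp.isLocalDiffeomorph z).localInverse_contMDiffAt

lemma IsSmoothCover.tendsto_germInv : Tendsto (hp.germInv z) (𝓝 (p z)) (𝓝 z) := by
  have h := (hp.contMDiffAt_germInv z).continuousAt
  unfold ContinuousAt at h
  rwa [hp.germInv_apply] at h

variable {z} in
lemma IsSmoothCover.eventually_germInv_eq {s : X → X'} (hs : Tendsto s (𝓝 (p z)) (𝓝 z))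
    (h : ∀ᶠ x in 𝓝 (p z), p (s x) = x) : s =ᶠ[𝓝 (p z)] hp.germInv z := by
  filter_upwards [hs.eventually (hp.eventually_germInv_apply z), h] with x h1 h2
  rw [← h1, h2]

/-- A local inverse of `p` at `z` also takes the value `w` at `p w` for `w` near `z`, and local
inverses are determined by one value. Hence these germs vary in a locally constant way along paths
in the cover. -/
lemma IsSmoothCover.eventually_germInv_eq_germInv :
    ∀ᶠ w in 𝓝 z, hp.germInv z =ᶠ[𝓝 (p w)] hp.germInv w := by
  have h1 : ∀ᶠ x in 𝓝 (p z), ContinuousAt (hp.germInv z) x := by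
    have h := (hp.isLocalDiffeomorph z).localInverse_isLocalDiffeomorphAt
    filter_upwards [h.eventually_isLocalDiffeomorphAt] with x hx
    exact hx.contMDiffAt.continuousAt
  filter_upwards [hp.eventually_germInv_apply z, hp.continuous.continuousAt.eventually h1,
    hp.continuous.continuousAt.eventually (hp.eventually_apply_germInv z).eventually_nhds]
    with w h2 h3 h4
  refine hp.eventually_germInv_eq ?_ h4
  unfold ContinuousAt at h3
  rwa [h2] at h3

variable {z}

lemma Foliation.IsTransverseAt.comp_germInv {b : X' → RR q}
    (hb : (F.comap p hp.isLocalDiffeomorph).IsTransverseAt b z) :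
    F.IsTransverseAt (b ∘ hp.germInv z) (p z) := by
  obtain ⟨e, ⟨c, hc, h, -⟩, hz, k, hk, hbk⟩ := hb
  refine ⟨c, hc, (h z hz).1, k, by rw [← (h z hz).2]; exact hk, ?_⟩
  filter_upwards [(hp.tendsto_germInv z).eventually hbk, hp.eventually_apply_germInv z,
    (hp.tendsto_germInv z).eventually (e.open_source.mem_nhds hz)] with x h1 h2 h3
  rw [Function.comp_apply, h1, (h _ h3).2, h2]

lemma Foliation.IsTransverseAt.comp_cover {a : X → RR q} (ha : F.IsTransverseAt a (p z)) :
    (F.comap p hp.isLocalDiffeomorph).IsTransverseAt (a ∘ p) z := by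
  obtain ⟨c, hc, hz, k, hk, hak⟩ := ha
  obtain ⟨e, hze, h, hsm⟩ := F.exists_lift_chart hp.isLocalDiffeomorph z hc hz
  refine ⟨e, ⟨c, hc, h, hsm⟩, hze, k, by rw [(h z hze).2]; exact hk, ?_⟩
  filter_upwards [hp.continuous.continuousAt.eventually hak, e.open_source.mem_nhds hze]
    with w h1 h2
  rw [Function.comp_apply, h1, (h w h2).2]

end Cover

/-! ### Rigidity of the action on the leaf space -/

section Rigidity

variable {d q : ℕ} {X X' M : Type u}
  [TopologicalSpace X] [ChartedSpace (RR (d + q)) X] [IsManifold 𝓘(ℝ, RR (d + q)) ∞ X] [T2Space X]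
  [TopologicalSpace X'] [ChartedSpace (RR (d + q)) X']
  [TopologicalSpace M] [ChartedSpace (RR q) M]
  {F : Foliation d q X} (g : TransverseMetric F) {p : X' → X} {hp : IsSmoothCover (d + q) p}
  {f : X' → M} (hf : IsDevelopingMap F p hp f)

/-- The pullback of the metric along `p`. -/
def TransverseMetric.lift (p : X' → X) (z : X') (v w : RR (d + q)) : ℝ :=
  g.form (p z) (der (RR (d + q)) (RR (d + q)) p z v) (der (RR (d + q)) (RR (d + q)) p z w)

include hf

omit [IsManifold 𝓘(ℝ, RR (d + q)) ∞ X] [T2Space X] in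
lemma IsDevelopingMap.surjective_der (z : X') :
    Function.Surjective (der (RR (d + q)) (RR q) f z) := hf.submersion z

omit hf [IsManifold 𝓘(ℝ, RR (d + q)) ∞ X] [T2Space X] [TopologicalSpace M]
  [ChartedSpace (RR q) M] in
lemma IsSmoothCover.comp_germInv_comp (hp : IsSmoothCover (d + q) p) {T : Type*} (b : X' → T)
    (z : X') : (b ∘ hp.germInv z) ∘ p =ᶠ[𝓝 z] b := by
  filter_upwards [hp.eventually_germInv_apply z] with w hw
  simp only [Function.comp_apply, hw]

omit [IsManifold 𝓘(ℝ, RR (d + q)) ∞ X] [T2Space X] in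
lemma IsDevelopingMap.der_comp_germInv {z : X'} {κ : M → RR q}
    (hκ : IsLocalDiffeomorphAt 𝓘(ℝ, RR q) 𝓘(ℝ, RR q) ∞ κ (f z)) :
    ∀ᶠ w in 𝓝 z, ∀ v, der (RR (d + q)) (RR q) (κ ∘ f ∘ hp.germInv z) (p w)
      (der (RR (d + q)) (RR (d + q)) p w v) = der (RR (d + q)) (RR q) (κ ∘ f) w v := by
  filter_upwards [(hp.comp_germInv_comp (κ ∘ f) z).eventually_nhds,
    hp.continuous.continuousAt.eventually ((hf.isTransverseAt hκ).comp_germInv hp).eventually]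
    with w h1 h2 v
  rw [← der_congr h1]
  exact (der_comp_apply h2.contMDiffAt (hp.isLocalDiffeomorph w).contMDiffAt v).symm

lemma TransverseMetric.exists_eventually_lift_eq {z : X'} {κ : M → RR q}
    (hκ : IsLocalDiffeomorphAt 𝓘(ℝ, RR q) 𝓘(ℝ, RR q) ∞ κ (f z)) :
    ∃ G : RR q → RR q →L[ℝ] RR q →L[ℝ] ℝ, ContDiffAt ℝ 2 G (κ (f z)) ∧
      ∀ᶠ w in 𝓝 z, ∀ u v, g.lift p w u v = G (κ (f w))
        (der (RR (d + q)) (RR q) (κ ∘ f) w u) (der (RR (d + q)) (RR q) (κ ∘ f) w v) := by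
  obtain ⟨G, hG, h⟩ := g.exists_eventually_form_eq ((hf.isTransverseAt hκ).comp_germInv hp)
  refine ⟨G, ?_, ?_⟩
  · rwa [Function.comp_apply, hp.germInv_apply] at hG
  · filter_upwards [hp.continuous.continuousAt.eventually h, hf.der_comp_germInv hκ,
      hp.comp_germInv_comp (κ ∘ f) z] with w h1 h2 h3 u v
    refine (h1 _ _).trans ?_
    have h4 := h2 u
    have h5 := h2 v
    rw [← Function.comp_assoc] at h4 h5
    rw [h4, h5, ← Function.comp_apply (f := κ) (g := f), ← h3]
    rfl

section Manifold

variable [IsManifold 𝓘(ℝ, RR q) ∞ M]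

omit [IsManifold 𝓘(ℝ, RR (d + q)) ∞ X] [T2Space X] [IsManifold 𝓘(ℝ, RR q) ∞ M] in
lemma IsDevelopingMap.der_comp_eq_iff {z w : X'} {κ : M → RR q}
    (hκ : IsLocalDiffeomorphAt 𝓘(ℝ, RR q) 𝓘(ℝ, RR q) ∞ κ (f z)) (h : f w = f z)
    (u v : RR (d + q)) :
    der (RR (d + q)) (RR q) (κ ∘ f) z u = der (RR (d + q)) (RR q) (κ ∘ f) w v ↔
      der (RR (d + q)) (RR q) f z u = der (RR (d + q)) (RR q) f w v := by
  obtain ⟨L, hL⟩ := exists_equiv_eq_der hκ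
  rw [der_comp_apply hκ.contMDiffAt hf.smooth.contMDiffAt,
    der_comp_apply (by rw [h]; exact hκ.contMDiffAt) hf.smooth.contMDiffAt, h, ← hL]
  exact L.injective.eq_iff

omit [IsManifold 𝓘(ℝ, RR (d + q)) ∞ X] [T2Space X] in
lemma IsDevelopingMap.isTangent_iff (z : X') (v : RR (d + q)) :
    F.IsTangent (p z) (der (RR (d + q)) (RR (d + q)) p z v) ↔
      der (RR (d + q)) (RR q) f z v = 0 := by
  have hκ := isLocalDiffeomorphAt_chartAt (q := q) (f z)
  have h1 := (hf.der_comp_germInv hκ).self_of_nhds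
  refine ((hf.isTransverseAt hκ).comp_germInv hp).isTangent_iff _ |>.trans ?_
  have h2 := hf.der_comp_eq_iff hκ rfl v 0
  rw [map_zero, map_zero] at h2
  rw [← h2, ← h1]
  rfl

omit [IsManifold 𝓘(ℝ, RR (d + q)) ∞ X] [T2Space X] in
-- The fibres being leaves speaks only of the endpoints of a path. In between, a chart of `M`
-- composed with `f` is a transverse coordinate, hence locally constant along the path.
lemma IsDevelopingMap.map_path_eq {x y : X'} {γ : Path x y}
    (hγ : (F.comap p hp.isLocalDiffeomorph).IsLeafwise γ) (t : unitInterval) :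
    f (γ t) = f x := by
  have key : IsLocallyConstant fun t => f (γ t) := by
    rw [IsLocallyConstant.iff_eventually_eq]
    intro t
    filter_upwards [hγ.eventually_eq t (hf.isTransverseAt (isLocalDiffeomorphAt_chartAt _)),
      (hf.smooth.continuous.comp γ.continuous).continuousAt.eventually
        ((chartAt (RR q) (f (γ t))).open_source.mem_nhds (mem_chart_source _ _))] with τ h1 h2
    exact (chartAt (RR q) (f (γ t))).injOn h2 (mem_chart_source _ _) h1
  rw [key.apply_eq_of_preconnectedSpace t 0, γ.source]

/-- The pullback of the metric is constant along leaves. -/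
lemma TransverseMetric.lift_eq_of_map_eq {z z' : X'} (h : f z' = f z) {v w v' w' : RR (d + q)}
    (hv : der (RR (d + q)) (RR q) f z v = der (RR (d + q)) (RR q) f z' v')
    (hw : der (RR (d + q)) (RR q) f z w = der (RR (d + q)) (RR q) f z' w') :
    g.lift p z v w = g.lift p z' v' w' := by
  -- `P z z'` says that the forms at `z` and `z'` induce the same form on the tangent space of `M`.
  -- It is transitive because `f` is a submersion, and it holds for nearby points of a fibre by the
  -- local form of the metric. It therefore propagates along a leafwise path.
  let P : X' → X' → Prop := fun z z' => ∀ v w v' w' : RR (d + q),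
    der (RR (d + q)) (RR q) f z v = der (RR (d + q)) (RR q) f z' v' →
    der (RR (d + q)) (RR q) f z w = der (RR (d + q)) (RR q) f z' w' →
    g.lift p z v w = g.lift p z' v' w'
  have hsymm : ∀ {z z'}, P z z' → P z' z :=
    fun h v w v' w' hv hw => (h _ _ _ _ hv.symm hw.symm).symm
  have htrans : ∀ {z z' z''}, P z z' → P z' z'' → P z z'' := by
    intro z z' z'' h h' v w v' w' hv hw
    obtain ⟨u, hu⟩ := hf.surjective_der z' (der (RR (d + q)) (RR q) f z v)
    obtain ⟨t, ht⟩ := hf.surjective_der z' (der (RR (d + q)) (RR q) f z w)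
    exact (h _ _ _ _ hu.symm ht.symm).trans (h' _ _ _ _ (hu.trans hv) (ht.trans hw))
  have hloc : ∀ z, ∀ᶠ z' in 𝓝 z, f z' = f z → P z z' := fun z => by
    have hκ := isLocalDiffeomorphAt_chartAt (q := q) (f z)
    obtain ⟨G, -, hG⟩ := g.exists_eventually_lift_eq hf hκ
    filter_upwards [hG] with z' hz' hfz v w v' w' hv hw
    rw [hG.self_of_nhds, hz', (hf.der_comp_eq_iff hκ hfz _ _).mpr hv,
      (hf.der_comp_eq_iff hκ hfz _ _).mpr hw, hfz]
  have hmem : z' ∈ (F.comap p hp.isLocalDiffeomorph).leaf z := by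
    rw [← hf.fiber_eq_leaf]; exact h
  obtain ⟨⟨γ, hγ⟩⟩ := hmem
  have key : IsLocallyConstant fun t => P z (γ t) := by
    rw [IsLocallyConstant.iff_eventually_eq]
    intro t
    filter_upwards [γ.continuous.continuousAt.eventually (hloc (γ t))] with τ h2
    have h1 : f (γ τ) = f (γ t) := (hf.map_path_eq hγ τ).trans (hf.map_path_eq hγ t).symm
    exact propext ⟨fun h => htrans h (hsymm (h2 h1)), fun h => htrans h (h2 h1)⟩
  have h01 := key.apply_eq_of_preconnectedSpace 0 1
  simp only [γ.source, γ.target] at h01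
  have h00 : P z z := by
    intro v w v' w' hv hw
    obtain ⟨G, -, hG⟩ := g.exists_eventually_lift_eq hf
      (isLocalDiffeomorphAt_chartAt (q := q) (f z))
    rw [hG.self_of_nhds, hG.self_of_nhds,
      (hf.der_comp_eq_iff (isLocalDiffeomorphAt_chartAt (q := q) (f z)) rfl _ _).mpr hv,
      (hf.der_comp_eq_iff (isLocalDiffeomorphAt_chartAt (q := q) (f z)) rfl _ _).mpr hw]
  exact (h01 ▸ h00 : P z z') v w v' w' hv hw

/-- The metric induced on the leaf space, in a chart. -/
lemma TransverseMetric.exists_metric (m : M) : ∃ G : RR q → RR q →L[ℝ] RR q →L[ℝ] ℝ,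
    ContDiffAt ℝ 2 G (chartAt (RR q) m m) ∧ ∀ᶠ m' in 𝓝 m, ∀ z, f z = m' → ∀ v w,
      g.lift p z v w = G (chartAt (RR q) m m')
        (der (RR (d + q)) (RR q) (chartAt (RR q) m ∘ f) z v)
        (der (RR (d + q)) (RR q) (chartAt (RR q) m ∘ f) z w) := by
  obtain ⟨z₀, rfl⟩ := hf.surjective m
  have hκ := isLocalDiffeomorphAt_chartAt (q := q) (f z₀)
  obtain ⟨G, hG, hGl⟩ := g.exists_eventually_lift_eq hf hκ
  obtain ⟨S, hS0, hS, hSs⟩ := hf.exists_section z₀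
  have hSc := hSs.self_of_nhds.continuousAt
  unfold ContinuousAt at hSc
  rw [hS0] at hSc
  refine ⟨G, hG, ?_⟩
  -- The local formula is known only near `z₀`. A point `z` anywhere in a nearby fibre is compared
  -- with the point of the section `S` in the same fibre, where the formula holds.
  filter_upwards [hS, hSc.eventually hGl, hκ.eventually_isLocalDiffeomorphAt]
    with m hm h1 h2 z hz v w
  subst hz
  obtain ⟨v', hv⟩ := hf.surjective_der (S (f z)) (der (RR (d + q)) (RR q) f z v)
  obtain ⟨w', hw⟩ := hf.surjective_der (S (f z)) (der (RR (d + q)) (RR q) f z w)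
  rw [g.lift_eq_of_map_eq hf hm hv.symm hw.symm, h1, hm,
    (hf.der_comp_eq_iff h2 hm _ _).mpr hv.symm, (hf.der_comp_eq_iff h2 hm _ _).mpr hw.symm]

omit hf [T2Space X] in
-- Deck transformations are isometries of the pulled back form because `p ∘ γ = p`.
lemma TransverseMetric.lift_deckGroup {γ : X' ≃ₜ X'} (hp : IsSmoothCover (d + q) p)
    (hγ : γ ∈ deckGroup p) (z : X') (v w : RR (d + q)) :
    g.lift p (γ z) (der (RR (d + q)) (RR (d + q)) γ z v) (der (RR (d + q)) (RR (d + q)) γ z w) =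
      g.lift p z v w := by
  have h1 : ∀ v, der (RR (d + q)) (RR (d + q)) p (γ z) (der (RR (d + q)) (RR (d + q)) γ z v) =
      der (RR (d + q)) (RR (d + q)) p z v := fun v => by
    rw [← der_comp_apply (hp.isLocalDiffeomorph _).contMDiffAt
      (contMDiff_deckGroup (hp := hp) hγ).contMDiffAt,
      show p ∘ γ = p from funext hγ]
  unfold TransverseMetric.lift
  rw [h1, h1, show p (γ z) = p z from hγ z]

include g in
/-- An element of `Γ_eff` acting as the identity to first order at a point acts as the identity
near that point. -/
lemma TransverseMetric.eventually_smul_eq (γ : EffDeckGroup hf) {m : M} (hm : γ • m = m)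
    (hder : fderiv ℝ (fun y => chartAt (RR q) m (γ • (chartAt (RR q) m).symm y))
      (chartAt (RR q) m m) = ContinuousLinearMap.id ℝ (RR q)) :
    ∀ᶠ m' in 𝓝 m, γ • m' = m' := by
  let κ := chartAt (RR q) m
  have hms : m ∈ κ.source := mem_chart_source (RR q) m
  have hκ : IsLocalDiffeomorphAt 𝓘(ℝ, RR q) 𝓘(ℝ, RR q) ∞ κ m := isLocalDiffeomorphAt_chartAt m
  let φ : RR q → RR q := fun y => κ (γ • κ.symm y)
  have hγs := contMDiff_effDeckGroup_smul hf γ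
  have hκm : κ.symm (κ m) = m := κ.left_inv hms
  have hγt : Tendsto (fun m' => γ • m') (𝓝 m) (𝓝 m) := by
    have := hγs.continuous.tendsto m
    rwa [hm] at this
  have hκt : Tendsto κ.symm (𝓝 (κ m)) (𝓝 m) := by
    have := κ.symm.continuousAt (x := κ m) (κ.map_source hms)
    unfold ContinuousAt at this
    rwa [hκm] at this
  have hφs : ∀ᶠ y in 𝓝 (κ m), ContDiffAt ℝ ∞ φ y := by
    filter_upwards [κ.open_target.mem_nhds (κ.map_source hms),
      (hγt.comp hκt).eventually hκ.eventually_isLocalDiffeomorphAt] with y h1 h2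
    rw [← contMDiffAt_iff_contDiffAt]
    have h3 : ContMDiffAt 𝓘(ℝ, RR q) 𝓘(ℝ, RR q) ∞ κ.symm y :=
      (contMDiffOn_chart_symm (I := 𝓘(ℝ, RR q)) (n := ∞) (x := m)).contMDiffAt
        (κ.open_target.mem_nhds h1)
    exact ContMDiffAt.comp (g := κ) y h2.contMDiffAt
      (hγs.contMDiffAt.comp (f := κ.symm) y h3)
  obtain ⟨G, hG, hGl⟩ := g.exists_metric hf m
  have hsurj : ∀ᶠ m' in 𝓝 m, ∀ z, f z = m' →
      Function.Surjective (der (RR (d + q)) (RR q) (κ ∘ f) z) := by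
    filter_upwards [hκ.eventually_isLocalDiffeomorphAt] with m' hm' z hz
    subst hz
    obtain ⟨L, hL⟩ := exists_equiv_eq_der hm'
    rw [der_comp hm'.contMDiffAt hf.smooth.contMDiffAt, ← hL]
    exact L.surjective.comp (hf.surjective_der z)
  -- In the chart `κ`, the action `φ` of `γ` is an isometry of the induced metric `G`, with the
  -- 1-jet of the identity. The conditions on `G` are checked on vectors lifted to the cover, where
  -- positivity holds because a lift of a nonzero vector is not tangent to the leaf.
  have hiso : ∀ᶠ y in 𝓝 (κ m), φ y = y := by
    refine eventually_eq_id_of_isometry (G := G) hG (hφs.self_of_nhds.of_le ENat.LEInfty.out)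
      ?_ ?_ ?_ hder ?_
    · intro u hu
      obtain ⟨z, hz⟩ := hf.surjective m
      obtain ⟨v, rfl⟩ := hsurj.self_of_nhds z hz u
      have h1 := hGl.self_of_nhds z hz v v
      refine h1 ▸ g.pos _ _ fun h2 => hu ?_
      have h3 := (hf.isTangent_iff z v).mp h2
      rw [← map_zero (der (RR (d + q)) (RR q) (κ ∘ f) z)]
      refine (hf.der_comp_eq_iff (by rw [hz]; exact hκ) rfl _ _).mpr ?_
      rw [h3, map_zero]
    · filter_upwards [hκt.eventually hGl, hκt.eventually hsurj,
        κ.open_target.mem_nhds (κ.map_source hms)] with y h1 h2 h3 u u'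
      obtain ⟨z, hz⟩ := hf.surjective (κ.symm y)
      obtain ⟨v, rfl⟩ := h2 z hz u
      obtain ⟨v', rfl⟩ := h2 z hz u'
      have h4 := h1 z hz v v'
      have h5 := h1 z hz v' v
      rw [κ.right_inv h3] at h4 h5
      exact h4.symm.trans ((g.form_symm _ _ _).trans h5)
    · change κ (γ • κ.symm (κ m)) = κ m
      rw [hκm, hm]
    · filter_upwards [hκt.eventually hGl, hκt.eventually hsurj, (hγt.comp hκt).eventually hGl,
        κ.open_target.mem_nhds (κ.map_source hms), hφs,
        hκt.eventually (κ.open_source.eventually_mem hms),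
        hκt.eventually hκ.eventually_isLocalDiffeomorphAt,
        (hγt.comp hκt).eventually hκ.eventually_isLocalDiffeomorphAt]
        with y h1 h2 h3 h4 h5 h6 h7 h11 u u'
      obtain ⟨γ, rfl⟩ := QuotientGroup.mk_surjective γ
      obtain ⟨z, hz⟩ := hf.surjective (κ.symm y)
      obtain ⟨v, rfl⟩ := h2 z hz u
      obtain ⟨v', rfl⟩ := h2 z hz u'
      have hκf : κ (f z) = y := by rw [hz, κ.right_inv h4]
      have e1 := h1 z hz v v'
      have hfγ : f (γ.1 z) = (show EffDeckGroup hf from QuotientGroup.mk γ) • κ.symm y := by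
        rw [← effDeckGroup_smul hf γ z, hz]
      have e2 := h3 (γ.1 z) hfγ (der (RR (d + q)) (RR (d + q)) γ.1 z v)
        (der (RR (d + q)) (RR (d + q)) γ.1 z v')
      rw [g.lift_deckGroup hp γ.2, e1] at e2
      -- Differentiate the equivariance of `f`, which in the chart reads `(κ ∘ f) ∘ γ = φ ∘ (κ ∘
      -- f)`.
      have hγd : ∀ v, der (RR (d + q)) (RR q) (κ ∘ f) (γ.1 z)
          (der (RR (d + q)) (RR (d + q)) γ.1 z v) =
          fderiv ℝ φ y (der (RR (d + q)) (RR q) (κ ∘ f) z v) := fun v => by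
        have h8 : ContMDiffAt 𝓘(ℝ, RR (d + q)) 𝓘(ℝ, RR q) ∞ (κ ∘ f) z :=
          ContMDiffAt.comp (g := κ) z (by rw [hz]; exact h7.contMDiffAt) hf.smooth.contMDiffAt
        have h9 : (κ ∘ f) ∘ γ.1 =ᶠ[𝓝 z] φ ∘ (κ ∘ f) := by
          filter_upwards [hf.smooth.continuous.continuousAt.eventually
            (κ.open_source.mem_nhds (x := f z) (by rw [hz]; exact h6))] with z' hz'
          change κ (f (γ.1 z')) = κ (_ • κ.symm (κ (f z')))
          rw [κ.left_inv hz', ← effDeckGroup_smul hf γ z']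
        rw [← der_eq_fderiv, ← hκf]
        have h10 := der_comp_apply (g := φ) (f := κ ∘ f) (x := z)
          (by rw [Function.comp_apply, hκf]; exact contMDiffAt_iff_contDiffAt.mpr h5) h8 v
        refine Eq.trans ?_ h10
        rw [← der_congr h9]
        refine (der_comp_apply (g := κ ∘ f) (f := γ.1) ?_
          (contMDiff_deckGroup (hp := hp) γ.2).contMDiffAt v).symm
        exact ContMDiffAt.comp (g := κ) _ (by rw [hfγ]; exact h11.contMDiffAt) hf.smooth.contMDiffAt
      rw [κ.right_inv h4] at e2
      have e3 := hγd v
      have e4 := hγd v'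
      refine Eq.trans ?_ e2.symm
      exact (congrArg₂ (fun s t => G (φ y) s t) e3 e4).symm
  filter_upwards [hκ.contMDiffAt.continuousAt.eventually hiso, κ.open_source.mem_nhds hms,
    hγt.eventually (κ.open_source.mem_nhds hms)] with m' h1 h2 h3
  refine κ.injOn h3 h2 ?_
  have h1 : κ (γ • κ.symm (κ m')) = κ m' := h1
  rwa [κ.left_inv h2] at h1

include g in
/-- An element of `Γ_eff` which acts trivially near one point is trivial. -/
theorem TransverseMetric.eq_one_of_eventually [T2Space M] [ConnectedSpace X']
    {γ : EffDeckGroup hf} {m : M} (h : ∀ᶠ m' in 𝓝 m, γ • m' = m') : γ = 1 := by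
  have hγs := contMDiff_effDeckGroup_smul hf γ
  let s : Set M := {m | ∀ᶠ m' in 𝓝 m, γ • m' = m'}
  have hso : IsOpen s := by
    rw [isOpen_iff_mem_nhds]
    exact fun m hm => hm.eventually_nhds
  have hsc : IsClosed s := by
    -- At a limit of points with trivial germ, `γ` fixes the point since `M` is Hausdorff, and its
    -- derivative is the identity by continuity. Rigidity of isometries then makes the germ trivial
    -- there too.
    refine isClosed_of_closure_subset fun m hm => ?_
    have hfix : γ • m = m := by
      have hcl : IsClosed {m : M | γ • m = m} := isClosed_eq hγs.continuous continuous_id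
      exact hcl.closure_subset_iff.mpr (fun m hm => Eventually.self_of_nhds hm) hm
    refine g.eventually_smul_eq hf γ hfix ?_
    let κ := chartAt (RR q) m
    have hms : m ∈ κ.source := mem_chart_source (RR q) m
    let φ : RR q → RR q := fun y => κ (γ • κ.symm y)
    have hκ : IsLocalDiffeomorphAt 𝓘(ℝ, RR q) 𝓘(ℝ, RR q) ∞ κ m := isLocalDiffeomorphAt_chartAt m
    have hφ : ContDiffAt ℝ ∞ φ (κ m) := by
      have h1 : ContMDiffAt 𝓘(ℝ, RR q) 𝓘(ℝ, RR q) ∞ κ.symm (κ m) :=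
        (contMDiffOn_chart_symm (I := 𝓘(ℝ, RR q)) (n := ∞) (x := m)).contMDiffAt
          (κ.open_target.mem_nhds (κ.map_source hms))
      rw [← contMDiffAt_iff_contDiffAt]
      refine ContMDiffAt.comp (g := κ) (f := fun y => γ • κ.symm y) (κ m) ?_
        (hγs.contMDiffAt.comp (f := κ.symm) (κ m) h1)
      rw [κ.left_inv hms, hfix]
      exact hκ.contMDiffAt
    have hcont : ContinuousAt (fun m' => fderiv ℝ φ (κ m')) m :=
      ContinuousAt.comp (hφ.fderiv_right (m := 0) (by simp)).continuousAt
        hκ.contMDiffAt.continuousAt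
    have hfreq : ∃ᶠ m' in 𝓝 m, fderiv ℝ φ (κ m') = ContinuousLinearMap.id ℝ (RR q) := by
      refine ((mem_closure_iff_frequently.mp hm).and_eventually
        (κ.open_source.mem_nhds hms)).mono ?_
      rintro m' ⟨h1, h2⟩
      have h3 : φ =ᶠ[𝓝 (κ m')] id := by
        have h4 : Tendsto κ.symm (𝓝 (κ m')) (𝓝 m') := by
          have := κ.symm.continuousAt (x := κ m') (κ.map_source h2)
          unfold ContinuousAt at this
          rwa [κ.left_inv h2] at this
        filter_upwards [h4.eventually h1, κ.open_target.mem_nhds (κ.map_source h2)] with y h5 h6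
        change κ (γ • κ.symm y) = y
        rw [h5, κ.right_inv h6]
      rw [h3.fderiv_eq, fderiv_id]
    by_contra hne
    exact hfreq ((hcont.eventually_ne hne).mono fun _ h => h)
  have : ConnectedSpace M := hf.surjective.connectedSpace hf.smooth.continuous
  have huniv : s = univ := IsClopen.eq_univ ⟨hsc, hso⟩ ⟨m, h⟩
  have hfix : ∀ m : M, γ • m = m := fun m => by
    have hm : ∀ᶠ m' in 𝓝 m, γ • m' = m' := (huniv ▸ mem_univ m : m ∈ s)
    exact hm.self_of_nhds
  -- An element acting trivially on all of `M` is trivial because `Γ_eff` is the quotient by the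
  -- kernel of the action.
  have hinj : Function.Injective (QuotientGroup.kerLift (deckHom hf)) :=
    QuotientGroup.kerLift_injective (deckHom hf)
  refine hinj (Equiv.ext fun m => ?_)
  refine (hfix m).trans ?_
  have h1 : QuotientGroup.kerLift (deckHom hf) (1 : EffDeckGroup hf) = 1 := map_one _
  exact (DFunLike.congr_fun h1 m).symm

end Manifold

end Rigidity

/-! ### The pullback of an action groupoid -/

section Pullback

variable (Γ : Type u) {Y M : Type u} [Group Γ] [MulAction Γ M] (f : Y → M)

/-- The arrows of the pullback along `f : Y → M` of the groupoid `Γ ⋉ M`: triples `(x, y, γ)` with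
`γ • f x = f y`. -/
@[ext]
structure PullbackArr : Type u where
  src : Y
  tgt : Y
  elt : Γ
  smul_eq : elt • f src = f tgt

instance [TopologicalSpace Y] : TopologicalSpace (PullbackArr Γ f) :=
  letI : TopologicalSpace Γ := ⊥
  .induced (fun r => ((r.src, r.tgt), r.elt)) inferInstance

/-- The pullback along `f : Y → M` of the groupoid `Γ ⋉ M`. -/
def pullbackGroupoid : Gpd Y (PullbackArr Γ f) where
  src := PullbackArr.src
  tgt := PullbackArr.tgt
  one x := ⟨x, x, 1, one_smul Γ (f x)⟩
  inv r := ⟨r.tgt, r.src, r.elt⁻¹, inv_smul_eq_iff.mpr r.smul_eq.symm⟩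
  mul r s w := ⟨s.src, r.tgt, r.elt * s.elt, by rw [mul_smul, s.smul_eq, ← w, r.smul_eq]⟩
  src_one _ := rfl
  tgt_one _ := rfl
  src_inv _ := rfl
  tgt_inv _ := rfl
  src_mul _ _ _ := rfl
  tgt_mul _ _ _ := rfl
  one_mul r := PullbackArr.ext rfl rfl (one_mul r.elt)
  mul_one r := PullbackArr.ext rfl rfl (mul_one r.elt)
  mul_assoc r s t _ _ := PullbackArr.ext rfl rfl (mul_assoc r.elt s.elt t.elt)
  inv_mul r := PullbackArr.ext rfl rfl (inv_mul_cancel r.elt)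
  mul_inv r := PullbackArr.ext rfl rfl (mul_inv_cancel r.elt)

variable {Γ f} [TopologicalSpace Y]

namespace PullbackArr

lemma tendsto_iff {r : PullbackArr Γ f} {ι : Type*} {l : Filter ι} {φ : ι → PullbackArr Γ f} :
    Tendsto φ l (𝓝 r) ↔ Tendsto (fun i => (φ i).src) l (𝓝 r.src) ∧
      Tendsto (fun i => (φ i).tgt) l (𝓝 r.tgt) ∧ ∀ᶠ i in l, (φ i).elt = r.elt := by
  let : TopologicalSpace Γ := ⊥
  have : DiscreteTopology Γ := ⟨rfl⟩
  have h : Topology.IsInducing (fun r : PullbackArr Γ f => ((r.src, r.tgt), r.elt)) := ⟨rfl⟩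
  rw [h.tendsto_nhds_iff, nhds_prod_eq, nhds_prod_eq, tendsto_prod_iff', tendsto_prod_iff',
    nhds_discrete Γ, tendsto_pure, and_assoc]
  rfl

lemma continuous_src : Continuous fun r : PullbackArr Γ f => r.src :=
  continuous_iff_continuousAt.mpr fun _ => (tendsto_iff.mp tendsto_id).1

lemma continuous_tgt : Continuous fun r : PullbackArr Γ f => r.tgt :=
  continuous_iff_continuousAt.mpr fun _ => (tendsto_iff.mp tendsto_id).2.1

lemma eventually_elt_eq (r : PullbackArr Γ f) : ∀ᶠ s in 𝓝 r, s.elt = r.elt :=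
  (tendsto_iff.mp tendsto_id).2.2

instance [T2Space Y] : T2Space (PullbackArr Γ f) := by
  let : TopologicalSpace Γ := ⊥
  have : DiscreteTopology Γ := ⟨rfl⟩
  refine T2Space.of_injective_continuous (f := fun r : PullbackArr Γ f => ((r.src, r.tgt), r.elt))
    (fun r s h => ?_) continuous_induced_dom
  simp only [Prod.mk.injEq] at h
  exact PullbackArr.ext h.1.1 h.1.2 h.2

end PullbackArr

lemma continuous_pullbackGroupoid_one : Continuous (pullbackGroupoid Γ f).one :=
  continuous_iff_continuousAt.mpr fun _ => PullbackArr.tendsto_iff.mpr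
    ⟨tendsto_id, tendsto_id, Eventually.of_forall fun _ => rfl⟩

lemma continuous_pullbackGroupoid_inv : Continuous (pullbackGroupoid Γ f).inv :=
  continuous_iff_continuousAt.mpr fun r => PullbackArr.tendsto_iff.mpr
    ⟨PullbackArr.continuous_tgt.tendsto r, PullbackArr.continuous_src.tendsto r,
      (PullbackArr.eventually_elt_eq r).mono fun _ h => congrArg (·⁻¹) h⟩

open Classical in
lemma continuousOn_pullbackGroupoid_mul :
    ContinuousOn (fun r : PullbackArr Γ f × PullbackArr Γ f =>
      if w : (pullbackGroupoid Γ f).src r.1 = (pullbackGroupoid Γ f).tgt r.2 then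
        (pullbackGroupoid Γ f).mul r.1 r.2 w else r.1)
      {r | (pullbackGroupoid Γ f).src r.1 = (pullbackGroupoid Γ f).tgt r.2} := by
  rintro ⟨r, s⟩ w
  have w : (pullbackGroupoid Γ f).src r = (pullbackGroupoid Γ f).tgt s := w
  let S := {r : PullbackArr Γ f × PullbackArr Γ f |
    (pullbackGroupoid Γ f).src r.1 = (pullbackGroupoid Γ f).tgt r.2}
  let μ : PullbackArr Γ f × PullbackArr Γ f → PullbackArr Γ f := fun r =>
    if w : (pullbackGroupoid Γ f).src r.1 = (pullbackGroupoid Γ f).tgt r.2 then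
      (pullbackGroupoid Γ f).mul r.1 r.2 w else r.1
  have hμ : ∀ t (w : t ∈ S), μ t = (pullbackGroupoid Γ f).mul t.1 t.2 w := fun t w => dif_pos w
  have h1 : Tendsto Prod.fst (𝓝[S] (r, s)) (𝓝 r) := continuous_fst.continuousWithinAt
  have h2 : Tendsto Prod.snd (𝓝[S] (r, s)) (𝓝 s) := continuous_snd.continuousWithinAt
  change Tendsto μ (𝓝[S] (r, s)) (𝓝 (μ (r, s)))
  rw [hμ _ w]
  refine PullbackArr.tendsto_iff.mpr ⟨?_, ?_, ?_⟩
  · refine ((PullbackArr.continuous_src.tendsto s).comp h2).congr' ?_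
    filter_upwards [self_mem_nhdsWithin] with t ht
    rw [hμ t ht]
    rfl
  · refine ((PullbackArr.continuous_tgt.tendsto r).comp h1).congr' ?_
    filter_upwards [self_mem_nhdsWithin] with t ht
    rw [hμ t ht]
    rfl
  · filter_upwards [self_mem_nhdsWithin, h1.eventually (PullbackArr.eventually_elt_eq r),
      h2.eventually (PullbackArr.eventually_elt_eq s)] with t ht h3 h4
    rw [hμ t ht]
    exact congrArg₂ (· * ·) h3 h4

end Pullback

/-! ### The Lie groupoid structure of the pullback -/

section PullbackDevelopable

variable {d q : ℕ} {X X' M : Type u}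
  [TopologicalSpace X] [ChartedSpace (RR (d + q)) X]
  [TopologicalSpace X'] [ChartedSpace (RR (d + q)) X']
  [TopologicalSpace M] [ChartedSpace (RR q) M] [IsManifold 𝓘(ℝ, RR q) ∞ M]
  {F : Foliation d q X} {p : X' → X} {hp : IsSmoothCover (d + q) p}
  {f : X' → M} (hf : IsDevelopingMap F p hp f)

lemma isLocalDiffeomorphAt_comp_smul {γ : EffDeckGroup hf} {κ : M → RR q} {m : M}
    (hκ : IsLocalDiffeomorphAt 𝓘(ℝ, RR q) 𝓘(ℝ, RR q) ∞ κ (γ • m)) :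
    IsLocalDiffeomorphAt 𝓘(ℝ, RR q) 𝓘(ℝ, RR q) ∞ (fun m => κ (γ • m)) m := by
  refine IsLocalDiffeomorphAt.comp (g := κ) (f := fun m => γ • m) 𝓘(ℝ, RR q) (RR q)
    ⟨⟨(MulAction.toPerm γ).toPartialEquiv, isOpen_univ, isOpen_univ,
      (contMDiff_effDeckGroup_smul hf γ).contMDiffOn,
      (contMDiff_effDeckGroup_smul hf γ⁻¹).contMDiffOn⟩, mem_univ _, fun _ _ => rfl⟩ hκ

lemma PullbackArr.isTransverseAt_src (r : PullbackArr (EffDeckGroup hf) f) :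
    (F.comap p hp.isLocalDiffeomorph).IsTransverseAt
      (fun x => chartAt (RR q) (f r.tgt) (r.elt • f x)) r.src :=
  hf.isTransverseAt (isLocalDiffeomorphAt_comp_smul hf (by
    rw [r.smul_eq]; exact isLocalDiffeomorphAt_chartAt _))

/-- With the group element `γ` of `r` frozen, the condition `γ • f x = f y` is, in a chart `κ` of
`M`, the equation `κ (γ • f x) = κ (f y)` between two transverse coordinates. The conditions agree
near the ends of `r`, where `κ` is injective. -/
lemma locallyFibred_pullbackGroupoid : (F.comap p hp.isLocalDiffeomorph).LocallyFibred
    (pullbackGroupoid (EffDeckGroup hf) f).src (pullbackGroupoid (EffDeckGroup hf) f).tgt := by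
  classical
  refine ⟨PullbackArr.continuous_src, PullbackArr.continuous_tgt, fun r => ?_⟩
  let κ := chartAt (RR q) (f r.tgt)
  let a : X' → RR q := fun x => κ (r.elt • f x)
  let b : X' → RR q := κ ∘ f
  let ρ : X' × X' → PullbackArr (EffDeckGroup hf) f := fun p =>
    if w : r.elt • f p.1 = f p.2 then ⟨p.1, p.2, r.elt, w⟩ else r
  have hκs : f r.tgt ∈ κ.source := mem_chart_source _ _
  have hev : ∀ᶠ p in 𝓝[{p : X' × X' | a p.1 = b p.2}] (r.src, r.tgt), r.elt • f p.1 = f p.2 := by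
    have h1 : Continuous fun p : X' × X' => r.elt • f p.1 :=
      (contMDiff_effDeckGroup_smul hf r.elt).continuous.comp
        (hf.smooth.continuous.comp continuous_fst)
    have h2 : Continuous fun p : X' × X' => f p.2 := hf.smooth.continuous.comp continuous_snd
    filter_upwards [self_mem_nhdsWithin, nhdsWithin_le_nhds (h1.continuousAt.eventually
      (κ.open_source.mem_nhds (x := r.elt • f r.src) (by rw [r.smul_eq]; exact hκs))),
      nhdsWithin_le_nhds (h2.continuousAt.eventually (κ.open_source.mem_nhds hκs))] with p h3 h4 h5
    exact κ.injOn h4 h5 h3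
  refine ⟨a, b, ρ, r.isTransverseAt_src hf, hf.isTransverseAt (isLocalDiffeomorphAt_chartAt _),
    ?_, ?_⟩
  · filter_upwards [PullbackArr.eventually_elt_eq r] with s hs
    have hs' : r.elt • f s.src = f s.tgt := by rw [← hs]; exact s.smul_eq
    refine ⟨congrArg κ hs', ?_⟩
    change (if w : r.elt • f s.src = f s.tgt then (⟨s.src, s.tgt, r.elt, w⟩ : PullbackArr _ f)
      else r) = s
    rw [dif_pos hs']
    exact PullbackArr.ext rfl rfl hs.symm
  · filter_upwards [eventually_eventually_nhdsWithin.mpr hev, hev] with p hp hp₀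
    have hρ : ∀ p (w : r.elt • f p.1 = f p.2), ρ p = ⟨p.1, p.2, r.elt, w⟩ := fun p w => dif_pos w
    refine ⟨by rw [hρ p hp₀]; rfl, by rw [hρ p hp₀]; rfl, ?_⟩
    refine PullbackArr.tendsto_iff.mpr ⟨?_, ?_, ?_⟩
    · rw [hρ p hp₀]
      exact Tendsto.congr' (hp.mono fun t ht => (congrArg PullbackArr.src (hρ t ht)).symm)
        continuous_fst.continuousWithinAt
    · rw [hρ p hp₀]
      exact Tendsto.congr' (hp.mono fun t ht => (congrArg PullbackArr.tgt (hρ t ht)).symm)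
        continuous_snd.continuousWithinAt
    · exact hp.mono fun t ht => by rw [hρ t ht, hρ p hp₀]

variable [T2Space X'] [SecondCountableTopology X'] [IsManifold 𝓘(ℝ, RR (d + q)) ∞ X']

lemma isLie_pullbackGroupoid [ChartedSpace (RR (d + d + q)) (PullbackArr (EffDeckGroup hf) f)]
    (hA : atlas (RR (d + d + q)) (PullbackArr (EffDeckGroup hf) f) = Foliation.fibredAtlas d q
      (pullbackGroupoid (EffDeckGroup hf) f).src (pullbackGroupoid (EffDeckGroup hf) f).tgt) :
    (pullbackGroupoid (EffDeckGroup hf) f).IsLie (d + q) (d + d + q) :=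
  (locallyFibred_pullbackGroupoid hf).isLie hA (fun _ => inferInstance) (fun _ => inferInstance)
    continuous_pullbackGroupoid_one continuous_pullbackGroupoid_inv
    continuousOn_pullbackGroupoid_mul

end PullbackDevelopable

/-! ### The functor to the holonomy groupoid -/

section HolonomyFunctor

open Foliation

variable {d q : ℕ} {X X' M : Type u}
  [TopologicalSpace X] [ChartedSpace (RR (d + q)) X]
  [TopologicalSpace X'] [ChartedSpace (RR (d + q)) X']
  [TopologicalSpace M] [ChartedSpace (RR q) M] [IsManifold 𝓘(ℝ, RR q) ∞ M]
  {F : Foliation d q X} {p : X' → X} {hp : IsSmoothCover (d + q) p}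
  {f : X' → M} (hf : IsDevelopingMap F p hp f)

omit [TopologicalSpace M] [ChartedSpace (RR q) M] [IsManifold 𝓘(ℝ, RR q) ∞ M] in
lemma isLeafwise_of_lift {x₀ y₀ : X} {x y : X'} {γ : Path x₀ y₀} {δ : Path x y}
    (hγδ : ∀ t, p (δ t) = γ t) (hδ : (F.comap p hp.isLocalDiffeomorph).IsLeafwise δ) :
    F.IsLeafwise γ := by
  refine isLeafwise_of_eventually fun t => ?_
  obtain ⟨a, ha⟩ := F.exists_isTransverseAt (γ t)
  refine ⟨a, ha, ?_⟩
  filter_upwards [hδ.eventually_eq t ((by rwa [hγδ] : F.IsTransverseAt a (p (δ t))).comp_cover hp)]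
    with τ hτ
  rwa [Function.comp_apply, Function.comp_apply, hγδ, hγδ] at hτ

omit [TopologicalSpace M] [ChartedSpace (RR q) M] [IsManifold 𝓘(ℝ, RR q) ∞ M] in
lemma isLeafwise_lift {x₀ y₀ : X} {x y : X'} {γ : Path x₀ y₀} {δ : Path x y}
    (hγδ : ∀ t, p (δ t) = γ t) (hγ : F.IsLeafwise γ) :
    (F.comap p hp.isLocalDiffeomorph).IsLeafwise δ := by
  refine isLeafwise_of_eventually fun t => ?_
  obtain ⟨a, ha⟩ := F.exists_isTransverseAt (γ t)
  refine ⟨a ∘ p, (by rwa [hγδ] : F.IsTransverseAt a (p (δ t))).comp_cover hp, ?_⟩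
  filter_upwards [hγ.eventually_eq t ha] with τ hτ
  rwa [Function.comp_apply, Function.comp_apply, hγδ, hγδ]

include hf in
/-- The holonomy of a path in `X` with a leafwise lift to the cover. -/
lemma IsDevelopingMap.transports {x₀ y₀ : X} {x y : X'} {γ : Path x₀ y₀} {δ : Path x y}
    (hγδ : ∀ t, p (δ t) = γ t) (hδ : (F.comap p hp.isLocalDiffeomorph).IsLeafwise δ)
    {κ : M → RR q} (hκ : IsLocalDiffeomorphAt 𝓘(ℝ, RR q) 𝓘(ℝ, RR q) ∞ κ (f x)) :
    F.Transports γ (κ ∘ f ∘ hp.germInv x) (κ ∘ f ∘ hp.germInv y) := by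
  -- The continuation reads `κ ∘ f` through the local inverse of `p` at the moving point of the
  -- lift. It stays transverse because `f` is constant along `δ`.
  refine ⟨fun t => κ ∘ f ∘ hp.germInv (δ t), ⟨fun t => ?_, fun t => ?_⟩, ?_, ?_⟩
  · rw [← hγδ]
    exact (hf.isTransverseAt (by rwa [hf.map_path_eq hδ t])).comp_germInv hp
  · filter_upwards [δ.continuous.continuousAt.eventually
      (hp.eventually_germInv_eq_germInv (δ t))] with τ hτ
    rw [← hγδ]
    exact hτ.symm.fun_comp (κ ∘ f)
  · change κ ∘ f ∘ hp.germInv (δ 0) =ᶠ[𝓝 x₀] _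
    rw [δ.source]
  · change κ ∘ f ∘ hp.germInv (δ 1) =ᶠ[𝓝 y₀] _
    rw [δ.target]

lemma germInv_deckGroup {γ : X' ≃ₜ X'} (hγ : γ ∈ deckGroup p) (x : X') :
    γ ∘ hp.germInv x =ᶠ[𝓝 (p x)] hp.germInv (γ x) := by
  have hγx : p (γ x) = p x := hγ x
  rw [← hγx]
  refine hp.eventually_germInv_eq ?_ ?_
  · rw [hγx]
    exact (γ.continuous.tendsto x).comp (hp.tendsto_germInv x)
  · rw [hγx]
    filter_upwards [hp.eventually_apply_germInv x] with z hz
    exact (hγ _).trans hz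

omit [IsManifold 𝓘(ℝ, RR q) ∞ M] in
lemma IsDevelopingMap.smul_comp_germInv (γ : deckGroup p) (x : X') :
    (fun z => (show EffDeckGroup hf from QuotientGroup.mk γ) • f (hp.germInv x z)) =ᶠ[𝓝 (p x)]
      f ∘ hp.germInv (γ.1 x) := by
  filter_upwards [germInv_deckGroup (hp := hp) γ.2 x] with z hz
  rw [Function.comp_apply, ← hz]
  exact effDeckGroup_smul hf γ _

/-- The arrow `h` of the holonomy groupoid is the image of the arrow `r`. -/
structure Represents (r : PullbackArr (EffDeckGroup hf) f) (h : F.HolArr) : Prop where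
  src_eq : h.1 = p r.src
  tgt_eq : h.2.1 = p r.tgt
  carries : ∀ κ : M → RR q, IsLocalDiffeomorphAt 𝓘(ℝ, RR q) 𝓘(ℝ, RR q) ∞ κ (f r.tgt) →
    h.Carries (fun x => κ (r.elt • f (hp.germInv r.src x))) (κ ∘ f ∘ hp.germInv r.tgt)

/-- Represent the group element by a deck transformation `γ`. Then `γ x` and `y` lie on one leaf,
and the projection of a leafwise path from `γ x` to `y` starts at `p (γ x) = p x`. Its holonomy is
given by the local inverse of `p` at `γ x`, which is `γ` composed with the one at `x`; this brings
in the action on `M`. -/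
lemma exists_represents (r : PullbackArr (EffDeckGroup hf) f) : ∃ h, Represents hf r h := by
  obtain ⟨x, y, γ, hr⟩ := r
  obtain ⟨γ, rfl⟩ := QuotientGroup.mk_surjective γ
  have hfy : f y = f (γ.1 x) := hr.symm.trans (effDeckGroup_smul hf γ x)
  have hmem : y ∈ (F.comap p hp.isLocalDiffeomorph).leaf (γ.1 x) := by
    rw [← hf.fiber_eq_leaf]; exact hfy
  obtain ⟨⟨δ, hδ⟩⟩ := hmem
  have hγx : p (γ.1 x) = p x := γ.2 x
  refine ⟨HolArr.mk ((δ.map hp.continuous).cast hγx.symm rfl)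
    (isLeafwise_of_lift (hp := hp) (δ := δ) (fun _ => rfl) hδ), rfl, rfl, fun κ hκ => ?_⟩
  have h := hf.transports (γ := (δ.map hp.continuous).cast hγx.symm rfl) (δ := δ) (fun _ => rfl) hδ
    (by rwa [← hfy])
  exact HolArr.carries_mk.mpr (h.congr ((hf.smul_comp_germInv γ x).symm.fun_comp κ)
    EventuallyEq.rfl)

variable {hf}

lemma Represents.unique {r : PullbackArr (EffDeckGroup hf) f} {h h' : F.HolArr}
    (H : Represents hf r h) (H' : Represents hf r h') : h = h' :=
  HolArr.ext_of_carries (H.src_eq.trans H'.src_eq.symm) (H.tgt_eq.trans H'.tgt_eq.symm)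
    (H.carries _ (isLocalDiffeomorphAt_chartAt _)) (H'.carries _ (isLocalDiffeomorphAt_chartAt _))

omit [IsManifold 𝓘(ℝ, RR q) ∞ M] in
lemma represents_one (x : X') :
    Represents hf ((pullbackGroupoid (EffDeckGroup hf) f).one x)
      (F.holonomyGroupoid.one (p x)) := by
  refine ⟨rfl, rfl, fun κ hκ => ?_⟩
  refine (HolArr.carries_one ((hf.isTransverseAt hκ).comp_germInv hp)).congr ?_ EventuallyEq.rfl
  refine Eventually.of_forall fun z => ?_
  exact congrArg κ (one_smul (EffDeckGroup hf) (f (hp.germInv x z))).symm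

/-- For the first arrow `k` the test coordinate is `κ` precomposed with the action of `r.elt`. The
germ at which `k` ends is then the germ at which `h` starts, and the carried pairs compose. -/
lemma Represents.mul {r s : PullbackArr (EffDeckGroup hf) f} {h k : F.HolArr}
    (H : Represents hf r h) (K : Represents hf s k)
    (w : (pullbackGroupoid (EffDeckGroup hf) f).src r =
      (pullbackGroupoid (EffDeckGroup hf) f).tgt s)
    (w' : F.holonomyGroupoid.src h = F.holonomyGroupoid.tgt k) :
    Represents hf ((pullbackGroupoid (EffDeckGroup hf) f).mul r s w)
      (F.holonomyGroupoid.mul h k w') := by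
  refine ⟨(F.holonomyGroupoid.src_mul _ _ _).trans K.src_eq,
    (F.holonomyGroupoid.tgt_mul _ _ _).trans H.tgt_eq, fun κ hκ => ?_⟩
  have w : r.src = s.tgt := w
  have h1 := H.carries κ hκ
  have h2 := K.carries (fun m => κ (r.elt • m)) (isLocalDiffeomorphAt_comp_smul hf (by
    rw [← w, r.smul_eq]; exact hκ))
  rw [w] at h1
  have h3 := HolArr.Carries.mul w' h2 h1
  refine h3.congr (Eventually.of_forall fun z => ?_) EventuallyEq.rfl
  exact congrArg κ (mul_smul r.elt s.elt _).symm

/-- Fullness. Lift the path to the cover, starting at `x`. The lift ends over `p y`, so the Galois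
property gives a deck transformation `η` taking its end to `y`. The arrow is `x`, `y` and the class
of `η`, since `η x` lies in the fibre of `f` through `y`. -/
lemma Represents.exists_of_holArr (hG : IsGaloisCover p) {x y : X'} {h : F.HolArr} (hx : h.1 = p x)
    (hy : h.2.1 = p y) : ∃ r, r.src = x ∧ r.tgt = y ∧ Represents hf r h := by
  obtain ⟨γ, hγ, hh⟩ := h.exists_path
  let δ₀ := hp.isCoveringMap.liftPath γ.toContinuousMap x (γ.source.trans hx)
  have hδ₀ : ∀ t, p (δ₀ t) = γ t := fun t => congrFun (hp.isCoveringMap.liftPath_lifts _ _ _) t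
  let δ : Path x (δ₀ 1) := ⟨δ₀, hp.isCoveringMap.liftPath_zero _ _ _, rfl⟩
  have hδ : (F.comap p hp.isLocalDiffeomorph).IsLeafwise δ :=
    isLeafwise_lift (hp := hp) (γ := γ) (δ := δ) hδ₀ hγ
  have hp1 : p (δ₀ 1) = p y := (hδ₀ 1).trans (γ.target.trans hy)
  obtain ⟨η, hη, hηy⟩ := hG _ _ hp1
  let η' : deckGroup p := ⟨η, hη⟩
  have hfx : f (δ₀ 1) = f x := hf.map_eq_of_isLeafwise hδ
  have hηx : f (η x) = f y := by rw [← hηy]; exact hf.deck_congr hη hfx.symm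
  refine ⟨⟨x, y, (show EffDeckGroup hf from QuotientGroup.mk η'),
    (effDeckGroup_smul hf η' x).trans hηx⟩, rfl, rfl, hx, hy, fun κ hκ => ?_⟩
  have h1 := hf.transports (γ := γ) (δ := δ) hδ₀ hδ
    (κ := fun m => κ ((show EffDeckGroup hf from QuotientGroup.mk η') • m))
    (isLocalDiffeomorphAt_comp_smul hf (by
      rw [effDeckGroup_smul hf η' x]
      change IsLocalDiffeomorphAt _ _ _ κ (f (η x))
      rwa [hηx]))
  refine ((hh _ _).mpr h1).congr EventuallyEq.rfl ?_
  have h2 := (hf.smul_comp_germInv η' (δ₀ 1)).fun_comp κ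
  rw [hp1, ← hy, show η'.1 (δ₀ 1) = y from hηy] at h2
  exact h2

/-- Faithfulness, and the place where the metric is needed. The germ at `p x` that is carried to the
given germ at `p y` is unique, which forces `γ` and `γ'` to agree near `f x`. Then `γ'⁻¹ * γ` acts
trivially near a point, hence is trivial. -/
lemma Represents.elt_eq [IsManifold 𝓘(ℝ, RR (d + q)) ∞ X] [T2Space X] [T2Space M]
    [ConnectedSpace X'] (g : TransverseMetric F) {r s : PullbackArr (EffDeckGroup hf) f}
    {h : F.HolArr} (H : Represents hf r h) (K : Represents hf s h) (hs : r.src = s.src)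
    (ht : r.tgt = s.tgt) : r = s := by
  refine PullbackArr.ext hs ht ?_
  obtain ⟨x, y, γ, hr⟩ := r
  obtain ⟨x', y', γ', hr'⟩ := s
  obtain rfl : x = x' := hs
  obtain rfl : y = y' := ht
  change γ = γ'
  let κ := chartAt (RR q) (f y)
  have hκs : f y ∈ κ.source := mem_chart_source _ _
  have h1 : (fun z => κ (γ • f (hp.germInv x z))) =ᶠ[𝓝 h.1]
      (fun z => κ (γ' • f (hp.germInv x z))) :=
    (H.carries κ (isLocalDiffeomorphAt_chartAt _)).left_unique
      (K.carries κ (isLocalDiffeomorphAt_chartAt _))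
  rw [H.src_eq] at h1
  have hev : ∀ (γ : EffDeckGroup hf), γ • f x = f y → ∀ᶠ z in 𝓝 x, γ • f z ∈ κ.source :=
    fun γ hγ => ((contMDiff_effDeckGroup_smul hf γ).continuous.comp
      hf.smooth.continuous).continuousAt.eventually (κ.open_source.mem_nhds (x := γ • f x)
        (by rw [hγ]; exact hκs))
  have h2 : ∀ᶠ z in 𝓝 x, γ • f z = γ' • f z := by
    filter_upwards [hp.continuous.continuousAt.eventually h1, hp.eventually_germInv_apply x,
      hev γ hr, hev γ' hr'] with z h3 h4 h5 h6
    rw [h4] at h3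
    exact κ.injOn h5 h6 h3
  -- Openness of `f` turns agreement along `f` near `x` into agreement on a neighbourhood in `M`.
  have h3 : ∀ᶠ m in 𝓝 (f x), γ • m = γ' • m := hf.isOpenMap.nhds_le x h2
  have h4 : γ'⁻¹ * γ = 1 := g.eq_one_of_eventually hf (h3.mono fun m hm => by
    rw [mul_smul, hm, inv_smul_smul])
  exact (inv_mul_eq_one.mp h4).symm

variable (hf)

/-- The arrow of the holonomy groupoid given by an arrow of the pullback of `Γ_eff ⋉ M`. -/
def holMap (r : PullbackArr (EffDeckGroup hf) f) : F.HolArr := (exists_represents hf r).choose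

lemma represents_holMap (r : PullbackArr (EffDeckGroup hf) f) : Represents hf r (holMap hf r) :=
  (exists_represents hf r).choose_spec

lemma isFunctor_holMap :
    (pullbackGroupoid (EffDeckGroup hf) f).IsFunctor F.holonomyGroupoid p (holMap hf) where
  src_map r := (represents_holMap hf r).src_eq
  tgt_map r := (represents_holMap hf r).tgt_eq
  map_one x := (represents_holMap hf _).unique (represents_one x)
  map_mul r s w := (represents_holMap hf _).unique
    ((represents_holMap hf r).mul (represents_holMap hf s) w _)

/-- Near `r` the group element is constant, and the local inverses of `p` at the ends of `s` have
the germs of those at the ends of `r`. The nearby images therefore carry the same pair of germs. -/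
lemma continuous_holMap : Continuous (holMap hf) := by
  refine continuous_iff_continuousAt.mpr fun r => ?_
  have hκ := isLocalDiffeomorphAt_chartAt (q := q) (f r.tgt)
  refine ((represents_holMap hf r).carries _ hκ).tendsto_iff.mpr ⟨?_, ?_, ?_⟩
  · rw [(represents_holMap hf r).src_eq]
    refine ((hp.continuous.comp PullbackArr.continuous_src).tendsto r).congr fun s => ?_
    exact (represents_holMap hf s).src_eq.symm
  · rw [(represents_holMap hf r).tgt_eq]
    refine ((hp.continuous.comp PullbackArr.continuous_tgt).tendsto r).congr fun s => ?_
    exact (represents_holMap hf s).tgt_eq.symm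
  · filter_upwards [r.eventually_elt_eq, PullbackArr.continuous_tgt.continuousAt.eventually
      (hf.smooth.continuous.continuousAt.eventually hκ.eventually_isLocalDiffeomorphAt),
      PullbackArr.continuous_src.continuousAt.eventually
        (hp.eventually_germInv_eq_germInv r.src),
      PullbackArr.continuous_tgt.continuousAt.eventually
        (hp.eventually_germInv_eq_germInv r.tgt)] with s h1 h2 h3 h4
    refine ((represents_holMap hf s).carries _ h2).congr ?_ ?_
    · rw [(represents_holMap hf s).src_eq, ← h1]
      exact h3.symm.fun_comp fun z => chartAt (RR q) (f r.tgt) (s.elt • f z)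
    · rw [(represents_holMap hf s).tgt_eq]
      exact h4.symm.fun_comp (chartAt (RR q) (f r.tgt) ∘ f)

end HolonomyFunctor

/-! ### The two Morita maps -/

lemma bijective_mapQ {E E' : Type*} [AddCommGroup E] [Module ℝ E] [AddCommGroup E'] [Module ℝ E']
    {P : Submodule ℝ E} {Q : Submodule ℝ E'} {L : E →ₗ[ℝ] E'} (hL : Function.Surjective L)
    (h : ∀ v, v ∈ P ↔ L v ∈ Q) : ∃ w : P ≤ Q.comap L, Function.Bijective (P.mapQ Q L w) := by
  refine ⟨fun v hv => (h v).mp hv, ?_, ?_⟩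
  · refine LinearMap.ker_eq_bot.mp ((Submodule.eq_bot_iff _).mpr ?_)
    rw [Submodule.ker_mapQ]
    rintro _ ⟨v, hv, rfl⟩
    exact (Submodule.Quotient.mk_eq_zero P).mpr ((h v).mpr hv)
  · intro y
    obtain ⟨y, rfl⟩ := Q.mkQ_surjective y
    obtain ⟨x, rfl⟩ := hL y
    exact ⟨P.mkQ x, rfl⟩

/-! ### A criterion for Morita maps -/

namespace Gpd

section Morita

variable {B A B' A' : Type u} {G : Gpd B A} {G' : Gpd B' A'}
  [TopologicalSpace B] [TopologicalSpace B'] {f : B → B'} {φ : A → A'}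

/-- A full functor with an open continuous surjection of objects induces a homeomorphism of orbit
spaces. -/
lemma IsFunctor.isHomeomorph_orbitMap (H : IsFunctor G G' f φ) (hc : Continuous f)
    (ho : IsOpenMap f) (hs : Function.Surjective f)
    (hfull : ∀ x y h, G'.src h = f x → G'.tgt h = f y → ∃ g, G.src g = x ∧ G.tgt g = y) :
    IsHomeomorph H.orbitMap := by
  have hmk : ∀ x, H.orbitMap (Quotient.mk _ x) = Quotient.mk _ (f x) := fun _ => rfl
  refine ⟨?_, ?_, ?_, ?_⟩
  · exact continuous_quot_lift _ (continuous_quotient_mk'.comp hc)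
  · intro U hU
    have hV : IsOpen (Quotient.mk G.orbitSetoid ⁻¹' U) := hU.preimage continuous_quotient_mk'
    -- Openness on orbit spaces is tested on objects. Fullness is what makes the `f`-image of a
    -- saturated set saturated.
    have h : Quotient.mk G'.orbitSetoid ⁻¹' (H.orbitMap '' U) =
        f '' (Quotient.mk G.orbitSetoid ⁻¹' U) := by
      ext y
      constructor
      · rintro ⟨u, hu, huy⟩
        obtain ⟨y, rfl⟩ := hs y
        obtain ⟨x, rfl⟩ := Quotient.exists_rep u
        obtain ⟨h, h1, h2⟩ := Quotient.exact huy
        obtain ⟨g, h3, h4⟩ := hfull x y h h1 h2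
        refine ⟨y, ?_, rfl⟩
        have : Quotient.mk G.orbitSetoid x = Quotient.mk _ y := Quotient.sound ⟨g, h3, h4⟩
        rwa [mem_preimage, ← this]
      · rintro ⟨x, hx, rfl⟩
        exact ⟨_, hx, rfl⟩
    refine isQuotientMap_quotient_mk'.isOpen_preimage.mp ?_
    exact h ▸ ho _ hV
  · intro u v huv
    obtain ⟨x, rfl⟩ := Quotient.exists_rep u
    obtain ⟨y, rfl⟩ := Quotient.exists_rep v
    obtain ⟨h, h1, h2⟩ := Quotient.exact huv
    exact Quotient.sound (hfull x y h h1 h2)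
  · intro v
    obtain ⟨y, rfl⟩ := Quotient.exists_rep v
    obtain ⟨x, rfl⟩ := hs y
    exact ⟨Quotient.mk _ x, rfl⟩

variable {b a b' a' : ℕ} [ChartedSpace (RR b) B] [ChartedSpace (RR b') B']
  [TopologicalSpace A] [ChartedSpace (RR a) A] [TopologicalSpace A'] [ChartedSpace (RR a') A']

/-- A fully faithful smooth functor to a groupoid with discrete isotropy groups, whose map of
objects is an open surjective submersion, is a Morita map if it identifies the tangent spaces to the
orbits with the preimages of the tangent spaces to the orbits. -/
lemma IsFunctor.isMoritaMap (H : IsFunctor G G' f φ)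
    (hf : ContMDiff 𝓘(ℝ, RR b) 𝓘(ℝ, RR b') ∞ f) (hφ : ContMDiff 𝓘(ℝ, RR a) 𝓘(ℝ, RR a') ∞ φ)
    (ho : IsOpenMap f) (hs : Function.Surjective f)
    (hfull : ∀ x y h, G'.src h = f x → G'.tgt h = f y → ∃ g, G.src g = x ∧ G.tgt g = y ∧ φ g = h)
    (hfaithful : ∀ g g', G.src g = G.src g' → G.tgt g = G.tgt g' → φ g = φ g' → g = g')
    (hdisc : ∀ y, ∀ h ∈ G'.isotropy y, ∀ᶠ h' in 𝓝[G'.isotropy y] h, h' = h)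
    (hder : ∀ x, Function.Surjective (der (RR b) (RR b') f x))
    (horb : ∀ x v, v ∈ G.orbitTangent b a x ↔
      der (RR b) (RR b') f x v ∈ G'.orbitTangent b' a' (f x)) :
    IsMoritaMap b a b' a' G G' f φ where
  functor := H
  smooth_obj := hf
  smooth_arr := hφ
  orbit_homeo := H.isHomeomorph_orbitMap hf.continuous ho hs fun x y h h1 h2 =>
    let ⟨g, h3, h4, _⟩ := hfull x y h h1 h2
    ⟨g, h3, h4⟩
  isotropy_bij x := by
    refine ⟨fun g hg => ⟨?_, ?_⟩, fun g hg g' hg' h => ?_, fun h hh => ?_⟩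
    · rw [H.src_map, hg.1]
    · rw [H.tgt_map, hg.2]
    · exact hfaithful g g' (hg.1.trans hg'.1.symm) (hg.2.trans hg'.2.symm) h
    · obtain ⟨g, h1, h2, h3⟩ := hfull x x h hh.1 hh.2
      exact ⟨g, ⟨h1, h2⟩, h3⟩
  isotropy_smooth_inv x := by
    classical
    -- Any set-theoretic inverse is smooth on the isotropy group, because that group is discrete and
    -- the inverse is locally constant there. The unit is a dummy value off the image.
    let ψ : A' → A := fun h => if w : ∃ g ∈ G.isotropy x, φ g = h then w.choose else G.one x
    refine ⟨ψ, fun h hh => ?_, fun g hg => ?_⟩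
    · refine (contMDiffWithinAt_const (c := ψ h)).congr_of_eventuallyEq ?_ rfl
      exact (hdisc _ h hh).mono fun h' e => by rw [e]
    · have w : ∃ g' ∈ G.isotropy x, φ g' = φ g := ⟨g, hg, rfl⟩
      have hψ : ψ (φ g) = w.choose := dif_pos w
      obtain ⟨h1, h2⟩ := w.choose_spec
      rw [hψ]
      exact hfaithful _ _ (h1.1.trans hg.1.symm) (h1.2.trans hg.2.symm) h2
  normal_iso x := bijective_mapQ (hder x) (horb x)

end Morita

end Gpd

/-! ### The maps to the holonomy groupoid and to the action groupoid -/

section MoritaMaps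

open Foliation

variable {d q : ℕ} {X X' M : Type u}
  [TopologicalSpace X] [ChartedSpace (RR (d + q)) X]
  [TopologicalSpace X'] [ChartedSpace (RR (d + q)) X']
  [TopologicalSpace M] [ChartedSpace (RR q) M]
  {F : Foliation d q X} {p : X' → X} {hp : IsSmoothCover (d + q) p} {f : X' → M}

omit [TopologicalSpace M] [ChartedSpace (RR q) M] in
lemma Foliation.isTangent_comap_iff (z : X') (v : RR (d + q)) :
    (F.comap p hp.isLocalDiffeomorph).IsTangent z v ↔
      F.IsTangent (p z) (der (RR (d + q)) (RR (d + q)) p z v) := by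
  obtain ⟨a, ha⟩ := F.exists_isTransverseAt (p z)
  rw [(ha.comp_cover hp).isTangent_iff, ha.isTangent_iff,
    der_comp_apply ha.contMDiffAt (hp.isLocalDiffeomorph z).contMDiffAt]

omit [ChartedSpace (RR (d + q)) X'] [TopologicalSpace X'] in
-- The holonomy groupoid has discrete isotropy: an arrow near `h` carries the same pair of germs,
-- and with the same endpoints it must be `h`.
lemma Foliation.eventually_eq_of_mem_isotropy {x : X} {h : F.HolArr}
    (hh : h ∈ F.holonomyGroupoid.isotropy x) :
    ∀ᶠ h' in 𝓝[F.holonomyGroupoid.isotropy x] h, h' = h := by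
  obtain ⟨a, b, hab⟩ := h.exists_carries_pair
  filter_upwards [nhdsWithin_le_nhds (hab.eventually univ_mem univ_mem), self_mem_nhdsWithin]
    with h' h1 h2
  exact HolArr.ext_of_carries (h2.1.trans hh.1.symm) (h2.2.trans hh.2.symm) h1.1 hab

variable [IsManifold 𝓘(ℝ, RR q) ∞ M] (hf : IsDevelopingMap F p hp f)
  [ChartedSpace (RR (d + d + q)) (PullbackArr (EffDeckGroup hf) f)]
  (hA : atlas (RR (d + d + q)) (PullbackArr (EffDeckGroup hf) f) = Foliation.fibredAtlas d q
    (pullbackGroupoid (EffDeckGroup hf) f).src (pullbackGroupoid (EffDeckGroup hf) f).tgt)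

include hA

lemma isMoritaMap_holMap [IsManifold 𝓘(ℝ, RR (d + q)) ∞ X] [T2Space X] [T2Space M]
    [ConnectedSpace X'] (g : TransverseMetric F) (hG : IsGaloisCover p)
    [ChartedSpace (RR (d + d + q)) F.HolArr]
    (hA' : atlas (RR (d + d + q)) F.HolArr = F.holonomyAtlas) :
    Gpd.IsMoritaMap (d + q) (d + d + q) (d + q) (d + d + q)
      (pullbackGroupoid (EffDeckGroup hf) f) F.holonomyGroupoid p (holMap hf) := by
  have hps := hp.isLocalDiffeomorph.contMDiff
  refine (isFunctor_holMap hf).isMoritaMap hps (fun r => ?_) hp.isLocalDiffeomorph.isOpenMap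
    hp.surjective (fun x y h hx hy => ?_) (fun r s hs ht h => ?_)
    (fun _ _ => eventually_eq_of_mem_isotropy) (fun z => ?_) (fun z v => ?_)
  · refine contMDiffAt_of_atlas_eq (s := F.holonomyGroupoid.src) (t := F.holonomyGroupoid.tgt) hA'
      (continuous_holMap hf).continuousAt ?_ ?_
    · simp only [(isFunctor_holMap hf).src_map]
      exact (hps.comp (contMDiff_src_of_atlas_eq hA)) r
    · simp only [(isFunctor_holMap hf).tgt_map]
      exact (hps.comp (contMDiff_tgt_of_atlas_eq hA)) r
  · obtain ⟨r, h1, h2, h3⟩ := Represents.exists_of_holArr (hf := hf) hG hx hy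
    exact ⟨r, h1, h2, (represents_holMap hf r).unique h3⟩
  · exact (represents_holMap hf r).elt_eq g (h ▸ represents_holMap hf s) hs ht
  · obtain ⟨L, hL⟩ := exists_equiv_eq_der (hp.isLocalDiffeomorph z)
    rw [← hL]
    exact L.surjective
  · rw [(locallyFibred_pullbackGroupoid hf).mem_orbitTangent hA,
      F.locallyFibred_holonomyGroupoid.mem_orbitTangent hA', isTangent_comap_iff (hp := hp)]

/-- The arrow of `Γ_eff ⋉ M` given by an arrow of its pullback. -/
def PullbackArr.toActionArr (r : PullbackArr (EffDeckGroup hf) f) :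
    ActionArr (EffDeckGroup hf) M := .mk r.elt (f r.src)

omit [ChartedSpace (RR (d + d + q)) (PullbackArr (EffDeckGroup hf) f)]
  [IsManifold 𝓘(ℝ, RR q) ∞ M] hA in
lemma isFunctor_toActionArr : (pullbackGroupoid (EffDeckGroup hf) f).IsFunctor
    (actionGroupoid (EffDeckGroup hf) M) f (PullbackArr.toActionArr hf) where
  src_map _ := rfl
  tgt_map r := r.smul_eq
  map_one _ := rfl
  map_mul _ _ _ := rfl

/-- Full faithfulness is built into the pullback. On normal spaces, the orbits upstairs have the
leaf directions as tangent spaces, which are the kernel of the derivative of `f`, while the orbits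
in `M` have zero tangent spaces. -/
lemma isMoritaMap_toActionArr : Gpd.IsMoritaMap (d + q) (d + d + q) q q
    (pullbackGroupoid (EffDeckGroup hf) f) (actionGroupoid (EffDeckGroup hf) M) f
    (PullbackArr.toActionArr hf) := by
  refine (isFunctor_toActionArr hf).isMoritaMap hf.smooth (fun r => ?_) hf.isOpenMap
    hf.surjective (fun x y h hx hy => ?_) (fun r s hs ht h => ?_)
    (fun _ _ => mem_isotropy_actionGroupoid_eventually) hf.surjective_der (fun z v => ?_)
  · refine (((contMDiff_actionArr_mk r.elt).comp hf.smooth).comp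
      (contMDiff_src_of_atlas_eq hA) r).congr_of_eventuallyEq ?_
    filter_upwards [r.eventually_elt_eq] with s hs
    exact congrArg (ActionArr.mk · (f s.src)) hs
  · obtain ⟨γ, m⟩ := h
    obtain rfl : m = f x := hx
    exact ⟨⟨x, y, γ, hy⟩, rfl, rfl, rfl⟩
  · exact PullbackArr.ext hs ht (congrArg Prod.fst h)
  · rw [(locallyFibred_pullbackGroupoid hf).mem_orbitTangent hA, orbitTangent_actionGroupoid,
      isTangent_comap_iff (hp := hp), hf.isTangent_iff, Submodule.mem_bot]

end MoritaMaps

end FolGpd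

end

theorem corollary4p5 {d q : ℕ} {X X' M : Type u}
    [TopologicalSpace X] [ChartedSpace (RR (d + q)) X]
    [IsManifold 𝓘(ℝ, RR (d + q)) ∞ X] [T2Space X] [SecondCountableTopology X]
    [TopologicalSpace X'] [ChartedSpace (RR (d + q)) X']
    [IsManifold 𝓘(ℝ, RR (d + q)) ∞ X'] [T2Space X'] [SecondCountableTopology X']
    [ConnectedSpace X']
    [TopologicalSpace M] [ChartedSpace (RR q) M]
    [IsManifold 𝓘(ℝ, RR q) ∞ M] [T2Space M] [SecondCountableTopology M]
    (F : Foliation d q X) (g : TransverseMetric F)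
    (p : X' → X) (hp : IsSmoothCover (d + q) p) (hG : IsGaloisCover p)
    (f : X' → M) (hf : IsDevelopingMap F p hp f) :
    ∃ c : ChartedSpace (RR (d + d + q)) F.HolArr,
      c.atlas = F.holonomyAtlas ∧
      Gpd.MoritaEquivalent (d + q) (d + d + q) q q F.holonomyGroupoid
        (actionGroupoid (EffDeckGroup hf) M) := by
  -- Both arrow spaces get the charts for which source and target together form an immersion. For
  -- the holonomy groupoid this atlas is `holonomyAtlas` by definition, so the conditions on atlases
  -- below hold by `rfl`.
  let _ := F.locallyFibred_holonomyGroupoid.chartedSpace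
  let _ := (locallyFibred_pullbackGroupoid hf).chartedSpace
  exact ⟨F.locallyFibred_holonomyGroupoid.chartedSpace, rfl, Foliation.isLie_holonomyGroupoid rfl,
    isLie_actionGroupoid (contMDiff_effDeckGroup_smul hf), d + q, d + d + q, X',
    PullbackArr (EffDeckGroup hf) f, inferInstance, inferInstance, inferInstance, inferInstance,
    pullbackGroupoid (EffDeckGroup hf) f, isLie_pullbackGroupoid hf rfl,
    ⟨p, holMap hf, isMoritaMap_holMap hf rfl g hG rfl⟩,
    ⟨f, PullbackArr.toActionArr hf, isMoritaMap_toActionArr hf rfl⟩⟩
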